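/- **The calculus.** Polarities are $\epsilon ::= + \mid - \mid \square$; $\boxplus$ ranges over $\{+,\square\}$ and $\pm$ over $\{+,-\}$. Terms, up to renaming of bound variables $x,y$ and covariables $\alpha,\beta$, are $$\begin{array}{rl} \text{values} & V,W ::= x \mid (V,W) \mid \square V \mid () \mid \iota_1 V \mid \iota_2 V \mid \mu[x^\epsilon].c \mid \mu\langle\alpha_1^{\epsilon_1}.c_1;\alpha_2^{\epsilon_2}.c_2\rangle \mid \mu(\alpha^{\epsilon_1},\beta^{\epsilon_2}).c \mid \mu\alpha^-.c\\ \text{co-values} & S ::= \alpha \mid \pi_1 S \mid \pi_2 S \mid \tilde\mu\square x^\epsilon.c \mid [V] \mid (S,S') \mid \tilde\mu().c \mid \tilde\mu x^{\boxplus}.c \mid \tilde\mu(x^{\epsilon_1},y^{\epsilon_2}).c \mid \tilde\mu[x_1^{\epsilon_1}.c_1 | x_2^{\epsilon_2}.c_2]\\ \text{expressions} & t ::= V \mid \mu\alpha^{\boxplus}.c \qquad \text{environments}\quad e ::= S \mid \tilde\mu x^-.c\\ \text{commands} & c ::= \langle t | S\rangle^{\boxplus} \mid \langle V | e\rangle^-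 \end{array}$$ The relation $\vartriangleright$ (at the top level only) is given by: $\langle\mu\alpha^\epsilon.c|S\rangle^\epsilon \vartriangleright c[S/\alpha]$; $\langle V|\tilde\mu x^\epsilon.c\rangle^\epsilon\vartriangleright c[V/x]$; $\langle()|\tilde\mu().c\rangle^\square\vartriangleright c$; $\langle(V,W)|\tilde\mu(x^{\epsilon_1},y^{\epsilon_2}).c\rangle^\epsilon\vartriangleright c[V/x,W/y]$; $\langle\iota_iV|\tilde\mu[x_1^{\epsilon_1}.c_1|x_2^{\epsilon_2}.c_2]\rangle^\epsilon\vartriangleright c_i[V/x_i]$; $\langle\square V|\tilde\mu\square x^\epsilon.c\rangle^\square\vartriangleright c[V/x]$; $\langle\mu[x^\epsilon].c|[V]\rangle^-\vartriangleright c[V/x]$; $\langle\mu(\alpha^{\epsilon_1},\beta^{\epsilon_2}).c|(S,S')\rangle^-\vartriangleright c[S/\alpha,S'/\beta]$; $\langle\mu\langle\alpha_1^{\epsilon_1}.c_1;\alpha_2^{\epsilon_2}.c_2\rangle|\pi_iS\rangle^-\vartriangleright c_i[S/\alpha_i]$. **Types.** $A,B ::= \mathbb 1\mid A\otimes B\mid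 A\oplus B\mid\Box A\mid\neg A\mid A\mathbin{\&}B\mid A⅋B$. The polarity $\varpi$ is $\square$ for $\mathbb 1$ and $\Box A$; it is $-$ for $\neg A$, $A\mathbin{\&}B$, $A⅋B$; for $A\otimes B$ and $A\oplus B$ it is $\square$ if $\varpi(A)=\varpi(B)=\square$ and $+$ otherwise. $A$ is modal if $\varpi(A)=\square$; $A_\epsilon$ means that $\varpi(A)=\epsilon$. A context $(\Gamma\,¦\,\Theta\vdash\Delta)$ consists of lists of typed variables $\Gamma$ (ordinary), $\Theta$ (modal) and of typed covariables $\Delta$, all names being distinct; $\Gamma_\square$ is a $\Gamma$ whose types are all modal. The judgments $\Gamma¦\Theta\vdash V:A;\Delta$ and $\Gamma¦\Theta\vdash t:A\mid\Delta$ and $\Gamma¦\Theta;S:A\vdash\Delta$ and $\Gamma¦\Theta\mid e:A\vdash\Delta$ and $c:(\Gamma¦\Theta\vdash\Delta)$ are generated by the following rules. Below, $K$ stands for $(\Gamma¦\Theta\vdash\Delta)$; "in $K,K'$" means that the two premises are typed in disjoint contexts $K,K'$ and the conclusion in their concatenation; the other rules keep $K$ apart from the bound (co)variables shown. - Axioms: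 $x:A¦\diamond\vdash x:A;\diamond$, $\ \diamond¦x:A\vdash x:A;\diamond$, $\ \diamond¦\diamond;\alpha:A\vdash\alpha:A$. - Cuts, in $K,K'$: $\langle t|S\rangle^{\boxplus}$ from $t:A_\boxplus\mid$ and $S:A_\boxplus$ (with the same polarity $\boxplus$); $\langle V|e\rangle^-$ from $V:A_-$ and $e:A_-$. A value of type $A_\boxplus$ is an expression of this type, and a co-value of type $A_-$ is an environment of this type. - $\mu\alpha^\epsilon.c:A_\epsilon$ (an expression if $\epsilon=\boxplus$, a value if $\epsilon=-$) from $c$ with $\alpha:A_\epsilon$ added to $\Delta$; $\tilde\mu x^\epsilon.c:A_\epsilon$ (a co-value if $\epsilon=\boxplus$, an environment if $\epsilon=-$) from $c$ with $x:A_\epsilon$ added to $\Gamma$. - $\diamond¦\diamond\vdash():\mathbb1;\diamond$; $\ \tilde\mu().c:\mathbb1$ from $c$. $\ (V,W):A\otimes B$ in $K,K'$ from $V:A$, $W:B$; $\ \tilde\mu(x^{\epsilon_1},y^{\epsilon_2}).c:A_{\epsilon_1}\otimes B_{\epsilon_2}$ from $c$ with $x:A,y:B$ added to $\Gamma$. $\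 \iota_iV:A_1\oplus A_2$ from $V:A_i$; $\ \tilde\mu[x_1^{\epsilon_1}.c_1|x_2^{\epsilon_2}.c_2]:A_{\epsilon_1}\oplus B_{\epsilon_2}$ from $c_1$ with $x_1:A$ and $c_2$ with $x_2:B$ added to $\Gamma$. - $\mu(\alpha^{\epsilon_1},\beta^{\epsilon_2}).c:A_{\epsilon_1}⅋B_{\epsilon_2}$ from $c$ with $\alpha:A,\beta:B$ added to $\Delta$; $\ (S,S'):A⅋B$ in $K,K'$ from $S:A$, $S':B$. $\ \mu[x^\epsilon].c:\neg A_\epsilon$ from $c$ with $x:A$ added to $\Gamma$; $\ [V]:\neg A$ from $V:A$. $\ \mu\langle\alpha_1^{\epsilon_1}.c_1;\alpha_2^{\epsilon_2}.c_2\rangle:A_{\epsilon_1}\mathbin{\&}B_{\epsilon_2}$ from $c_1$ with $\alpha_1:A$ and $c_2$ with $\alpha_2:B$ added to $\Delta$; $\ \pi_iS:A_1\mathbin{\&}A_2$ from $S:A_i$. - $\Gamma_\square¦\Theta\vdash\square V:\Box A;\diamond$ from $\Gamma_\square¦\Theta\vdash V:A;\diamond$; $\ \tilde\mu\square x^\epsilon.c:\Box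 A_\epsilon$ from $c$ with $x:A_\epsilon$ added to $\Theta$. - All judgments are closed under type-preserving renamings of $\Gamma,\Theta,\Delta$ into $\Gamma',\Theta',\Delta'$ respectively. **The machine.** A memory $M=\langle H|\mathcal S\rangle$ consists of a heap $H$ (a list of equations $x^\epsilon:=V$) and a stack $\mathcal S$ (a list of frames of one or two equations $x^\pm:=V$ or $\alpha^\epsilon:=S$). $M(x)=^\epsilon V$ and $M(\alpha)=^\epsilon S$ mean that the equation occurs in $M$; then $\varpi(x)=\epsilon$, resp. $\varpi(\alpha)=\epsilon$. The toplevel continuation $tp$ is a fixed covariable, with $\varpi(tp)=\square$, which $M$ never defines. Allocation $M[x^\epsilon:=V]$ appends to the heap if $\epsilon=\square$ and a new frame to the stack otherwise; $M[\alpha^\epsilon:=S]$ appends a frame; a simultaneous allocation of two (co)variables puts the modal variables on the heap and the other equations in a single new frame. $M|_{@\alpha}$ removes the frame that defines $\alpha$ and all later frames. Evaluation $\Downarrow$ in $M$: $x\Downarrow V$ if $M(x)=^{\boxplus}V$, and $x\Downarrow x$ if $\varpi(x)=-$; $\alpha\Downarrow\alpha$ if $\varpi(\alpha)\in\{+,\square\}$,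 and $\alpha\Downarrow S$ if $M(\alpha)=^-S$; $\Downarrow$ is componentwise on $(V,W)$, $\iota_iV$, $\square V$, $()$, $\pi_iS$, $[V]$, $(S,S')$; every value $\mu\ldots$ and every co-value $\tilde\mu\ldots$ evaluates to itself. The steps $\rightsquigarrow$ are, where the bound (co)variables are first renamed to fresh ones (distinct from $tp$, not defined in $M$, not free in $M$ or in the command): - if $M(\alpha)=^+S$: $\ M\vDash\langle V|\alpha\rangle^+\rightsquigarrow M\vDash\langle V|S\rangle^+$; if $M(\alpha)=^\square S$: $\ M\vDash\langle V|\alpha\rangle^\square\rightsquigarrow M|_{@\alpha}\vDash\langle V|S\rangle^\square$; if $M(x)=^-V$: $\ M\vDash\langle x|S\rangle^-\rightsquigarrow M\vDash\langle V|S\rangle^-$; - if $S\Downarrow S'$: $\ M\vDash\langle\mu\alpha^\epsilon.c|S\rangle^\epsilon\rightsquigarrow M[\alpha^\epsilon:=S']\vDash c$; if $V\Downarrow V'$: $\ M\vDash\langle V|\tilde\mu x^\epsilon.c\rangle^\epsilon\rightsquigarrow M[x^\epsilon:=V']\vDash c$; - if $S\Downarrow[V]$: $\ M\vDash\langle\mu[x^\epsilon].c|S\rangle^-\rightsquigarrow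 M[x^\epsilon:=V]\vDash c$; if $S\Downarrow(S_1,S_2)$: $\ M\vDash\langle\mu(\alpha^{\epsilon_1},\beta^{\epsilon_2}).c|S\rangle^-\rightsquigarrow M[\alpha^{\epsilon_1}:=S_1,\beta^{\epsilon_2}:=S_2]\vDash c$; if $S\Downarrow\pi_iS'$: $\ M\vDash\langle\mu\langle\alpha_1^{\epsilon_1}.c_1;\alpha_2^{\epsilon_2}.c_2\rangle|S\rangle^-\rightsquigarrow M[\alpha_i^{\epsilon_i}:=S']\vDash c_i$; - if $V\Downarrow(V_1,V_2)$: $\ M\vDash\langle V|\tilde\mu(x^{\epsilon_1},y^{\epsilon_2}).c\rangle^\epsilon\rightsquigarrow M[x^{\epsilon_1}:=V_1,y^{\epsilon_2}:=V_2]\vDash c$; if $V\Downarrow\iota_iV'$: $\ M\vDash\langle V|\tilde\mu[x_1^{\epsilon_1}.c_1|x_2^{\epsilon_2}.c_2]\rangle^\epsilon\rightsquigarrow M[x_i^{\epsilon_i}:=V']\vDash c_i$; if $V\Downarrow()$: $\ M\vDash\langle V|\tilde\mu().c\rangle^\square\rightsquigarrow M\vDash c$; - if $V\Downarrow\square V'$: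 $\ \langle H|\mathcal S\rangle\vDash\langle V|\tilde\mu\square x^\epsilon.c\rangle^\square\rightsquigarrow\langle H,x^\epsilon:=V'|\mathcal S\rangle\vDash c$. For a heap $H=(x_1:=V_1,\dots,x_n:=V_n)$ put $V[H]=V[V_n/x_n]\cdots[V_1/x_1]$, where the substitutions are performed from left to right (the most recent equation first). **Theorem (Evaluation).** Let $R$ be a modal type and let $c:(\diamond\,¦\,\diamond\vdash tp:R)$. Then there is a value $V$ with $\diamond¦\diamond\vdash V:R;\diamond$ and $c\vartriangleright^*\langle V|tp\rangle^\square$, this $V$ being the only value with $c\vartriangleright^*\langle V|tp\rangle^\square$; and there are a value $V'$, a heap $H$ and a stack $\mathcal S$ such that $$(\langle\diamond|\diamond\rangle\vDash c)\rightsquigarrow^*(\langle H|\mathcal S\rangle\vDash\langle V'|tp\rangle^\square),$$ no variable or covariable defined in $\mathcal S$ is free in $V'$, and $V'[H]=V$. -/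

import Mathlib

namespace LBox

/-! ## Polarities, types and terms -/

/-- Positive polarities: `+` and the modal polarity `□`. -/
inductive PosPol : Type
  | plus
  | box

/-- Non-modal polarities: `+` and `-`. -/
inductive NonModalPol : Type
  | plus
  | minus

/-- The three polarities `+`, `-` and `□`. -/
inductive Pol : Type
  | plus
  | minus
  | box

def PosPol.toPol : PosPol → Pol
  | .plus => .plus
  | .box => .box

def NonModalPol.toPol : NonModalPol → Pol
  | .plus => .plus
  | .minus => .minus

/-- `none` on the modal polarity, the polarity itself on the non-modal ones. -/
def Pol.nonModal? : Pol → Option NonModalPol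
  | .plus => some .plus
  | .minus => some .minus
  | .box => none

/-- The polarity of a positive pair or of a sum. -/
def Pol.odot : Pol → Pol → Pol
  | .box, .box => .box
  | _, _ => .plus

/-- Types `𝟙`, `A ⊗ B`, `A ⊕ B`, `□A`, `¬A`, `A & B` and `A ⅋ B`. -/
inductive Ty : Type
  | one
  | tensor (A B : Ty)
  | plus (A B : Ty)
  | box (A : Ty)
  | not (A : Ty)
  | withT (A B : Ty)
  | par (A B : Ty)

/-- The polarity of a type. -/
def Ty.pol : Ty → Pol
  | .one => .box
  | .tensor A B => A.pol.odot B.pol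
  | .plus A B => A.pol.odot B.pol
  | .box _ => .box
  | .not _ => .minus
  | .withT _ _ => .minus
  | .par _ _ => .minus

/-- The syntactic classes: values, co-values, expressions, environments, commands. -/
inductive Cls : Type
  | val
  | coval
  | exp
  | env
  | cmd

/-- Terms up to renaming of bound (co)variables: variables and covariables are two separate
sorts of de Bruijn indices, which may be free.  A constructor that binds one (co)variable binds
the index `0` of its sort in its command; one that binds two of them binds the first one as `0`
and the second one as `1`. -/
inductive Tm : Cls → Type
  /-- `x` -/
  | var (x : ℕ) : Tm .val
  /-- `(V, W)` -/
  | pair (V W : Tm .val) : Tm .val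
  /-- `□ V` -/
  | box (V : Tm .val) : Tm .val
  /-- `()` -/
  | unit : Tm .val
  /-- `ι₁ V` -/
  | inl (V : Tm .val) : Tm .val
  /-- `ι₂ V` -/
  | inr (V : Tm .val) : Tm .val
  /-- `μ[x^ε]. c` -/
  | muNot (ε : Pol) (c : Tm .cmd) : Tm .val
  /-- the lazy record `μ⟨α^ε₁. c₁ ; β^ε₂. c₂⟩` -/
  | muWith (ε₁ : Pol) (c₁ : Tm .cmd) (ε₂ : Pol) (c₂ : Tm .cmd) : Tm .val
  /-- `μ(α^ε₁, β^ε₂). c` -/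
  | muPar (ε₁ ε₂ : Pol) (c : Tm .cmd) : Tm .val
  /-- `μα^-. c` -/
  | muNeg (c : Tm .cmd) : Tm .val
  /-- `α` -/
  | covar (α : ℕ) : Tm .coval
  /-- `π₁ S` -/
  | fst (S : Tm .coval) : Tm .coval
  /-- `π₂ S` -/
  | snd (S : Tm .coval) : Tm .coval
  /-- `μ̃□x^ε. c` -/
  | mutBox (ε : Pol) (c : Tm .cmd) : Tm .coval
  /-- `[V]` -/
  | conot (V : Tm .val) : Tm .coval
  /-- `(S, S')` -/
  | copair (S S' : Tm .coval) : Tm .coval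
  /-- `μ̃(). c` -/
  | mutUnit (c : Tm .cmd) : Tm .coval
  /-- `μ̃x^p. c`, with `p` a positive polarity -/
  | mutPos (p : PosPol) (c : Tm .cmd) : Tm .coval
  /-- `μ̃(x^ε₁, y^ε₂). c` -/
  | mutPair (ε₁ ε₂ : Pol) (c : Tm .cmd) : Tm .coval
  /-- `μ̃[x^ε₁. c₁ | y^ε₂. c₂]` -/
  | mutSum (ε₁ : Pol) (c₁ : Tm .cmd) (ε₂ : Pol) (c₂ : Tm .cmd) : Tm .coval
  /-- a value, as an expression -/
  | ofVal (V : Tm .val) : Tm .exp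
  /-- `μα^p. c`, with `p` a positive polarity -/
  | muPos (p : PosPol) (c : Tm .cmd) : Tm .exp
  /-- a co-value, as an environment -/
  | ofCoval (S : Tm .coval) : Tm .env
  /-- `μ̃x^-. c` -/
  | mutNeg (c : Tm .cmd) : Tm .env
  /-- `⟨t | S⟩^p`, with `p` a positive polarity -/
  | cutPos (p : PosPol) (t : Tm .exp) (S : Tm .coval) : Tm .cmd
  /-- `⟨V | e⟩^-` -/
  | cutNeg (V : Tm .val) (e : Tm .env) : Tm .cmd

abbrev Val := Tm .val
abbrev Coval := Tm .coval
abbrev Exp := Tm .exp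
abbrev Env := Tm .env
abbrev Cmd := Tm .cmd

/-! ## Renaming and substitution -/

/-- The sequence `a, f 0, f 1, …`. -/
def scons {X : Type} (a : X) (f : ℕ → X) : ℕ → X
  | 0 => a
  | n + 1 => f n

/-- A renaming pushed under one binder. -/
def up (f : ℕ → ℕ) : ℕ → ℕ := scons 0 (fun n => f n + 1)

/-- Renames the free variables by `f` and the free covariables by `g`. -/
def Tm.rename : {s : Cls} → Tm s → (ℕ → ℕ) → (ℕ → ℕ) → Tm s
  | _, .var x, f, _ => .var (f x)
  | _, .pair V W, f, g => .pair (V.rename f g) (W.rename f g)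
  | _, .box V, f, g => .box (V.rename f g)
  | _, .unit, _, _ => .unit
  | _, .inl V, f, g => .inl (V.rename f g)
  | _, .inr V, f, g => .inr (V.rename f g)
  | _, .muNot ε c, f, g => .muNot ε (c.rename (up f) g)
  | _, .muWith ε₁ c₁ ε₂ c₂, f, g => .muWith ε₁ (c₁.rename f (up g)) ε₂ (c₂.rename f (up g))
  | _, .muPar ε₁ ε₂ c, f, g => .muPar ε₁ ε₂ (c.rename f (up (up g)))
  | _, .muNeg c, f, g => .muNeg (c.rename f (up g))
  | _, .covar α, _, g => .covar (g α)
  | _, .fst S, f, g => .fst (S.rename f g)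
  | _, .snd S, f, g => .snd (S.rename f g)
  | _, .mutBox ε c, f, g => .mutBox ε (c.rename (up f) g)
  | _, .conot V, f, g => .conot (V.rename f g)
  | _, .copair S S', f, g => .copair (S.rename f g) (S'.rename f g)
  | _, .mutUnit c, f, g => .mutUnit (c.rename f g)
  | _, .mutPos p c, f, g => .mutPos p (c.rename (up f) g)
  | _, .mutPair ε₁ ε₂ c, f, g => .mutPair ε₁ ε₂ (c.rename (up (up f)) g)
  | _, .mutSum ε₁ c₁ ε₂ c₂, f, g => .mutSum ε₁ (c₁.rename (up f) g) ε₂ (c₂.rename (up f) g)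
  | _, .ofVal V, f, g => .ofVal (V.rename f g)
  | _, .muPos p c, f, g => .muPos p (c.rename f (up g))
  | _, .ofCoval S, f, g => .ofCoval (S.rename f g)
  | _, .mutNeg c, f, g => .mutNeg (c.rename (up f) g)
  | _, .cutPos p t S, f, g => .cutPos p (t.rename f g) (S.rename f g)
  | _, .cutNeg V e, f, g => .cutNeg (V.rename f g) (e.rename f g)

/-- A simultaneous substitution: values for the variables, co-values for the covariables. -/
structure Sub : Type where
  onVar : ℕ → Val
  onCovar : ℕ → Coval

/-- A substitution pushed under a binder of a variable. -/
def Sub.upVar (σ : Sub) : Sub where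
  onVar := scons (.var 0) (fun n => (σ.onVar n).rename Nat.succ id)
  onCovar := fun n => (σ.onCovar n).rename Nat.succ id

/-- A substitution pushed under a binder of a covariable. -/
def Sub.upCovar (σ : Sub) : Sub where
  onVar := fun n => (σ.onVar n).rename id Nat.succ
  onCovar := scons (.covar 0) (fun n => (σ.onCovar n).rename id Nat.succ)

/-- Capture-avoiding simultaneous substitution. -/
def Tm.subst : {s : Cls} → Tm s → Sub → Tm s
  | _, .var x, σ => σ.onVar x
  | _, .pair V W, σ => .pair (V.subst σ) (W.subst σ)
  | _, .box V, σ => .box (V.subst σ)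
  | _, .unit, _ => .unit
  | _, .inl V, σ => .inl (V.subst σ)
  | _, .inr V, σ => .inr (V.subst σ)
  | _, .muNot ε c, σ => .muNot ε (c.subst σ.upVar)
  | _, .muWith ε₁ c₁ ε₂ c₂, σ => .muWith ε₁ (c₁.subst σ.upCovar) ε₂ (c₂.subst σ.upCovar)
  | _, .muPar ε₁ ε₂ c, σ => .muPar ε₁ ε₂ (c.subst σ.upCovar.upCovar)
  | _, .muNeg c, σ => .muNeg (c.subst σ.upCovar)
  | _, .covar α, σ => σ.onCovar α
  | _, .fst S, σ => .fst (S.subst σ)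
  | _, .snd S, σ => .snd (S.subst σ)
  | _, .mutBox ε c, σ => .mutBox ε (c.subst σ.upVar)
  | _, .conot V, σ => .conot (V.subst σ)
  | _, .copair S S', σ => .copair (S.subst σ) (S'.subst σ)
  | _, .mutUnit c, σ => .mutUnit (c.subst σ)
  | _, .mutPos p c, σ => .mutPos p (c.subst σ.upVar)
  | _, .mutPair ε₁ ε₂ c, σ => .mutPair ε₁ ε₂ (c.subst σ.upVar.upVar)
  | _, .mutSum ε₁ c₁ ε₂ c₂, σ => .mutSum ε₁ (c₁.subst σ.upVar) ε₂ (c₂.subst σ.upVar)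
  | _, .ofVal V, σ => .ofVal (V.subst σ)
  | _, .muPos p c, σ => .muPos p (c.subst σ.upCovar)
  | _, .ofCoval S, σ => .ofCoval (S.subst σ)
  | _, .mutNeg c, σ => .mutNeg (c.subst σ.upVar)
  | _, .cutPos p t S, σ => .cutPos p (t.subst σ) (S.subst σ)
  | _, .cutNeg V e, σ => .cutNeg (V.subst σ) (e.subst σ)

/-- `c[V/x]`, for the variable `x` bound as index `0` around `c`. -/
def Tm.instVar (c : Cmd) (V : Val) : Cmd := c.subst ⟨scons V .var, .covar⟩

/-- `c[V/x, W/y]`, for the variables `x, y` bound as indices `0, 1` around `c`. -/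
def Tm.instVars (c : Cmd) (V W : Val) : Cmd := c.subst ⟨scons V (scons W .var), .covar⟩

/-- `c[S/α]`, for the covariable `α` bound as index `0` around `c`. -/
def Tm.instCovar (c : Cmd) (S : Coval) : Cmd := c.subst ⟨.var, scons S .covar⟩

/-- `c[S/α, S'/β]`, for the covariables `α, β` bound as indices `0, 1` around `c`. -/
def Tm.instCovars (c : Cmd) (S S' : Coval) : Cmd := c.subst ⟨.var, scons S (scons S' .covar)⟩

/-- `t[W/x]`, for a free variable `x`. -/
def Tm.substFree {s : Cls} (t : Tm s) (x : ℕ) (W : Val) : Tm s :=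
  t.subst ⟨fun y => if y = x then W else .var y, .covar⟩

/-- The variable `x` occurs free in the term. -/
def Tm.FreeVar : {s : Cls} → Tm s → ℕ → Prop
  | _, .var y, x => y = x
  | _, .pair V W, x => V.FreeVar x ∨ W.FreeVar x
  | _, .box V, x => V.FreeVar x
  | _, .unit, _ => False
  | _, .inl V, x => V.FreeVar x
  | _, .inr V, x => V.FreeVar x
  | _, .muNot _ c, x => c.FreeVar (x + 1)
  | _, .muWith _ c₁ _ c₂, x => c₁.FreeVar x ∨ c₂.FreeVar x
  | _, .muPar _ _ c, x => c.FreeVar x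
  | _, .muNeg c, x => c.FreeVar x
  | _, .covar _, _ => False
  | _, .fst S, x => S.FreeVar x
  | _, .snd S, x => S.FreeVar x
  | _, .mutBox _ c, x => c.FreeVar (x + 1)
  | _, .conot V, x => V.FreeVar x
  | _, .copair S S', x => S.FreeVar x ∨ S'.FreeVar x
  | _, .mutUnit c, x => c.FreeVar x
  | _, .mutPos _ c, x => c.FreeVar (x + 1)
  | _, .mutPair _ _ c, x => c.FreeVar (x + 2)
  | _, .mutSum _ c₁ _ c₂, x => c₁.FreeVar (x + 1) ∨ c₂.FreeVar (x + 1)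
  | _, .ofVal V, x => V.FreeVar x
  | _, .muPos _ c, x => c.FreeVar x
  | _, .ofCoval S, x => S.FreeVar x
  | _, .mutNeg c, x => c.FreeVar (x + 1)
  | _, .cutPos _ t S, x => t.FreeVar x ∨ S.FreeVar x
  | _, .cutNeg V e, x => V.FreeVar x ∨ e.FreeVar x

/-- The covariable `α` occurs free in the term. -/
def Tm.FreeCovar : {s : Cls} → Tm s → ℕ → Prop
  | _, .var _, _ => False
  | _, .pair V W, α => V.FreeCovar α ∨ W.FreeCovar α
  | _, .box V, α => V.FreeCovar α
  | _, .unit, _ => False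
  | _, .inl V, α => V.FreeCovar α
  | _, .inr V, α => V.FreeCovar α
  | _, .muNot _ c, α => c.FreeCovar α
  | _, .muWith _ c₁ _ c₂, α => c₁.FreeCovar (α + 1) ∨ c₂.FreeCovar (α + 1)
  | _, .muPar _ _ c, α => c.FreeCovar (α + 2)
  | _, .muNeg c, α => c.FreeCovar (α + 1)
  | _, .covar β, α => β = α
  | _, .fst S, α => S.FreeCovar α
  | _, .snd S, α => S.FreeCovar α
  | _, .mutBox _ c, α => c.FreeCovar α
  | _, .conot V, α => V.FreeCovar α
  | _, .copair S S', α => S.FreeCovar α ∨ S'.FreeCovar α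
  | _, .mutUnit c, α => c.FreeCovar α
  | _, .mutPos _ c, α => c.FreeCovar α
  | _, .mutPair _ _ c, α => c.FreeCovar α
  | _, .mutSum _ c₁ _ c₂, α => c₁.FreeCovar α ∨ c₂.FreeCovar α
  | _, .ofVal V, α => V.FreeCovar α
  | _, .muPos _ c, α => c.FreeCovar (α + 1)
  | _, .ofCoval S, α => S.FreeCovar α
  | _, .mutNeg c, α => c.FreeCovar α
  | _, .cutPos _ t S, α => t.FreeCovar α ∨ S.FreeCovar α
  | _, .cutNeg V e, α => V.FreeCovar α ∨ e.FreeCovar α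

/-! ## Operational semantics -/

/-- One step `c ▷ c'` of the operational semantics, at the top level only. -/
inductive Red : Cmd → Cmd → Prop
  | muPos (p : PosPol) (c : Cmd) (S : Coval) :
      Red (.cutPos p (.muPos p c) S) (c.instCovar S)
  | muNeg (c : Cmd) (S : Coval) :
      Red (.cutNeg (.muNeg c) (.ofCoval S)) (c.instCovar S)
  | mutPos (p : PosPol) (V : Val) (c : Cmd) :
      Red (.cutPos p (.ofVal V) (.mutPos p c)) (c.instVar V)
  | mutNeg (V : Val) (c : Cmd) :
      Red (.cutNeg V (.mutNeg c)) (c.instVar V)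
  | unit (c : Cmd) :
      Red (.cutPos .box (.ofVal .unit) (.mutUnit c)) c
  | pairPos (p : PosPol) (V W : Val) (ε₁ ε₂ : Pol) (c : Cmd) :
      Red (.cutPos p (.ofVal (.pair V W)) (.mutPair ε₁ ε₂ c)) (c.instVars V W)
  | pairNeg (V W : Val) (ε₁ ε₂ : Pol) (c : Cmd) :
      Red (.cutNeg (.pair V W) (.ofCoval (.mutPair ε₁ ε₂ c))) (c.instVars V W)
  | inlPos (p : PosPol) (V : Val) (ε₁ ε₂ : Pol) (c₁ c₂ : Cmd) :
      Red (.cutPos p (.ofVal (.inl V)) (.mutSum ε₁ c₁ ε₂ c₂)) (c₁.instVar V)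
  | inlNeg (V : Val) (ε₁ ε₂ : Pol) (c₁ c₂ : Cmd) :
      Red (.cutNeg (.inl V) (.ofCoval (.mutSum ε₁ c₁ ε₂ c₂))) (c₁.instVar V)
  | inrPos (p : PosPol) (V : Val) (ε₁ ε₂ : Pol) (c₁ c₂ : Cmd) :
      Red (.cutPos p (.ofVal (.inr V)) (.mutSum ε₁ c₁ ε₂ c₂)) (c₂.instVar V)
  | inrNeg (V : Val) (ε₁ ε₂ : Pol) (c₁ c₂ : Cmd) :
      Red (.cutNeg (.inr V) (.ofCoval (.mutSum ε₁ c₁ ε₂ c₂))) (c₂.instVar V)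
  | box (V : Val) (ε : Pol) (c : Cmd) :
      Red (.cutPos .box (.ofVal (.box V)) (.mutBox ε c)) (c.instVar V)
  | conot (ε : Pol) (c : Cmd) (V : Val) :
      Red (.cutNeg (.muNot ε c) (.ofCoval (.conot V))) (c.instVar V)
  | copair (ε₁ ε₂ : Pol) (c : Cmd) (S S' : Coval) :
      Red (.cutNeg (.muPar ε₁ ε₂ c) (.ofCoval (.copair S S'))) (c.instCovars S S')
  | fst (ε₁ ε₂ : Pol) (c₁ c₂ : Cmd) (S : Coval) :
      Red (.cutNeg (.muWith ε₁ c₁ ε₂ c₂) (.ofCoval (.fst S))) (c₁.instCovar S)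
  | snd (ε₁ ε₂ : Pol) (c₁ c₂ : Cmd) (S : Coval) :
      Red (.cutNeg (.muWith ε₁ c₁ ε₂ c₂) (.ofCoval (.snd S))) (c₂.instCovar S)

/-! ## Typing -/

/-- One part of a context: an ordered list of (co)variables with their types. -/
abbrev Ctx := List (ℕ × Ty)

/-- The same declarations, seen from under one more binder. -/
def Ctx.shift (Γ : Ctx) : Ctx := Γ.map (fun d => (d.1 + 1, d.2))

/-- All types of `Γ` are modal. -/
def Ctx.Modal (Γ : Ctx) : Prop := ∀ d ∈ Γ, d.2.pol = .box

/-- The variables of `Γ` and `Θ` together are distinct, and so are the covariables of `Δ`. -/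
def Distinct (Γ Θ Δ : Ctx) : Prop :=
  ((Γ ++ Θ).map Prod.fst).Nodup ∧ (Δ.map Prod.fst).Nodup

/-- The renaming `f` of variables and `g` of covariables maps each part of the first context
into the corresponding part of the second one, and preserves types. -/
def IsRenaming (f g : ℕ → ℕ) (Γ Θ Δ Γ' Θ' Δ' : Ctx) : Prop :=
  (∀ d ∈ Γ, (f d.1, d.2) ∈ Γ') ∧ (∀ d ∈ Θ, (f d.1, d.2) ∈ Θ') ∧ (∀ d ∈ Δ, (g d.1, d.2) ∈ Δ')

/-- The subject (and the type) of the five typing judgments. -/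
inductive Judg : Type
  | val (V : Val) (A : Ty)
  | coval (S : Coval) (A : Ty)
  | exp (t : Exp) (A : Ty)
  | env (e : Env) (A : Ty)
  | cmd (c : Cmd)

def Judg.rename : Judg → (ℕ → ℕ) → (ℕ → ℕ) → Judg
  | .val V A, f, g => .val (V.rename f g) A
  | .coval S A, f, g => .coval (S.rename f g) A
  | .exp t A, f, g => .exp (t.rename f g) A
  | .env e A, f, g => .env (e.rename f g) A
  | .cmd c, f, g => .cmd (c.rename f g)

/-- `Typed Γ Θ Δ J`: the judgment `J` is derivable in the context `(Γ ¦ Θ ⊢ Δ)`. -/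
inductive Typed : Ctx → Ctx → Ctx → Judg → Prop
  -- axioms
  | ax (x : ℕ) (A : Ty) : Typed [(x, A)] [] [] (.val (.var x) A)
  | boxAx (x : ℕ) (A : Ty) : Typed [] [(x, A)] [] (.val (.var x) A)
  | coAx (α : ℕ) (A : Ty) : Typed [] [] [(α, A)] (.coval (.covar α) A)
  -- cuts
  | cutPos {Γ Θ Δ Γ' Θ' Δ' : Ctx} {p : PosPol} {t : Exp} {S : Coval} {A : Ty} :
      A.pol = p.toPol → Distinct (Γ ++ Γ') (Θ ++ Θ') (Δ ++ Δ') →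
      Typed Γ Θ Δ (.exp t A) → Typed Γ' Θ' Δ' (.coval S A) →
      Typed (Γ ++ Γ') (Θ ++ Θ') (Δ ++ Δ') (.cmd (.cutPos p t S))
  | cutNeg {Γ Θ Δ Γ' Θ' Δ' : Ctx} {V : Val} {e : Env} {A : Ty} :
      A.pol = .minus → Distinct (Γ ++ Γ') (Θ ++ Θ') (Δ ++ Δ') →
      Typed Γ Θ Δ (.val V A) → Typed Γ' Θ' Δ' (.env e A) →
      Typed (Γ ++ Γ') (Θ ++ Θ') (Δ ++ Δ') (.cmd (.cutNeg V e))
  -- values as expressions, co-values as environments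
  | ofVal {Γ Θ Δ : Ctx} {p : PosPol} {V : Val} {A : Ty} :
      A.pol = p.toPol → Typed Γ Θ Δ (.val V A) → Typed Γ Θ Δ (.exp (.ofVal V) A)
  | ofCoval {Γ Θ Δ : Ctx} {S : Coval} {A : Ty} :
      A.pol = .minus → Typed Γ Θ Δ (.coval S A) → Typed Γ Θ Δ (.env (.ofCoval S) A)
  -- `μα` and `μ̃x`
  | muPos {Γ Θ Δ : Ctx} {p : PosPol} {c : Cmd} {A : Ty} :
      A.pol = p.toPol → Typed Γ Θ ((0, A) :: Δ.shift) (.cmd c) →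
      Typed Γ Θ Δ (.exp (.muPos p c) A)
  | muNeg {Γ Θ Δ : Ctx} {c : Cmd} {A : Ty} :
      A.pol = .minus → Typed Γ Θ ((0, A) :: Δ.shift) (.cmd c) →
      Typed Γ Θ Δ (.val (.muNeg c) A)
  | mutPos {Γ Θ Δ : Ctx} {p : PosPol} {c : Cmd} {A : Ty} :
      A.pol = p.toPol → Typed ((0, A) :: Γ.shift) Θ.shift Δ (.cmd c) →
      Typed Γ Θ Δ (.coval (.mutPos p c) A)
  | mutNeg {Γ Θ Δ : Ctx} {c : Cmd} {A : Ty} :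
      A.pol = .minus → Typed ((0, A) :: Γ.shift) Θ.shift Δ (.cmd c) →
      Typed Γ Θ Δ (.env (.mutNeg c) A)
  -- `𝟙`
  | unit : Typed [] [] [] (.val .unit .one)
  | mutUnit {Γ Θ Δ : Ctx} {c : Cmd} :
      Typed Γ Θ Δ (.cmd c) → Typed Γ Θ Δ (.coval (.mutUnit c) .one)
  -- `⊗`
  | pair {Γ Θ Δ Γ' Θ' Δ' : Ctx} {V W : Val} {A B : Ty} :
      Distinct (Γ ++ Γ') (Θ ++ Θ') (Δ ++ Δ') →
      Typed Γ Θ Δ (.val V A) → Typed Γ' Θ' Δ' (.val W B) →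
      Typed (Γ ++ Γ') (Θ ++ Θ') (Δ ++ Δ') (.val (.pair V W) (.tensor A B))
  | mutPair {Γ Θ Δ : Ctx} {ε₁ ε₂ : Pol} {c : Cmd} {A B : Ty} :
      A.pol = ε₁ → B.pol = ε₂ →
      Typed ((0, A) :: (1, B) :: Γ.shift.shift) Θ.shift.shift Δ (.cmd c) →
      Typed Γ Θ Δ (.coval (.mutPair ε₁ ε₂ c) (.tensor A B))
  -- `⊕`
  | inl {Γ Θ Δ : Ctx} {V : Val} {A B : Ty} :
      Typed Γ Θ Δ (.val V A) → Typed Γ Θ Δ (.val (.inl V) (.plus A B))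
  | inr {Γ Θ Δ : Ctx} {V : Val} {A B : Ty} :
      Typed Γ Θ Δ (.val V B) → Typed Γ Θ Δ (.val (.inr V) (.plus A B))
  | mutSum {Γ Θ Δ : Ctx} {ε₁ ε₂ : Pol} {c₁ c₂ : Cmd} {A B : Ty} :
      A.pol = ε₁ → B.pol = ε₂ →
      Typed ((0, A) :: Γ.shift) Θ.shift Δ (.cmd c₁) →
      Typed ((0, B) :: Γ.shift) Θ.shift Δ (.cmd c₂) →
      Typed Γ Θ Δ (.coval (.mutSum ε₁ c₁ ε₂ c₂) (.plus A B))
  -- `⅋`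
  | muPar {Γ Θ Δ : Ctx} {ε₁ ε₂ : Pol} {c : Cmd} {A B : Ty} :
      A.pol = ε₁ → B.pol = ε₂ →
      Typed Γ Θ ((0, A) :: (1, B) :: Δ.shift.shift) (.cmd c) →
      Typed Γ Θ Δ (.val (.muPar ε₁ ε₂ c) (.par A B))
  | copair {Γ Θ Δ Γ' Θ' Δ' : Ctx} {S S' : Coval} {A B : Ty} :
      Distinct (Γ ++ Γ') (Θ ++ Θ') (Δ ++ Δ') →
      Typed Γ Θ Δ (.coval S A) → Typed Γ' Θ' Δ' (.coval S' B) →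
      Typed (Γ ++ Γ') (Θ ++ Θ') (Δ ++ Δ') (.coval (.copair S S') (.par A B))
  -- `¬`
  | muNot {Γ Θ Δ : Ctx} {ε : Pol} {c : Cmd} {A : Ty} :
      A.pol = ε → Typed ((0, A) :: Γ.shift) Θ.shift Δ (.cmd c) →
      Typed Γ Θ Δ (.val (.muNot ε c) (.not A))
  | conot {Γ Θ Δ : Ctx} {V : Val} {A : Ty} :
      Typed Γ Θ Δ (.val V A) → Typed Γ Θ Δ (.coval (.conot V) (.not A))
  -- `&`
  | muWith {Γ Θ Δ : Ctx} {ε₁ ε₂ : Pol} {c₁ c₂ : Cmd} {A B : Ty} :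
      A.pol = ε₁ → B.pol = ε₂ →
      Typed Γ Θ ((0, A) :: Δ.shift) (.cmd c₁) →
      Typed Γ Θ ((0, B) :: Δ.shift) (.cmd c₂) →
      Typed Γ Θ Δ (.val (.muWith ε₁ c₁ ε₂ c₂) (.withT A B))
  | fst {Γ Θ Δ : Ctx} {S : Coval} {A B : Ty} :
      Typed Γ Θ Δ (.coval S A) → Typed Γ Θ Δ (.coval (.fst S) (.withT A B))
  | snd {Γ Θ Δ : Ctx} {S : Coval} {A B : Ty} :
      Typed Γ Θ Δ (.coval S B) → Typed Γ Θ Δ (.coval (.snd S) (.withT A B))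
  -- `□`
  | box {Γ Θ : Ctx} {V : Val} {A : Ty} :
      Γ.Modal → Typed Γ Θ [] (.val V A) → Typed Γ Θ [] (.val (.box V) (.box A))
  | mutBox {Γ Θ Δ : Ctx} {ε : Pol} {c : Cmd} {A : Ty} :
      A.pol = ε → Typed Γ.shift ((0, A) :: Θ.shift) Δ (.cmd c) →
      Typed Γ Θ Δ (.coval (.mutBox ε c) (.box A))
  -- renaming: permutation, contraction and weakening, for all five judgments
  | ren {Γ Θ Δ Γ' Θ' Δ' : Ctx} {J : Judg} (f g : ℕ → ℕ) :
      IsRenaming f g Γ Θ Δ Γ' Θ' Δ' → Distinct Γ' Θ' Δ' →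
      Typed Γ Θ Δ J → Typed Γ' Θ' Δ' (J.rename f g)

/-- The toplevel continuation, a free covariable. -/
def tp : ℕ := 0

/-- `⟨V | tp⟩^□` -/
def ret (V : Val) : Cmd := .cutPos .box (.ofVal V) (.covar tp)

/-- `V` is the result of evaluating `c` at type `R`: it is a value of type `R` in the empty
context, `c ▷* ⟨V | tp⟩^□`, and it is the only value with this last property. -/
def EvaluatesTo (R : Ty) (c : Cmd) (V : Val) : Prop :=
  Typed [] [] [] (.val V R) ∧ Relation.ReflTransGen Red c (ret V) ∧
    ∀ W : Val, Relation.ReflTransGen Red c (ret W) → W = V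

/-! ## Memory -/

/-- A heap equation `x^ε := V`. -/
structure HeapEqn : Type where
  name : ℕ
  pol : Pol
  val : Val

/-- Heaps, with the most recent equation first. -/
abbrev Heap := List HeapEqn

/-- A stack equation: `x^± := V` or `α^ε := S`. -/
inductive Eqn : Type
  | var (x : ℕ) (π : NonModalPol) (V : Val)
  | covar (α : ℕ) (ε : Pol) (S : Coval)

/-- A stack frame: one or two equations. -/
inductive Frame : Type
  | one (E : Eqn)
  | two (E E' : Eqn)

def Frame.eqns : Frame → List Eqn
  | .one E => [E]
  | .two E E' => [E, E']

/-- Stacks, with the most recent frame first. -/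
abbrev Stack := List Frame

/-- A memory `⟨H | S⟩`. -/
structure Mem : Type where
  heap : Heap
  stack : Stack

/-- `M(x) =^ε V` -/
def Mem.VarIs (M : Mem) (x : ℕ) (ε : Pol) (V : Val) : Prop :=
  (∃ h ∈ M.heap, h = ⟨x, ε, V⟩) ∨
    ∃ F ∈ M.stack, ∃ π : NonModalPol, Eqn.var x π V ∈ F.eqns ∧ π.toPol = ε

/-- `M(α) =^ε S` -/
def Mem.CovarIs (M : Mem) (α : ℕ) (ε : Pol) (S : Coval) : Prop :=
  ∃ F ∈ M.stack, Eqn.covar α ε S ∈ F.eqns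

/-- The covariable `α` has polarity `ε`; the toplevel continuation, whose type is modal, has
polarity `□`. -/
def Mem.CovarPol (M : Mem) (α : ℕ) (ε : Pol) : Prop :=
  (α = tp ∧ ε = .box) ∨ ∃ S, M.CovarIs α ε S

/-- `M[x^ε := V]` -/
def Mem.allocVar (M : Mem) (x : ℕ) (ε : Pol) (V : Val) : Mem :=
  match ε.nonModal? with
  | none => ⟨⟨x, .box, V⟩ :: M.heap, M.stack⟩
  | some π => ⟨M.heap, .one (.var x π V) :: M.stack⟩

/-- `M[x^ε := V, y^ε' := W]` -/
def Mem.allocVars (M : Mem) (x : ℕ) (ε : Pol) (V : Val) (y : ℕ) (ε' : Pol) (W : Val) : Mem :=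
  match ε.nonModal?, ε'.nonModal? with
  | none, none => ⟨⟨y, .box, W⟩ :: ⟨x, .box, V⟩ :: M.heap, M.stack⟩
  | none, some π' => ⟨⟨x, .box, V⟩ :: M.heap, .one (.var y π' W) :: M.stack⟩
  | some π, none => ⟨⟨y, .box, W⟩ :: M.heap, .one (.var x π V) :: M.stack⟩
  | some π, some π' => ⟨M.heap, .two (.var x π V) (.var y π' W) :: M.stack⟩

/-- `M[α^ε := S]` -/
def Mem.allocCovar (M : Mem) (α : ℕ) (ε : Pol) (S : Coval) : Mem :=
  ⟨M.heap, .one (.covar α ε S) :: M.stack⟩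

/-- `M[α^ε := S, β^ε' := S']` -/
def Mem.allocCovars (M : Mem) (α : ℕ) (ε : Pol) (S : Coval) (β : ℕ) (ε' : Pol) (S' : Coval) :
    Mem :=
  ⟨M.heap, .two (.covar α ε S) (.covar β ε' S') :: M.stack⟩

/-- `⟨H, x^ε := V | S⟩`, for any polarity `ε`. -/
def Mem.allocHeap (M : Mem) (x : ℕ) (ε : Pol) (V : Val) : Mem :=
  ⟨⟨x, ε, V⟩ :: M.heap, M.stack⟩

/-- The equation defines the covariable `α`. -/
def Eqn.definesCovar (α : ℕ) : Eqn → Bool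
  | .var _ _ _ => false
  | .covar β _ _ => β == α

/-- Drops the frames up to and including the most recent one that defines `α`. -/
def Stack.dropTo (α : ℕ) : Stack → Stack
  | [] => []
  | F :: S => if F.eqns.any (Eqn.definesCovar α) then S else Stack.dropTo α S

/-- The restriction of `M` at the address of `α`. -/
def Mem.restrict (M : Mem) (α : ℕ) : Mem := ⟨M.heap, Stack.dropTo α M.stack⟩

/-! ## Evaluation of values and co-values -/

/-- The value `V` evaluates to `V'` in the memory `M`. -/
inductive EvalVal (M : Mem) : Val → Val → Prop
  | varPos {x : ℕ} {p : PosPol} {V : Val} : M.VarIs x p.toPol V → EvalVal M (.var x) V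
  | varNeg {x : ℕ} {V : Val} : M.VarIs x .minus V → EvalVal M (.var x) (.var x)
  | pair {V W V' W' : Val} : EvalVal M V V' → EvalVal M W W' →
      EvalVal M (.pair V W) (.pair V' W')
  | inl {V V' : Val} : EvalVal M V V' → EvalVal M (.inl V) (.inl V')
  | inr {V V' : Val} : EvalVal M V V' → EvalVal M (.inr V) (.inr V')
  | box {V V' : Val} : EvalVal M V V' → EvalVal M (.box V) (.box V')
  | unit : EvalVal M .unit .unit
  | muNot (ε : Pol) (c : Cmd) : EvalVal M (.muNot ε c) (.muNot ε c)
  | muWith (ε₁ : Pol) (c₁ : Cmd) (ε₂ : Pol) (c₂ : Cmd) :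
      EvalVal M (.muWith ε₁ c₁ ε₂ c₂) (.muWith ε₁ c₁ ε₂ c₂)
  | muPar (ε₁ ε₂ : Pol) (c : Cmd) : EvalVal M (.muPar ε₁ ε₂ c) (.muPar ε₁ ε₂ c)
  | muNeg (c : Cmd) : EvalVal M (.muNeg c) (.muNeg c)

/-- The co-value `S` evaluates to `S'` in the memory `M`. -/
inductive EvalCoval (M : Mem) : Coval → Coval → Prop
  | covarPos {α : ℕ} {p : PosPol} : M.CovarPol α p.toPol → EvalCoval M (.covar α) (.covar α)
  | covarNeg {α : ℕ} {S : Coval} : M.CovarIs α .minus S → EvalCoval M (.covar α) S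
  | fst {S S' : Coval} : EvalCoval M S S' → EvalCoval M (.fst S) (.fst S')
  | snd {S S' : Coval} : EvalCoval M S S' → EvalCoval M (.snd S) (.snd S')
  | conot {V V' : Val} : EvalVal M V V' → EvalCoval M (.conot V) (.conot V')
  | copair {S T S' T' : Coval} : EvalCoval M S S' → EvalCoval M T T' →
      EvalCoval M (.copair S T) (.copair S' T')
  | mutBox (ε : Pol) (c : Cmd) : EvalCoval M (.mutBox ε c) (.mutBox ε c)
  | mutUnit (c : Cmd) : EvalCoval M (.mutUnit c) (.mutUnit c)
  | mutPos (p : PosPol) (c : Cmd) : EvalCoval M (.mutPos p c) (.mutPos p c)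
  | mutPair (ε₁ ε₂ : Pol) (c : Cmd) : EvalCoval M (.mutPair ε₁ ε₂ c) (.mutPair ε₁ ε₂ c)
  | mutSum (ε₁ : Pol) (c₁ : Cmd) (ε₂ : Pol) (c₂ : Cmd) :
      EvalCoval M (.mutSum ε₁ c₁ ε₂ c₂) (.mutSum ε₁ c₁ ε₂ c₂)

/-! ## The machine -/

/-- A variable `x` is fresh for `M` and `c`: it is not defined in `M`, and occurs free neither
in the terms stored in `M` nor in `c`. -/
def FreshVar (M : Mem) (c : Cmd) (x : ℕ) : Prop :=
  (∀ h ∈ M.heap, h.name ≠ x ∧ ¬ h.val.FreeVar x) ∧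
  (∀ F ∈ M.stack, ∀ E ∈ F.eqns, match E with
    | .var y _ V => y ≠ x ∧ ¬ V.FreeVar x
    | .covar _ _ S => ¬ S.FreeVar x) ∧
  ¬ c.FreeVar x

/-- A covariable `α` is fresh for `M` and `c`: it is not the toplevel continuation, it is not
defined in `M`, and occurs free neither in the terms stored in `M` nor in `c`. -/
def FreshCovar (M : Mem) (c : Cmd) (α : ℕ) : Prop :=
  α ≠ tp ∧
  (∀ h ∈ M.heap, ¬ h.val.FreeCovar α) ∧
  (∀ F ∈ M.stack, ∀ E ∈ F.eqns, match E with
    | .var _ _ V => ¬ V.FreeCovar α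
    | .covar β _ S => β ≠ α ∧ ¬ S.FreeCovar α) ∧
  ¬ c.FreeCovar α

/-- The body `c` of a binder of one variable, when this variable is named `x`. -/
def Tm.openVar (c : Cmd) (x : ℕ) : Cmd := c.rename (scons x id) id

/-- The body `c` of a binder of two variables, when they are named `x` and `y`. -/
def Tm.openVars (c : Cmd) (x y : ℕ) : Cmd := c.rename (scons x (scons y id)) id

/-- The body `c` of a binder of one covariable, when this covariable is named `α`. -/
def Tm.openCovar (c : Cmd) (α : ℕ) : Cmd := c.rename id (scons α id)

/-- The body `c` of a binder of two covariables, when they are named `α` and `β`. -/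
def Tm.openCovars (c : Cmd) (α β : ℕ) : Cmd := c.rename id (scons α (scons β id))

/-- One step `(M ⊨ c) ⇝ (M' ⊨ c')` of the machine.  The bound (co)variables of an evaluated
binder are first renamed to fresh ones, which then name the allocated memory. -/
inductive Step : Mem × Cmd → Mem × Cmd → Prop
  | evalPlus {M : Mem} {V : Val} {α : ℕ} {S : Coval} : M.CovarIs α .plus S →
      Step (M, .cutPos .plus (.ofVal V) (.covar α)) (M, .cutPos .plus (.ofVal V) S)
  | evalMinus {M : Mem} {x : ℕ} {V : Val} {S : Coval} : M.VarIs x .minus V →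
      Step (M, .cutNeg (.var x) (.ofCoval S)) (M, .cutNeg V (.ofCoval S))
  | evalBox {M : Mem} {V : Val} {α : ℕ} {S : Coval} : M.CovarIs α .box S →
      Step (M, .cutPos .box (.ofVal V) (.covar α)) (M.restrict α, .cutPos .box (.ofVal V) S)
  | muNot {M : Mem} {ε : Pol} {c : Cmd} {S : Coval} {V : Val} {x : ℕ} :
      EvalCoval M S (.conot V) →
      FreshVar M (.cutNeg (.muNot ε c) (.ofCoval S)) x →
      Step (M, .cutNeg (.muNot ε c) (.ofCoval S)) (M.allocVar x ε V, c.openVar x)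
  | muPos {M : Mem} {p : PosPol} {c : Cmd} {S S' : Coval} {α : ℕ} :
      EvalCoval M S S' →
      FreshCovar M (.cutPos p (.muPos p c) S) α →
      Step (M, .cutPos p (.muPos p c) S) (M.allocCovar α p.toPol S', c.openCovar α)
  | muNeg {M : Mem} {c : Cmd} {S S' : Coval} {α : ℕ} :
      EvalCoval M S S' →
      FreshCovar M (.cutNeg (.muNeg c) (.ofCoval S)) α →
      Step (M, .cutNeg (.muNeg c) (.ofCoval S)) (M.allocCovar α .minus S', c.openCovar α)
  | mutPos {M : Mem} {p : PosPol} {V V' : Val} {c : Cmd} {x : ℕ} :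
      EvalVal M V V' →
      FreshVar M (.cutPos p (.ofVal V) (.mutPos p c)) x →
      Step (M, .cutPos p (.ofVal V) (.mutPos p c)) (M.allocVar x p.toPol V', c.openVar x)
  | mutNeg {M : Mem} {V V' : Val} {c : Cmd} {x : ℕ} :
      EvalVal M V V' →
      FreshVar M (.cutNeg V (.mutNeg c)) x →
      Step (M, .cutNeg V (.mutNeg c)) (M.allocVar x .minus V', c.openVar x)
  | mutPairPos {M : Mem} {p : PosPol} {V V₁ V₂ : Val} {ε₁ ε₂ : Pol} {c : Cmd} {x y : ℕ} :
      EvalVal M V (.pair V₁ V₂) → x ≠ y →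
      FreshVar M (.cutPos p (.ofVal V) (.mutPair ε₁ ε₂ c)) x →
      FreshVar M (.cutPos p (.ofVal V) (.mutPair ε₁ ε₂ c)) y →
      Step (M, .cutPos p (.ofVal V) (.mutPair ε₁ ε₂ c))
        (M.allocVars x ε₁ V₁ y ε₂ V₂, c.openVars x y)
  | mutPairNeg {M : Mem} {V V₁ V₂ : Val} {ε₁ ε₂ : Pol} {c : Cmd} {x y : ℕ} :
      EvalVal M V (.pair V₁ V₂) → x ≠ y →
      FreshVar M (.cutNeg V (.ofCoval (.mutPair ε₁ ε₂ c))) x →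
      FreshVar M (.cutNeg V (.ofCoval (.mutPair ε₁ ε₂ c))) y →
      Step (M, .cutNeg V (.ofCoval (.mutPair ε₁ ε₂ c)))
        (M.allocVars x ε₁ V₁ y ε₂ V₂, c.openVars x y)
  | muPar {M : Mem} {ε₁ ε₂ : Pol} {c : Cmd} {S S₁ S₂ : Coval} {α β : ℕ} :
      EvalCoval M S (.copair S₁ S₂) → α ≠ β →
      FreshCovar M (.cutNeg (.muPar ε₁ ε₂ c) (.ofCoval S)) α →
      FreshCovar M (.cutNeg (.muPar ε₁ ε₂ c) (.ofCoval S)) β →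
      Step (M, .cutNeg (.muPar ε₁ ε₂ c) (.ofCoval S))
        (M.allocCovars α ε₁ S₁ β ε₂ S₂, c.openCovars α β)
  | inlPos {M : Mem} {p : PosPol} {V V' : Val} {ε₁ ε₂ : Pol} {c₁ c₂ : Cmd} {x : ℕ} :
      EvalVal M V (.inl V') →
      FreshVar M (.cutPos p (.ofVal V) (.mutSum ε₁ c₁ ε₂ c₂)) x →
      Step (M, .cutPos p (.ofVal V) (.mutSum ε₁ c₁ ε₂ c₂)) (M.allocVar x ε₁ V', c₁.openVar x)
  | inlNeg {M : Mem} {V V' : Val} {ε₁ ε₂ : Pol} {c₁ c₂ : Cmd} {x : ℕ} :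
      EvalVal M V (.inl V') →
      FreshVar M (.cutNeg V (.ofCoval (.mutSum ε₁ c₁ ε₂ c₂))) x →
      Step (M, .cutNeg V (.ofCoval (.mutSum ε₁ c₁ ε₂ c₂))) (M.allocVar x ε₁ V', c₁.openVar x)
  | inrPos {M : Mem} {p : PosPol} {V V' : Val} {ε₁ ε₂ : Pol} {c₁ c₂ : Cmd} {x : ℕ} :
      EvalVal M V (.inr V') →
      FreshVar M (.cutPos p (.ofVal V) (.mutSum ε₁ c₁ ε₂ c₂)) x →
      Step (M, .cutPos p (.ofVal V) (.mutSum ε₁ c₁ ε₂ c₂)) (M.allocVar x ε₂ V', c₂.openVar x)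
  | inrNeg {M : Mem} {V V' : Val} {ε₁ ε₂ : Pol} {c₁ c₂ : Cmd} {x : ℕ} :
      EvalVal M V (.inr V') →
      FreshVar M (.cutNeg V (.ofCoval (.mutSum ε₁ c₁ ε₂ c₂))) x →
      Step (M, .cutNeg V (.ofCoval (.mutSum ε₁ c₁ ε₂ c₂))) (M.allocVar x ε₂ V', c₂.openVar x)
  | fst {M : Mem} {ε₁ ε₂ : Pol} {c₁ c₂ : Cmd} {S S' : Coval} {α : ℕ} :
      EvalCoval M S (.fst S') →
      FreshCovar M (.cutNeg (.muWith ε₁ c₁ ε₂ c₂) (.ofCoval S)) α →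
      Step (M, .cutNeg (.muWith ε₁ c₁ ε₂ c₂) (.ofCoval S))
        (M.allocCovar α ε₁ S', c₁.openCovar α)
  | snd {M : Mem} {ε₁ ε₂ : Pol} {c₁ c₂ : Cmd} {S S' : Coval} {α : ℕ} :
      EvalCoval M S (.snd S') →
      FreshCovar M (.cutNeg (.muWith ε₁ c₁ ε₂ c₂) (.ofCoval S)) α →
      Step (M, .cutNeg (.muWith ε₁ c₁ ε₂ c₂) (.ofCoval S))
        (M.allocCovar α ε₂ S', c₂.openCovar α)
  | mutUnit {M : Mem} {V : Val} {c : Cmd} : EvalVal M V .unit →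
      Step (M, .cutPos .box (.ofVal V) (.mutUnit c)) (M, c)
  | mutBox {M : Mem} {V V' : Val} {ε : Pol} {c : Cmd} {x : ℕ} :
      EvalVal M V (.box V') →
      FreshVar M (.cutPos .box (.ofVal V) (.mutBox ε c)) x →
      Step (M, .cutPos .box (.ofVal V) (.mutBox ε c)) (M.allocHeap x ε V', c.openVar x)

/-- `V` contains no reference to the stack `S`: no (co)variable defined in `S` is free in `V`. -/
def NoRef (V : Val) (S : Stack) : Prop :=
  ∀ F ∈ S, ∀ E ∈ F.eqns, match E with
    | .var x _ _ => ¬ V.FreeVar x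
    | .covar α _ _ => ¬ V.FreeCovar α

/-- `V[H]`: the heap, whose values refer to older equations only, is substituted from its most
recent equation to its oldest one. -/
def Heap.applyTo : Heap → Val → Val
  | [], V => V
  | h :: H, V => Heap.applyTo H (V.substFree h.name h.val)

end LBox

namespace LBox

/-! ## The algebra of renamings and substitutions -/

/-! The theorem joins a termination proof for `▷` to a simulation of `▷` by the machine.

Both work on an additive form `HT` of the type system, where premises share their context and
renaming is admissible instead of being a rule, so that derivations can be inverted along the term.
The fact about types used everywhere is `HT.modal_of_box`: abstractions that are values have
negative types, so a value of modal type is built by constructors from modal variables, ordinary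
variables of modal type and boxes. It can therefore always be used under a box, with no covariable
and no ordinary variable of non-modal type.

Termination is by realizability with halting as the pole. A positive type is interpreted by its
constructor values and a negative one by its constructor co-values; the opposite side is the
orthogonal. `HT.real` says that typed terms realize their types. Since `⟨V | tp⟩` is already a
result, `tp` realizes every modal type, and so `c` halts. The result is unique because `▷` is
deterministic and results are irreducible.

For the machine, a `World` gives types to names together with a substitution that solves all
equations of the memory. Applying this substitution to the current command unfolds the state into a
command of the calculus. A step that consumes a binder is one reduction of the unfolded command. A
lookup leaves the unfolded command unchanged, and lookups cannot go on forever because each stored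
term refers only to older frames or to the heap, and heap values only to older heap equations. Hence
a halting reduction can be followed by the machine (`World.MemOK.normalize`,
`World.MemOK.evaluates`).

The delicate step is the return to a modal continuation, which discards part of the stack. It is
sound because variables on the stack never have modal types: by `HT.modal_of_box` the returned value
depends on the heap alone. The same argument applied to the final value shows that it has no
reference to the stack and that substituting the heap into it gives its unfolding, which is `V`.
This also types `V` in the empty context, without a subject reduction lemma for `▷`. -/

theorem up_id : up id = id := by
  funext n; cases n <;> rfl

theorem up_comp (f f' : ℕ → ℕ) : up (fun n => f' (f n)) = fun n => up f' (up f n) := by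
  funext n; cases n <;> rfl

theorem Tm.rename_id {s : Cls} (t : Tm s) : t.rename id id = t := by
  induction t <;> simp only [Tm.rename, up_id, id_eq, *]

/-- The four composition laws are ordered by their binder cases. Pushing a substitution under a
binder renames the terms that it inserts, so renaming after substitution needs the law for two
renamings, and composing two substitutions needs both mixed laws. -/
theorem Tm.rename_rename {s : Cls} (t : Tm s) (f g f' g' : ℕ → ℕ) :
    (t.rename f g).rename f' g' = t.rename (fun n => f' (f n)) (fun n => g' (g n)) := by
  induction t generalizing f g f' g' <;> simp only [Tm.rename, up_comp, *]

theorem Sub.ext_fun {σ τ : Sub} (h : ∀ n, σ.onVar n = τ.onVar n)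
    (h' : ∀ n, σ.onCovar n = τ.onCovar n) : σ = τ := by
  cases σ; cases τ
  simp only [Sub.mk.injEq]
  exact ⟨funext h, funext h'⟩

/-- The substitution `σ` precomposed with a renaming. -/
def Sub.precomp (σ : Sub) (f g : ℕ → ℕ) : Sub := ⟨fun n => σ.onVar (f n), fun n => σ.onCovar (g n)⟩

/-- The substitution `σ` followed by a renaming. -/
def Sub.postRename (σ : Sub) (f g : ℕ → ℕ) : Sub :=
  ⟨fun n => (σ.onVar n).rename f g, fun n => (σ.onCovar n).rename f g⟩

/-- The substitution `σ` followed by the substitution `τ`. -/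
def Sub.comp (σ τ : Sub) : Sub := ⟨fun n => (σ.onVar n).subst τ, fun n => (σ.onCovar n).subst τ⟩

/-- The identity substitution. -/
def Sub.ident : Sub := ⟨.var, .covar⟩

theorem Sub.upVar_precomp (σ : Sub) (f g : ℕ → ℕ) :
    σ.upVar.precomp (up f) g = (σ.precomp f g).upVar := by
  apply Sub.ext_fun
  · intro n; cases n <;> rfl
  · intro n; rfl

theorem Sub.upCovar_precomp (σ : Sub) (f g : ℕ → ℕ) :
    σ.upCovar.precomp f (up g) = (σ.precomp f g).upCovar := by
  apply Sub.ext_fun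
  · intro n; rfl
  · intro n; cases n <;> rfl

theorem Tm.subst_rename_left {s : Cls} (t : Tm s) (f g : ℕ → ℕ) (σ : Sub) :
    (t.rename f g).subst σ = t.subst (σ.precomp f g) := by
  induction t generalizing f g σ <;>
    simp only [Tm.rename, Tm.subst, Sub.upVar_precomp, Sub.upCovar_precomp, *] <;> rfl

theorem Sub.upVar_postRename (σ : Sub) (f g : ℕ → ℕ) :
    σ.upVar.postRename (up f) g = (σ.postRename f g).upVar := by
  apply Sub.ext_fun
  · intro n
    cases n
    · rfl
    · simp only [Sub.postRename, Sub.upVar, scons, Tm.rename_rename]; rfl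
  · intro n
    simp only [Sub.postRename, Sub.upVar, Tm.rename_rename]; rfl

theorem Sub.upCovar_postRename (σ : Sub) (f g : ℕ → ℕ) :
    σ.upCovar.postRename f (up g) = (σ.postRename f g).upCovar := by
  apply Sub.ext_fun
  · intro n
    simp only [Sub.postRename, Sub.upCovar, Tm.rename_rename]; rfl
  · intro n
    cases n
    · rfl
    · simp only [Sub.postRename, Sub.upCovar, scons, Tm.rename_rename]; rfl

theorem Tm.rename_subst {s : Cls} (t : Tm s) (f g : ℕ → ℕ) (σ : Sub) :
    (t.subst σ).rename f g = t.subst (σ.postRename f g) := by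
  induction t generalizing f g σ <;>
    simp only [Tm.rename, Tm.subst, Sub.upVar_postRename, Sub.upCovar_postRename, *] <;> rfl

theorem Sub.upVar_comp (σ τ : Sub) : σ.upVar.comp τ.upVar = (σ.comp τ).upVar := by
  apply Sub.ext_fun
  · intro n
    cases n
    · rfl
    · simp only [Sub.comp, Sub.upVar, scons, Tm.subst_rename_left, Tm.rename_subst]; rfl
  · intro n
    simp only [Sub.comp, Sub.upVar, Tm.subst_rename_left, Tm.rename_subst]; rfl

theorem Sub.upCovar_comp (σ τ : Sub) : σ.upCovar.comp τ.upCovar = (σ.comp τ).upCovar := by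
  apply Sub.ext_fun
  · intro n
    simp only [Sub.comp, Sub.upCovar, Tm.subst_rename_left, Tm.rename_subst]; rfl
  · intro n
    cases n
    · rfl
    · simp only [Sub.comp, Sub.upCovar, scons, Tm.subst_rename_left, Tm.rename_subst]; rfl

theorem Tm.subst_subst {s : Cls} (t : Tm s) (σ τ : Sub) :
    (t.subst σ).subst τ = t.subst (σ.comp τ) := by
  induction t generalizing σ τ <;>
    simp only [Tm.subst, Sub.upVar_comp, Sub.upCovar_comp, *] <;> rfl

theorem Sub.upVar_ident : Sub.ident.upVar = Sub.ident := by
  apply Sub.ext_fun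
  · intro n; cases n <;> rfl
  · intro n; rfl

theorem Sub.upCovar_ident : Sub.ident.upCovar = Sub.ident := by
  apply Sub.ext_fun
  · intro n; rfl
  · intro n; cases n <;> rfl

theorem Tm.subst_ident {s : Cls} (t : Tm s) : t.subst Sub.ident = t := by
  induction t <;> simp only [Tm.subst, Sub.upVar_ident, Sub.upCovar_ident, *] <;> rfl

/-! ### Instantiating a binder after a substitution -/

/-- `σ` extended by `V` on the index `0` of variables. -/
def Sub.consVar (V : Val) (σ : Sub) : Sub := ⟨scons V σ.onVar, σ.onCovar⟩

/-- `σ` extended by `S` on the index `0` of covariables. -/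
def Sub.consCovar (S : Coval) (σ : Sub) : Sub := ⟨σ.onVar, scons S σ.onCovar⟩

theorem Sub.comp_ident (σ : Sub) : σ.comp Sub.ident = σ := by
  apply Sub.ext_fun <;> intro n <;> exact Tm.subst_ident _

theorem Sub.upVar_comp_consVar (σ τ : Sub) (V : Val) :
    σ.upVar.comp (τ.consVar V) = (σ.comp τ).consVar V := by
  apply Sub.ext_fun
  · intro n
    cases n
    · rfl
    · simp only [Sub.comp, Sub.upVar, Sub.consVar, scons, Tm.subst_rename_left]; rfl
  · intro n
    simp only [Sub.comp, Sub.upVar, Sub.consVar, Tm.subst_rename_left]; rfl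

theorem Sub.upCovar_comp_consCovar (σ τ : Sub) (S : Coval) :
    σ.upCovar.comp (τ.consCovar S) = (σ.comp τ).consCovar S := by
  apply Sub.ext_fun
  · intro n
    simp only [Sub.comp, Sub.upCovar, Sub.consCovar, Tm.subst_rename_left]; rfl
  · intro n
    cases n
    · rfl
    · simp only [Sub.comp, Sub.upCovar, Sub.consCovar, scons, Tm.subst_rename_left]; rfl

/-- A reduct of a substituted term is the body under an extended environment. This form serves both
the realizability argument and the simulation. -/
theorem Tm.subst_upVar_instVar (c : Cmd) (σ : Sub) (V : Val) :
    (c.subst σ.upVar).instVar V = c.subst (σ.consVar V) := by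
  rw [Tm.instVar, Tm.subst_subst]
  exact congrArg _ ((Sub.upVar_comp_consVar σ .ident V).trans (by rw [Sub.comp_ident]))

theorem Tm.subst_upCovar_instCovar (c : Cmd) (σ : Sub) (S : Coval) :
    (c.subst σ.upCovar).instCovar S = c.subst (σ.consCovar S) := by
  rw [Tm.instCovar, Tm.subst_subst]
  exact congrArg _ ((Sub.upCovar_comp_consCovar σ .ident S).trans (by rw [Sub.comp_ident]))

/-- The first component is consed last, because it is bound as index `0`. -/
theorem Tm.subst_upVar_instVars (c : Cmd) (σ : Sub) (V W : Val) :
    (c.subst σ.upVar.upVar).instVars V W = c.subst ((σ.consVar W).consVar V) := by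
  rw [Tm.instVars, Tm.subst_subst]
  refine congrArg _ ((Sub.upVar_comp_consVar σ.upVar (Sub.ident.consVar W) V).trans ?_)
  rw [Sub.upVar_comp_consVar, Sub.comp_ident]

theorem Tm.subst_upCovar_instCovars (c : Cmd) (σ : Sub) (S S' : Coval) :
    (c.subst σ.upCovar.upCovar).instCovars S S' = c.subst ((σ.consCovar S').consCovar S) := by
  rw [Tm.instCovars, Tm.subst_subst]
  refine congrArg _ ((Sub.upCovar_comp_consCovar σ.upCovar (Sub.ident.consCovar S') S).trans ?_)
  rw [Sub.upCovar_comp_consCovar, Sub.comp_ident]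

/-! ## An additive presentation of the type system -/

/-- A context given by three relations between names and types: ordinary variables, modal
variables and covariables. -/
structure TCtx : Type where
  reg : ℕ → Ty → Prop
  mod : ℕ → Ty → Prop
  cov : ℕ → Ty → Prop

/-- The declarations of a relation, seen from under one more binder. -/
def shiftRel (G : ℕ → Ty → Prop) : ℕ → Ty → Prop
  | 0, _ => False
  | n + 1, B => G n B

/-- The declarations of a relation, seen from under one more binder, and the bound one. -/
def consRel (A : Ty) (G : ℕ → Ty → Prop) : ℕ → Ty → Prop
  | 0, B => B = A
  | n + 1, B => G n B

namespace TCtx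

def empty : TCtx := ⟨fun _ _ => False, fun _ _ => False, fun _ _ => False⟩

def bindVar (A : Ty) (K : TCtx) : TCtx := ⟨consRel A K.reg, shiftRel K.mod, K.cov⟩

def bindBox (A : Ty) (K : TCtx) : TCtx := ⟨shiftRel K.reg, consRel A K.mod, K.cov⟩

def bindCovar (A : Ty) (K : TCtx) : TCtx := ⟨K.reg, K.mod, consRel A K.cov⟩

/-- The part of the context that can be used under a box. -/
def modal (K : TCtx) : TCtx := ⟨fun x A => K.reg x A ∧ A.pol = .box, K.mod, fun _ _ => False⟩

end TCtx

/-- The judgments derivable when contexts are shared between premises. -/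
inductive HT : TCtx → Judg → Prop
  | ax {K : TCtx} {x : ℕ} {A : Ty} : K.reg x A → HT K (.val (.var x) A)
  | boxAx {K : TCtx} {x : ℕ} {A : Ty} : K.mod x A → HT K (.val (.var x) A)
  | coAx {K : TCtx} {α : ℕ} {A : Ty} : K.cov α A → HT K (.coval (.covar α) A)
  | cutPos {K : TCtx} {p : PosPol} {t : Exp} {S : Coval} {A : Ty} :
      A.pol = p.toPol → HT K (.exp t A) → HT K (.coval S A) → HT K (.cmd (.cutPos p t S))
  | cutNeg {K : TCtx} {V : Val} {e : Env} {A : Ty} :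
      A.pol = .minus → HT K (.val V A) → HT K (.env e A) → HT K (.cmd (.cutNeg V e))
  | ofVal {K : TCtx} {p : PosPol} {V : Val} {A : Ty} :
      A.pol = p.toPol → HT K (.val V A) → HT K (.exp (.ofVal V) A)
  | ofCoval {K : TCtx} {S : Coval} {A : Ty} :
      A.pol = .minus → HT K (.coval S A) → HT K (.env (.ofCoval S) A)
  | muPos {K : TCtx} {p : PosPol} {c : Cmd} {A : Ty} :
      A.pol = p.toPol → HT (K.bindCovar A) (.cmd c) → HT K (.exp (.muPos p c) A)
  | muNeg {K : TCtx} {c : Cmd} {A : Ty} :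
      A.pol = .minus → HT (K.bindCovar A) (.cmd c) → HT K (.val (.muNeg c) A)
  | mutPos {K : TCtx} {p : PosPol} {c : Cmd} {A : Ty} :
      A.pol = p.toPol → HT (K.bindVar A) (.cmd c) → HT K (.coval (.mutPos p c) A)
  | mutNeg {K : TCtx} {c : Cmd} {A : Ty} :
      A.pol = .minus → HT (K.bindVar A) (.cmd c) → HT K (.env (.mutNeg c) A)
  | unit {K : TCtx} : HT K (.val .unit .one)
  | mutUnit {K : TCtx} {c : Cmd} : HT K (.cmd c) → HT K (.coval (.mutUnit c) .one)
  | pair {K : TCtx} {V W : Val} {A B : Ty} :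
      HT K (.val V A) → HT K (.val W B) → HT K (.val (.pair V W) (.tensor A B))
  | mutPair {K : TCtx} {ε₁ ε₂ : Pol} {c : Cmd} {A B : Ty} :
      A.pol = ε₁ → B.pol = ε₂ → HT ((K.bindVar B).bindVar A) (.cmd c) →
      HT K (.coval (.mutPair ε₁ ε₂ c) (.tensor A B))
  | inl {K : TCtx} {V : Val} {A B : Ty} : HT K (.val V A) → HT K (.val (.inl V) (.plus A B))
  | inr {K : TCtx} {V : Val} {A B : Ty} : HT K (.val V B) → HT K (.val (.inr V) (.plus A B))
  | mutSum {K : TCtx} {ε₁ ε₂ : Pol} {c₁ c₂ : Cmd} {A B : Ty} :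
      A.pol = ε₁ → B.pol = ε₂ → HT (K.bindVar A) (.cmd c₁) → HT (K.bindVar B) (.cmd c₂) →
      HT K (.coval (.mutSum ε₁ c₁ ε₂ c₂) (.plus A B))
  | muPar {K : TCtx} {ε₁ ε₂ : Pol} {c : Cmd} {A B : Ty} :
      A.pol = ε₁ → B.pol = ε₂ → HT ((K.bindCovar B).bindCovar A) (.cmd c) →
      HT K (.val (.muPar ε₁ ε₂ c) (.par A B))
  | copair {K : TCtx} {S S' : Coval} {A B : Ty} :
      HT K (.coval S A) → HT K (.coval S' B) → HT K (.coval (.copair S S') (.par A B))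
  | muNot {K : TCtx} {ε : Pol} {c : Cmd} {A : Ty} :
      A.pol = ε → HT (K.bindVar A) (.cmd c) → HT K (.val (.muNot ε c) (.not A))
  | conot {K : TCtx} {V : Val} {A : Ty} : HT K (.val V A) → HT K (.coval (.conot V) (.not A))
  | muWith {K : TCtx} {ε₁ ε₂ : Pol} {c₁ c₂ : Cmd} {A B : Ty} :
      A.pol = ε₁ → B.pol = ε₂ → HT (K.bindCovar A) (.cmd c₁) → HT (K.bindCovar B) (.cmd c₂) →
      HT K (.val (.muWith ε₁ c₁ ε₂ c₂) (.withT A B))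
  | fst {K : TCtx} {S : Coval} {A B : Ty} :
      HT K (.coval S A) → HT K (.coval (.fst S) (.withT A B))
  | snd {K : TCtx} {S : Coval} {A B : Ty} :
      HT K (.coval S B) → HT K (.coval (.snd S) (.withT A B))
  -- Weakening is built in: the conclusion may hold non-modal ordinary variables and covariables,
  -- which the premise does not see.
  | box {K : TCtx} {V : Val} {A : Ty} : HT K.modal (.val V A) → HT K (.val (.box V) (.box A))
  | mutBox {K : TCtx} {ε : Pol} {c : Cmd} {A : Ty} :
      A.pol = ε → HT (K.bindBox A) (.cmd c) → HT K (.coval (.mutBox ε c) (.box A))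

/-! ### Renaming -/

/-- The renaming `f`, `g` maps the context `K` into `K'`; ordinary variables may become modal. -/
structure TCtx.Ren (f g : ℕ → ℕ) (K K' : TCtx) : Prop where
  -- The second alternative is needed when an ordinary variable of modal type is allocated: it goes
  -- to the heap, whose variables count as modal.
  reg : ∀ x A, K.reg x A → K'.reg (f x) A ∨ K'.mod (f x) A
  mod : ∀ x A, K.mod x A → K'.mod (f x) A
  cov : ∀ α A, K.cov α A → K'.cov (g α) A

namespace TCtx.Ren

variable {f g : ℕ → ℕ} {K K' : TCtx}

theorem bindVar (h : Ren f g K K') (A : Ty) : Ren (up f) g (K.bindVar A) (K'.bindVar A) where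
  reg := by rintro (_ | x) B hB; exacts [Or.inl hB, h.reg x B hB]
  mod := by rintro (_ | x) B hB; exacts [hB.elim, h.mod x B hB]
  cov := h.cov

theorem bindBox (h : Ren f g K K') (A : Ty) : Ren (up f) g (K.bindBox A) (K'.bindBox A) where
  reg := by rintro (_ | x) B hB; exacts [hB.elim, h.reg x B hB]
  mod := by rintro (_ | x) B hB; exacts [hB, h.mod x B hB]
  cov := h.cov

theorem bindCovar (h : Ren f g K K') (A : Ty) :
    Ren f (up g) (K.bindCovar A) (K'.bindCovar A) where
  reg := h.reg
  mod := h.mod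
  cov := by rintro (_ | x) B hB; exacts [hB, h.cov x B hB]

theorem modal (h : Ren f g K K') (g' : ℕ → ℕ) : Ren f g' K.modal K'.modal where
  reg := fun x A hA => (h.reg x A hA.1).imp (fun h' => ⟨h', hA.2⟩) id
  mod := h.mod
  cov := fun _ _ h' => h'.elim

theorem succ_bindVar (K : TCtx) (A : Ty) : Ren Nat.succ id K (K.bindVar A) :=
  ⟨fun _ _ h => Or.inl h, fun _ _ h => h, fun _ _ h => h⟩

theorem succ_bindBox (K : TCtx) (A : Ty) : Ren Nat.succ id K (K.bindBox A) :=
  ⟨fun _ _ h => Or.inl h, fun _ _ h => h, fun _ _ h => h⟩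

theorem succ_bindCovar (K : TCtx) (A : Ty) : Ren id Nat.succ K (K.bindCovar A) :=
  ⟨fun _ _ h => Or.inl h, fun _ _ h => h, fun _ _ h => h⟩

end TCtx.Ren

theorem HT.rename {K K' : TCtx} {J : Judg} {f g : ℕ → ℕ} (h : HT K J) (hr : TCtx.Ren f g K K') :
    HT K' (J.rename f g) := by
  induction h generalizing K' f g with
  | ax h => exact (hr.reg _ _ h).elim .ax .boxAx
  | boxAx h => exact .boxAx (hr.mod _ _ h)
  | coAx h => exact .coAx (hr.cov _ _ h)
  | cutPos hA _ _ ih ih' => exact .cutPos hA (ih hr) (ih' hr)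
  | cutNeg hA _ _ ih ih' => exact .cutNeg hA (ih hr) (ih' hr)
  | ofVal hA _ ih => exact .ofVal hA (ih hr)
  | ofCoval hA _ ih => exact .ofCoval hA (ih hr)
  | muPos hA _ ih => exact .muPos hA (ih (hr.bindCovar _))
  | muNeg hA _ ih => exact .muNeg hA (ih (hr.bindCovar _))
  | mutPos hA _ ih => exact .mutPos hA (ih (hr.bindVar _))
  | mutNeg hA _ ih => exact .mutNeg hA (ih (hr.bindVar _))
  | unit => exact .unit
  | mutUnit _ ih => exact .mutUnit (ih hr)
  | pair _ _ ih ih' => exact .pair (ih hr) (ih' hr)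
  | mutPair hA hB _ ih => exact .mutPair hA hB (ih ((hr.bindVar _).bindVar _))
  | inl _ ih => exact .inl (ih hr)
  | inr _ ih => exact .inr (ih hr)
  | mutSum hA hB _ _ ih ih' => exact .mutSum hA hB (ih (hr.bindVar _)) (ih' (hr.bindVar _))
  | muPar hA hB _ ih => exact .muPar hA hB (ih ((hr.bindCovar _).bindCovar _))
  | copair _ _ ih ih' => exact .copair (ih hr) (ih' hr)
  | muNot hA _ ih => exact .muNot hA (ih (hr.bindVar _))
  | conot _ ih => exact .conot (ih hr)
  | muWith hA hB _ _ ih ih' =>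
    exact .muWith hA hB (ih (hr.bindCovar _)) (ih' (hr.bindCovar _))
  | fst _ ih => exact .fst (ih hr)
  | snd _ ih => exact .snd (ih hr)
  | box _ ih => exact .box (ih (hr.modal _))
  | mutBox hA _ ih => exact .mutBox hA (ih (hr.bindBox _))

theorem Judg.rename_id (J : Judg) : J.rename id id = J := by
  cases J <;> simp only [Judg.rename, Tm.rename_id]

/-- Every declaration of `K` is one of `K'`. -/
abbrev TCtx.Le (K K' : TCtx) : Prop := TCtx.Ren id id K K'

theorem HT.mono {K K' : TCtx} {J : Judg} (h : HT K J) (hr : K.Le K') : HT K' J := by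
  simpa only [Judg.rename_id] using h.rename hr

theorem TCtx.modal_le (K : TCtx) : K.modal.Le K :=
  ⟨fun _ _ h => Or.inl h.1, fun _ _ h => h, fun _ _ h => h.elim⟩

theorem Pol.odot_eq_box {ε ε' : Pol} (h : ε.odot ε' = .box) : ε = .box ∧ ε' = .box := by
  cases ε <;> cases ε' <;> first | exact ⟨rfl, rfl⟩ | cases h

/-- A value of modal type only refers to the part of the context that can be used under a box. -/
theorem HT.modal_of_box {K : TCtx} {V : Val} {A : Ty} (h : HT K (.val V A)) (hA : A.pol = .box) :
    HT K.modal (.val V A) := by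
  generalize hJ : Judg.val V A = J at h
  induction h generalizing V A with
  | ax h => cases hJ; exact .ax ⟨h, hA⟩
  | boxAx h => cases hJ; exact .boxAx h
  -- All value abstractions have negative types, which leaves only variables and constructors.
  | muNeg hm _ _ => cases hJ; cases hm.symm.trans hA
  | unit => cases hJ; exact .unit
  | pair _ _ ih ih' =>
    cases hJ
    obtain ⟨h, h'⟩ := Pol.odot_eq_box hA
    exact .pair (ih h rfl) (ih' h' rfl)
  | inl _ ih => cases hJ; exact .inl (ih (Pol.odot_eq_box hA).1 rfl)
  | inr _ ih => cases hJ; exact .inr (ih (Pol.odot_eq_box hA).2 rfl)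
  | box h _ =>
    cases hJ
    -- Restricting a context to its modal part twice is the same as doing it once.
    exact .box (h.mono ⟨fun _ _ h => Or.inl ⟨h, h.2⟩, fun _ _ h => h, fun _ _ h => h⟩)
  | muPar | muNot | muWith => cases hJ; cases hA
  | _ => cases hJ

/-! ### Free variables and substitution -/

def Judg.FreeVar : Judg → ℕ → Prop
  | .val V _, x => V.FreeVar x
  | .coval S _, x => S.FreeVar x
  | .exp t _, x => t.FreeVar x
  | .env e _, x => e.FreeVar x
  | .cmd c, x => c.FreeVar x

def Judg.FreeCovar : Judg → ℕ → Prop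
  | .val V _, x => V.FreeCovar x
  | .coval S _, x => S.FreeCovar x
  | .exp t _, x => t.FreeCovar x
  | .env e _, x => e.FreeCovar x
  | .cmd c, x => c.FreeCovar x

def Judg.subst : Judg → Sub → Judg
  | .val V A, σ => .val (V.subst σ) A
  | .coval S A, σ => .coval (S.subst σ) A
  | .exp t A, σ => .exp (t.subst σ) A
  | .env e A, σ => .env (e.subst σ) A
  | .cmd c, σ => .cmd (c.subst σ)

theorem HT.freeVar {K : TCtx} {J : Judg} (h : HT K J) {x : ℕ} (hx : J.FreeVar x) :
    ∃ A, K.reg x A ∨ K.mod x A := by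
  induction h generalizing x with
  | ax h => cases hx; exact ⟨_, Or.inl h⟩
  | boxAx h => cases hx; exact ⟨_, Or.inr h⟩
  | coAx h => exact hx.elim
  | unit => exact hx.elim
  | cutPos _ _ _ ih ih' | cutNeg _ _ _ ih ih' | pair _ _ ih ih' | copair _ _ ih ih' =>
    exact Or.elim hx ih ih'
  | mutSum _ _ _ _ ih ih' => exact hx.elim ih ih'
  | muWith _ _ _ _ ih ih' => exact hx.elim ih ih'
  | box _ ih => obtain ⟨A, h⟩ := ih hx; exact ⟨A, h.imp And.left id⟩
  | ofVal _ _ ih | ofCoval _ _ ih | mutUnit _ ih | inl _ ih | inr _ ih | conot _ ih | fst _ ih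
  | snd _ ih | muPos _ _ ih | muNeg _ _ ih | mutPos _ _ ih | mutNeg _ _ ih | muNot _ _ ih
  | mutBox _ _ ih | mutPair _ _ _ ih | muPar _ _ _ ih =>
    exact ih hx

theorem HT.freeCovar {K : TCtx} {J : Judg} (h : HT K J) {α : ℕ} (hα : J.FreeCovar α) :
    ∃ A, K.cov α A := by
  induction h generalizing α with
  | ax h => exact hα.elim
  | boxAx h => exact hα.elim
  | coAx h => cases hα; exact ⟨_, h⟩
  | unit => exact hα.elim
  | cutPos _ _ _ ih ih' | cutNeg _ _ _ ih ih' | pair _ _ ih ih' | copair _ _ ih ih' =>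
    exact Or.elim hα ih ih'
  | mutSum _ _ _ _ ih ih' => exact hα.elim ih ih'
  | muWith _ _ _ _ ih ih' => exact hα.elim ih ih'
  | box _ ih => obtain ⟨A, h⟩ := ih hα; exact h.elim
  | ofVal _ _ ih | ofCoval _ _ ih | mutUnit _ ih | inl _ ih | inr _ ih | conot _ ih | fst _ ih
  | snd _ ih | muPos _ _ ih | muNeg _ _ ih | mutPos _ _ ih | mutNeg _ _ ih | muNot _ _ ih
  | mutBox _ _ ih | mutPair _ _ _ ih | muPar _ _ _ ih =>
    exact ih hα

/-- `σ` and `τ` agree on the declarations of `K`. -/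
structure TCtx.Agree (K : TCtx) (σ τ : Sub) : Prop where
  reg : ∀ x A, K.reg x A → σ.onVar x = τ.onVar x
  mod : ∀ x A, K.mod x A → σ.onVar x = τ.onVar x
  cov : ∀ α A, K.cov α A → σ.onCovar α = τ.onCovar α

namespace TCtx.Agree

variable {σ τ : Sub} {K : TCtx}

theorem bindVar (h : K.Agree σ τ) (A : Ty) : (K.bindVar A).Agree σ.upVar τ.upVar where
  reg := by rintro (_ | x) B hB; exacts [rfl, congrArg (Tm.rename · Nat.succ id) (h.reg x B hB)]
  mod := by rintro (_ | x) B hB; exacts [rfl, congrArg (Tm.rename · Nat.succ id) (h.mod x B hB)]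
  cov := fun α B hB => congrArg (Tm.rename · Nat.succ id) (h.cov α B hB)

theorem bindBox (h : K.Agree σ τ) (A : Ty) : (K.bindBox A).Agree σ.upVar τ.upVar where
  reg := by rintro (_ | x) B hB; exacts [rfl, congrArg (Tm.rename · Nat.succ id) (h.reg x B hB)]
  mod := by rintro (_ | x) B hB; exacts [rfl, congrArg (Tm.rename · Nat.succ id) (h.mod x B hB)]
  cov := fun α B hB => congrArg (Tm.rename · Nat.succ id) (h.cov α B hB)

theorem bindCovar (h : K.Agree σ τ) (A : Ty) : (K.bindCovar A).Agree σ.upCovar τ.upCovar where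
  reg := fun x B hB => congrArg (Tm.rename · id Nat.succ) (h.reg x B hB)
  mod := fun x B hB => congrArg (Tm.rename · id Nat.succ) (h.mod x B hB)
  cov := by rintro (_ | x) B hB; exacts [rfl, congrArg (Tm.rename · id Nat.succ) (h.cov x B hB)]

theorem modal (h : K.Agree σ τ) : K.modal.Agree σ τ :=
  ⟨fun x A hA => h.reg x A hA.1, h.mod, fun _ _ h => h.elim⟩

end TCtx.Agree

/-- Typing bounds the free names, so a substitution can be changed freely elsewhere. This allows the
unfolding of a memory to be extended at new names without disturbing the terms already stored. -/
theorem HT.subst_congr {K : TCtx} {J : Judg} {σ τ : Sub} (h : HT K J) (ha : K.Agree σ τ) :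
    J.subst σ = J.subst τ := by
  induction h generalizing σ τ with
  | ax h => simp only [Judg.subst, Tm.subst, ha.reg _ _ h]
  | boxAx h => simp only [Judg.subst, Tm.subst, ha.mod _ _ h]
  | coAx h => simp only [Judg.subst, Tm.subst, ha.cov _ _ h]
  | unit => rfl
  | cutPos _ _ _ ih ih' | cutNeg _ _ _ ih ih' | pair _ _ ih ih' | copair _ _ ih ih' =>
    have h := ih ha; have h' := ih' ha
    simp only [Judg.subst, Tm.subst, Judg.val.injEq, Judg.coval.injEq, Judg.exp.injEq,
      Judg.env.injEq] at h h' ⊢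
    simp only [h, h', and_self]
  | ofVal _ _ ih | ofCoval _ _ ih | mutUnit _ ih | inl _ ih | inr _ ih | conot _ ih | fst _ ih
  | snd _ ih =>
    have h := ih ha
    simp only [Judg.subst, Tm.subst, Judg.val.injEq, Judg.coval.injEq, Judg.cmd.injEq] at h ⊢
    simp only [h, and_self]
  | box _ ih =>
    have h := ih ha.modal
    simp only [Judg.subst, Tm.subst, Judg.val.injEq] at h ⊢
    simp only [h, and_self]
  | muPos _ _ ih | muNeg _ _ ih =>
    have h := ih (ha.bindCovar _)
    simp only [Judg.subst, Tm.subst, Judg.cmd.injEq] at h ⊢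
    simp only [h]
  | mutPos _ _ ih | mutNeg _ _ ih | muNot _ _ ih =>
    have h := ih (ha.bindVar _)
    simp only [Judg.subst, Tm.subst, Judg.cmd.injEq] at h ⊢
    simp only [h]
  | mutBox _ _ ih =>
    have h := ih (ha.bindBox _)
    simp only [Judg.subst, Tm.subst, Judg.cmd.injEq] at h ⊢
    simp only [h]
  | mutPair _ _ _ ih =>
    have h := ih ((ha.bindVar _).bindVar _)
    simp only [Judg.subst, Tm.subst, Judg.cmd.injEq] at h ⊢
    simp only [h]
  | muPar _ _ _ ih =>
    have h := ih ((ha.bindCovar _).bindCovar _)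
    simp only [Judg.subst, Tm.subst, Judg.cmd.injEq] at h ⊢
    simp only [h]
  | mutSum _ _ _ _ ih ih' =>
    have h := ih (ha.bindVar _); have h' := ih' (ha.bindVar _)
    simp only [Judg.subst, Tm.subst, Judg.cmd.injEq] at h h' ⊢
    simp only [h, h']
  | muWith _ _ _ _ ih ih' =>
    have h := ih (ha.bindCovar _); have h' := ih' (ha.bindCovar _)
    simp only [Judg.subst, Tm.subst, Judg.cmd.injEq] at h h' ⊢
    simp only [h, h']

/-- `σ` maps the declarations of `K` to terms of the same type in `K'`. -/
structure TCtx.SubstTyped (σ : Sub) (K K' : TCtx) : Prop where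
  reg : ∀ x A, K.reg x A → HT K' (.val (σ.onVar x) A)
  -- A modal variable can occur under a box whatever its type, so its substitute has to be typable
  -- there too.
  mod : ∀ x A, K.mod x A → HT K'.modal (.val (σ.onVar x) A)
  cov : ∀ α A, K.cov α A → HT K' (.coval (σ.onCovar α) A)

namespace TCtx.SubstTyped

variable {σ : Sub} {K K' : TCtx}

theorem bindVar (h : SubstTyped σ K K') (A : Ty) :
    SubstTyped σ.upVar (K.bindVar A) (K'.bindVar A) where
  reg := by
    rintro (_ | x) B hB
    exacts [.ax hB, (h.reg x B hB).rename (Ren.succ_bindVar K' A)]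
  mod := by
    rintro (_ | x) B hB
    exacts [hB.elim, (h.mod x B hB).rename ((Ren.succ_bindVar K' A).modal id)]
  cov := fun α B hB => (h.cov α B hB).rename (Ren.succ_bindVar K' A)

theorem bindBox (h : SubstTyped σ K K') (A : Ty) :
    SubstTyped σ.upVar (K.bindBox A) (K'.bindBox A) where
  reg := by
    rintro (_ | x) B hB
    exacts [hB.elim, (h.reg x B hB).rename (Ren.succ_bindBox K' A)]
  mod := by
    rintro (_ | x) B hB
    exacts [.boxAx hB, (h.mod x B hB).rename ((Ren.succ_bindBox K' A).modal id)]
  cov := fun α B hB => (h.cov α B hB).rename (Ren.succ_bindBox K' A)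

theorem bindCovar (h : SubstTyped σ K K') (A : Ty) :
    SubstTyped σ.upCovar (K.bindCovar A) (K'.bindCovar A) where
  reg := fun x B hB => (h.reg x B hB).rename (Ren.succ_bindCovar K' A)
  mod := fun x B hB => (h.mod x B hB).rename ((Ren.succ_bindCovar K' A).modal Nat.succ)
  cov := by
    rintro (_ | x) B hB
    exacts [.coAx hB, (h.cov x B hB).rename (Ren.succ_bindCovar K' A)]

/-- An ordinary variable that is still visible under a box has modal type, and then
`HT.modal_of_box` applies to its substitute. This is why modal values can be substituted into boxes.
-/
theorem modal (h : SubstTyped σ K K') : SubstTyped σ K.modal K'.modal where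
  reg := fun x A hA => (h.reg x A hA.1).modal_of_box hA.2
  mod := fun x A hA => (h.mod x A hA).mono
    ⟨fun _ _ h => Or.inl ⟨h, h.2⟩, fun _ _ h => h, fun _ _ h => h⟩
  cov := fun _ _ h => h.elim

end TCtx.SubstTyped

theorem HT.subst {K K' : TCtx} {J : Judg} {σ : Sub} (h : HT K J)
    (hs : TCtx.SubstTyped σ K K') : HT K' (J.subst σ) := by
  induction h generalizing K' σ with
  | ax h => exact hs.reg _ _ h
  | boxAx h => exact (hs.mod _ _ h).mono K'.modal_le
  | coAx h => exact hs.cov _ _ h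
  | cutPos hA _ _ ih ih' => exact .cutPos hA (ih hs) (ih' hs)
  | cutNeg hA _ _ ih ih' => exact .cutNeg hA (ih hs) (ih' hs)
  | ofVal hA _ ih => exact .ofVal hA (ih hs)
  | ofCoval hA _ ih => exact .ofCoval hA (ih hs)
  | muPos hA _ ih => exact .muPos hA (ih (hs.bindCovar _))
  | muNeg hA _ ih => exact .muNeg hA (ih (hs.bindCovar _))
  | mutPos hA _ ih => exact .mutPos hA (ih (hs.bindVar _))
  | mutNeg hA _ ih => exact .mutNeg hA (ih (hs.bindVar _))
  | unit => exact .unit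
  | mutUnit _ ih => exact .mutUnit (ih hs)
  | pair _ _ ih ih' => exact .pair (ih hs) (ih' hs)
  | mutPair hA hB _ ih => exact .mutPair hA hB (ih ((hs.bindVar _).bindVar _))
  | inl _ ih => exact .inl (ih hs)
  | inr _ ih => exact .inr (ih hs)
  | mutSum hA hB _ _ ih ih' => exact .mutSum hA hB (ih (hs.bindVar _)) (ih' (hs.bindVar _))
  | muPar hA hB _ ih => exact .muPar hA hB (ih ((hs.bindCovar _).bindCovar _))
  | copair _ _ ih ih' => exact .copair (ih hs) (ih' hs)
  | muNot hA _ ih => exact .muNot hA (ih (hs.bindVar _))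
  | conot _ ih => exact .conot (ih hs)
  | muWith hA hB _ _ ih ih' =>
    exact .muWith hA hB (ih (hs.bindCovar _)) (ih' (hs.bindCovar _))
  | fst _ ih => exact .fst (ih hs)
  | snd _ ih => exact .snd (ih hs)
  | box _ ih => exact .box (ih hs.modal)
  | mutBox hA _ ih => exact .mutBox hA (ih (hs.bindBox _))

/-! ### Comparison with the multiplicative presentation -/

/-- The declarations of three lists. -/
def TCtx.ofLists (Γ Θ Δ : Ctx) : TCtx :=
  ⟨fun x A => (x, A) ∈ Γ, fun x A => (x, A) ∈ Θ, fun α A => (α, A) ∈ Δ⟩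

theorem Ctx.mem_shift_zero {Γ : Ctx} {B : Ty} : ¬ (0, B) ∈ Γ.shift := by
  intro h
  obtain ⟨_, _, h'⟩ := List.mem_map.1 h
  cases h'

theorem Ctx.mem_shift_succ {Γ : Ctx} {x : ℕ} {B : Ty} : (x + 1, B) ∈ Γ.shift ↔ (x, B) ∈ Γ := by
  simp only [Ctx.shift, List.mem_map, Prod.mk.injEq, Nat.add_right_cancel_iff, Prod.exists,
    exists_eq_right_right, exists_eq_right]

theorem Ctx.mem_shift_iff {Γ : Ctx} {x : ℕ} {B : Ty} :
    (x, B) ∈ Γ.shift ↔ shiftRel (fun x A => (x, A) ∈ Γ) x B := by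
  cases x
  · exact iff_of_false mem_shift_zero id
  · exact mem_shift_succ

theorem Ctx.mem_cons_shift_iff {Γ : Ctx} {A : Ty} {x : ℕ} {B : Ty} :
    (x, B) ∈ (0, A) :: Γ.shift ↔ consRel A (fun x A => (x, A) ∈ Γ) x B := by
  cases x
  · simp only [List.mem_cons, Prod.mk.injEq, true_and, mem_shift_zero, or_false]; exact Iff.rfl
  · simp only [List.mem_cons, Prod.mk.injEq, Nat.add_one_ne_zero, false_and, false_or]
    exact mem_shift_succ

namespace TCtx

theorem bindVar_ofLists (Γ Θ Δ : Ctx) (A : Ty) :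
    (ofLists Γ Θ Δ).bindVar A = ofLists ((0, A) :: Γ.shift) Θ.shift Δ := by
  simp only [bindVar, ofLists, Ctx.mem_shift_iff, Ctx.mem_cons_shift_iff]

theorem bindBox_ofLists (Γ Θ Δ : Ctx) (A : Ty) :
    (ofLists Γ Θ Δ).bindBox A = ofLists Γ.shift ((0, A) :: Θ.shift) Δ := by
  simp only [bindBox, ofLists, Ctx.mem_shift_iff, Ctx.mem_cons_shift_iff]

theorem bindCovar_ofLists (Γ Θ Δ : Ctx) (A : Ty) :
    (ofLists Γ Θ Δ).bindCovar A = ofLists Γ Θ ((0, A) :: Δ.shift) := by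
  simp only [bindCovar, ofLists, Ctx.mem_cons_shift_iff]

theorem ofLists_le_append_left (Γ Θ Δ Γ' Θ' Δ' : Ctx) :
    (ofLists Γ Θ Δ).Le (ofLists (Γ ++ Γ') (Θ ++ Θ') (Δ ++ Δ')) :=
  ⟨fun _ _ h => Or.inl (List.mem_append_left _ h), fun _ _ h => List.mem_append_left _ h,
    fun _ _ h => List.mem_append_left _ h⟩

theorem ofLists_le_append_right (Γ Θ Δ Γ' Θ' Δ' : Ctx) :
    (ofLists Γ' Θ' Δ').Le (ofLists (Γ ++ Γ') (Θ ++ Θ') (Δ ++ Δ')) :=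
  ⟨fun _ _ h => Or.inl (List.mem_append_right _ h), fun _ _ h => List.mem_append_right _ h,
    fun _ _ h => List.mem_append_right _ h⟩

end TCtx

-- Disjoint contexts are weakened to their concatenation, and the renaming rule is absorbed by
-- `HT.rename`.
open TCtx in
theorem Typed.toHT {Γ Θ Δ : Ctx} {J : Judg} (h : Typed Γ Θ Δ J) : HT (.ofLists Γ Θ Δ) J := by
  induction h with
  | ax => exact .ax (List.mem_singleton_self _)
  | boxAx => exact .boxAx (List.mem_singleton_self _)
  | coAx => exact .coAx (List.mem_singleton_self _)
  | cutPos hA _ _ _ ih ih' =>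
    exact .cutPos hA (ih.mono (ofLists_le_append_left ..)) (ih'.mono (ofLists_le_append_right ..))
  | cutNeg hA _ _ _ ih ih' =>
    exact .cutNeg hA (ih.mono (ofLists_le_append_left ..)) (ih'.mono (ofLists_le_append_right ..))
  | ofVal hA _ ih => exact .ofVal hA ih
  | ofCoval hA _ ih => exact .ofCoval hA ih
  | muPos hA _ ih => exact .muPos hA (by rwa [bindCovar_ofLists])
  | muNeg hA _ ih => exact .muNeg hA (by rwa [bindCovar_ofLists])
  | mutPos hA _ ih => exact .mutPos hA (by rwa [bindVar_ofLists])
  | mutNeg hA _ ih => exact .mutNeg hA (by rwa [bindVar_ofLists])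
  | unit => exact .unit
  | mutUnit _ ih => exact .mutUnit ih
  | pair _ _ _ ih ih' =>
    exact .pair (ih.mono (ofLists_le_append_left ..)) (ih'.mono (ofLists_le_append_right ..))
  | mutPair hA hB _ ih => exact .mutPair hA hB (by rwa [bindVar_ofLists, bindVar_ofLists])
  | inl _ ih => exact .inl ih
  | inr _ ih => exact .inr ih
  | mutSum hA hB _ _ ih ih' =>
    exact .mutSum hA hB (by rwa [bindVar_ofLists]) (by rwa [bindVar_ofLists])
  | muPar hA hB _ ih => exact .muPar hA hB (by rwa [bindCovar_ofLists, bindCovar_ofLists])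
  | copair _ _ _ ih ih' =>
    exact .copair (ih.mono (ofLists_le_append_left ..)) (ih'.mono (ofLists_le_append_right ..))
  | muNot hA _ ih => exact .muNot hA (by rwa [bindVar_ofLists])
  | conot _ ih => exact .conot ih
  | muWith hA hB _ _ ih ih' =>
    exact .muWith hA hB (by rwa [bindCovar_ofLists]) (by rwa [bindCovar_ofLists])
  | fst _ ih => exact .fst ih
  | snd _ ih => exact .snd ih
  | box hΓ _ ih =>
    exact .box (ih.mono ⟨fun _ _ h => Or.inl ⟨h, hΓ _ h⟩, fun _ _ h => h, fun _ _ h => by cases h⟩)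
  | mutBox hA _ ih => exact .mutBox hA (by rwa [bindBox_ofLists])
  | ren f g hr _ _ ih =>
    exact ih.rename ⟨fun _ _ h => Or.inl (hr.1 _ h), fun _ _ h => hr.2.1 _ h,
      fun _ _ h => hr.2.2 _ h⟩

theorem Typed.weaken {Γ Θ Δ Γ' Θ' Δ' : Ctx} {J : Judg} (h : Typed Γ Θ Δ J) (hΓ : Γ ⊆ Γ')
    (hΘ : Θ ⊆ Θ') (hΔ : Δ ⊆ Δ') (hd : Distinct Γ' Θ' Δ') : Typed Γ' Θ' Δ' J := by
  have := Typed.ren id id ⟨fun _ h => hΓ h, fun _ h => hΘ h, fun _ h => hΔ h⟩ hd h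
  rwa [Judg.rename_id] at this

/-! ### Sharing a context by duplication and contraction -/

/-- The declarations of `Γ`, renamed by `f`. -/
def Ctx.mapName (f : ℕ → ℕ) (Γ : Ctx) : Ctx := Γ.map (fun d => (f d.1, d.2))

theorem Ctx.map_fst_mapName (f : ℕ → ℕ) (Γ : Ctx) :
    (Γ.mapName f).map Prod.fst = (Γ.map Prod.fst).map f := by
  simp only [Ctx.mapName, List.map_map]; rfl

theorem nodup_even_append_odd {l : List ℕ} (h : l.Nodup) :
    (l.map (fun n => 2 * n) ++ l.map (fun n => 2 * n + 1)).Nodup := by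
  refine List.nodup_append.2 ⟨h.map fun a b h => ?_, h.map fun a b h => ?_, ?_⟩
  · omega
  · omega
  · intro a ha b hb
    obtain ⟨m, -, rfl⟩ := List.mem_map.1 ha
    obtain ⟨n, -, rfl⟩ := List.mem_map.1 hb
    omega

/-- Two copies of a context on even and on odd names. -/
theorem Distinct.two_copies {Γ Θ Δ : Ctx} (h : Distinct Γ Θ Δ) :
    Distinct (Γ.mapName (fun n => 2 * n) ++ Γ.mapName (fun n => 2 * n + 1))
      (Θ.mapName (fun n => 2 * n) ++ Θ.mapName (fun n => 2 * n + 1))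
      (Δ.mapName (fun n => 2 * n) ++ Δ.mapName (fun n => 2 * n + 1)) := by
  constructor
  -- The two lists differ by the exchange of the odd copy of `Γ` with the even copy of `Θ`.
  · refine List.Perm.nodup ?_ (nodup_even_append_odd h.1)
    simp only [List.map_append, Ctx.map_fst_mapName, List.append_assoc]
    refine List.Perm.append_left _ ?_
    simp only [← List.append_assoc]
    exact List.Perm.append_right _ List.perm_append_comm
  · simpa only [List.map_append, Ctx.map_fst_mapName] using nodup_even_append_odd h.2

theorem Distinct.mapName {Γ Θ Δ : Ctx} (h : Distinct Γ Θ Δ) {f : ℕ → ℕ}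
    (hf : Function.Injective f) : Distinct (Γ.mapName f) (Θ.mapName f) (Δ.mapName f) := by
  constructor
  · have := h.1.map hf
    simpa only [List.map_append, Ctx.map_fst_mapName] using this
  · simpa only [Ctx.map_fst_mapName] using h.2.map hf

theorem Typed.mapName {Γ Θ Δ : Ctx} {J : Judg} (hd : Distinct Γ Θ Δ) (h : Typed Γ Θ Δ J)
    {f : ℕ → ℕ} (hf : Function.Injective f) :
    Typed (Γ.mapName f) (Θ.mapName f) (Δ.mapName f) (J.rename f f) :=
  .ren f f ⟨fun _ h => List.mem_map_of_mem h, fun _ h => List.mem_map_of_mem h,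
    fun _ h => List.mem_map_of_mem h⟩ (hd.mapName hf) h

theorem even_injective : Function.Injective (fun n : ℕ => 2 * n) := fun a b h => by
  simp only at h; omega

theorem odd_injective : Function.Injective (fun n : ℕ => 2 * n + 1) := fun a b h => by
  simp only at h; omega

theorem Ctx.half_mem {Γ : Ctx} {d : ℕ × Ty}
    (h : d ∈ Γ.mapName (fun n => 2 * n) ++ Γ.mapName (fun n => 2 * n + 1)) :
    (d.1 / 2, d.2) ∈ Γ := by
  rcases List.mem_append.1 h with h | h <;> obtain ⟨⟨m, A⟩, hm, rfl⟩ := List.mem_map.1 h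
  · have : 2 * m / 2 = m := by omega
    simpa only [this] using hm
  · have : (2 * m + 1) / 2 = m := by omega
    simpa only [this] using hm

theorem Tm.rename_even_half {s : Cls} (t : Tm s) :
    (t.rename (fun n => 2 * n) (fun n => 2 * n)).rename (· / 2) (· / 2) = t := by
  rw [Tm.rename_rename]
  have : (fun n : ℕ => 2 * n / 2) = id := by funext n; simp only [id]; omega
  rw [this, Tm.rename_id]

theorem Tm.rename_odd_half {s : Cls} (t : Tm s) :
    (t.rename (fun n => 2 * n + 1) (fun n => 2 * n + 1)).rename (· / 2) (· / 2) = t := by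
  rw [Tm.rename_rename]
  have : (fun n : ℕ => (2 * n + 1) / 2) = id := by funext n; simp only [id]; omega
  rw [this, Tm.rename_id]

/-- Two copies of a context can be contracted into one. -/
theorem Typed.contract {Γ Θ Δ : Ctx} {J : Judg} (hd : Distinct Γ Θ Δ)
    (h : Typed (Γ.mapName (fun n => 2 * n) ++ Γ.mapName (fun n => 2 * n + 1))
      (Θ.mapName (fun n => 2 * n) ++ Θ.mapName (fun n => 2 * n + 1))
      (Δ.mapName (fun n => 2 * n) ++ Δ.mapName (fun n => 2 * n + 1)) J) :
    Typed Γ Θ Δ (J.rename (· / 2) (· / 2)) :=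
  .ren _ _ ⟨fun _ h => Ctx.half_mem h, fun _ h => Ctx.half_mem h, fun _ h => Ctx.half_mem h⟩ hd h

theorem Ctx.map_fst_shift (Γ : Ctx) : Γ.shift.map Prod.fst = (Γ.map Prod.fst).map Nat.succ := by
  simp only [Ctx.shift, List.map_map]; rfl

theorem nodup_zero_cons_succ {l : List ℕ} (h : l.Nodup) : (0 :: l.map Nat.succ).Nodup := by
  refine List.nodup_cons.2 ⟨fun h' => ?_, h.map Nat.succ_injective⟩
  obtain ⟨_, _, h⟩ := List.mem_map.1 h'
  cases h

theorem Distinct.bindVar {Γ Θ Δ : Ctx} (h : Distinct Γ Θ Δ) (A : Ty) :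
    Distinct ((0, A) :: Γ.shift) Θ.shift Δ := by
  refine ⟨?_, h.2⟩
  have := nodup_zero_cons_succ h.1
  simpa only [List.cons_append, List.map_cons, List.map_append, Ctx.map_fst_shift] using this

theorem Distinct.bindBox {Γ Θ Δ : Ctx} (h : Distinct Γ Θ Δ) (A : Ty) :
    Distinct Γ.shift ((0, A) :: Θ.shift) Δ := by
  refine ⟨?_, h.2⟩
  refine List.Perm.nodup ?_ (nodup_zero_cons_succ h.1)
  simp only [List.map_cons, List.map_append, Ctx.map_fst_shift]
  exact List.perm_middle.symm

theorem Distinct.bindCovar {Γ Θ Δ : Ctx} (h : Distinct Γ Θ Δ) (A : Ty) :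
    Distinct Γ Θ ((0, A) :: Δ.shift) := by
  refine ⟨h.1, ?_⟩
  have := nodup_zero_cons_succ h.2
  simpa only [List.map_cons, Ctx.map_fst_shift] using this

namespace TCtx

theorem bindVar_le_ofLists {K : TCtx} {Γ Θ Δ : Ctx} (h : K.Le (ofLists Γ Θ Δ)) (A : Ty) :
    (K.bindVar A).Le (ofLists ((0, A) :: Γ.shift) Θ.shift Δ) := by
  have := h.bindVar A
  rwa [up_id, bindVar_ofLists] at this

theorem bindBox_le_ofLists {K : TCtx} {Γ Θ Δ : Ctx} (h : K.Le (ofLists Γ Θ Δ)) (A : Ty) :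
    (K.bindBox A).Le (ofLists Γ.shift ((0, A) :: Θ.shift) Δ) := by
  have := h.bindBox A
  rwa [up_id, bindBox_ofLists] at this

theorem bindCovar_le_ofLists {K : TCtx} {Γ Θ Δ : Ctx} (h : K.Le (ofLists Γ Θ Δ)) (A : Ty) :
    (K.bindCovar A).Le (ofLists Γ Θ ((0, A) :: Δ.shift)) := by
  have := h.bindCovar A
  rwa [up_id, bindCovar_ofLists] at this

end TCtx

instance : DecidableEq Pol := fun a b => by
  cases a <;> cases b <;> first | exact isTrue rfl | exact isFalse (fun h => by cases h)

-- Needed to state the type of the final value in the original system. A rule with disjoint contexts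
-- is applied to an even and an odd copy of the shared context, and the renaming `n ↦ n / 2` then
-- contracts the copies.
open TCtx in
theorem HT.toTyped {K : TCtx} {J : Judg} (h : HT K J) {Γ Θ Δ : Ctx} (hd : Distinct Γ Θ Δ)
    (hK : K.Le (.ofLists Γ Θ Δ)) : Typed Γ Θ Δ J := by
  induction h generalizing Γ Θ Δ with
  | ax h =>
    rcases hK.reg _ _ h with h | h
    · exact (Typed.ax _ _).weaken (List.cons_subset.2 ⟨h, List.nil_subset _⟩) (by simp) (by simp) hd
    · exact (Typed.boxAx _ _).weaken (by simp) (List.cons_subset.2 ⟨h, List.nil_subset _⟩) (by simp) hd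
  | boxAx h =>
    exact (Typed.boxAx _ _).weaken (by simp) (List.cons_subset.2 ⟨(hK.mod _ _ h), List.nil_subset _⟩) (by simp) hd
  | coAx h => exact (Typed.coAx _ _).weaken (by simp) (by simp) (List.cons_subset.2 ⟨(hK.cov _ _ h), List.nil_subset _⟩) hd
  | cutPos hA _ _ ih ih' =>
    have := (Typed.cutPos hA hd.two_copies ((ih hd hK).mapName hd even_injective)
      ((ih' hd hK).mapName hd odd_injective)).contract hd
    simpa only [Judg.rename, Tm.rename, Tm.rename_even_half, Tm.rename_odd_half] using this
  | cutNeg hA _ _ ih ih' =>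
    have := (Typed.cutNeg hA hd.two_copies ((ih hd hK).mapName hd even_injective)
      ((ih' hd hK).mapName hd odd_injective)).contract hd
    simpa only [Judg.rename, Tm.rename, Tm.rename_even_half, Tm.rename_odd_half] using this
  | ofVal hA _ ih => exact .ofVal hA (ih hd hK)
  | ofCoval hA _ ih => exact .ofCoval hA (ih hd hK)
  | muPos hA _ ih => exact .muPos hA (ih (hd.bindCovar _) (bindCovar_le_ofLists hK _))
  | muNeg hA _ ih => exact .muNeg hA (ih (hd.bindCovar _) (bindCovar_le_ofLists hK _))
  | mutPos hA _ ih => exact .mutPos hA (ih (hd.bindVar _) (bindVar_le_ofLists hK _))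
  | mutNeg hA _ ih => exact .mutNeg hA (ih (hd.bindVar _) (bindVar_le_ofLists hK _))
  | unit => exact Typed.unit.weaken (by simp) (by simp) (by simp) hd
  | mutUnit _ ih => exact .mutUnit (ih hd hK)
  | pair _ _ ih ih' =>
    have := (Typed.pair hd.two_copies ((ih hd hK).mapName hd even_injective)
      ((ih' hd hK).mapName hd odd_injective)).contract hd
    simpa only [Judg.rename, Tm.rename, Tm.rename_even_half, Tm.rename_odd_half] using this
  | mutPair hA hB _ ih =>
    exact .mutPair hA hB (ih ((hd.bindVar _).bindVar _)
      (bindVar_le_ofLists (bindVar_le_ofLists hK _) _))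
  | inl _ ih => exact .inl (ih hd hK)
  | inr _ ih => exact .inr (ih hd hK)
  | mutSum hA hB _ _ ih ih' =>
    exact .mutSum hA hB (ih (hd.bindVar _) (bindVar_le_ofLists hK _))
      (ih' (hd.bindVar _) (bindVar_le_ofLists hK _))
  | muPar hA hB _ ih =>
    exact .muPar hA hB (ih ((hd.bindCovar _).bindCovar _)
      (bindCovar_le_ofLists (bindCovar_le_ofLists hK _) _))
  | copair _ _ ih ih' =>
    have := (Typed.copair hd.two_copies ((ih hd hK).mapName hd even_injective)
      ((ih' hd hK).mapName hd odd_injective)).contract hd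
    simpa only [Judg.rename, Tm.rename, Tm.rename_even_half, Tm.rename_odd_half] using this
  | muNot hA _ ih => exact .muNot hA (ih (hd.bindVar _) (bindVar_le_ofLists hK _))
  | conot _ ih => exact .conot (ih hd hK)
  | muWith hA hB _ _ ih ih' =>
    exact .muWith hA hB (ih (hd.bindCovar _) (bindCovar_le_ofLists hK _))
      (ih' (hd.bindCovar _) (bindCovar_le_ofLists hK _))
  | fst _ ih => exact .fst (ih hd hK)
  | snd _ ih => exact .snd (ih hd hK)
  | @box K V A _ ih =>
    -- The rule for `□` in `Typed` wants only modal types in `Γ` and an empty `Δ`. The other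
    -- declarations are removed before the rule and put back by weakening.
    have hsub : (Γ.filter fun d => d.2.pol = .box) ⊆ Γ := List.filter_subset_self Γ
    have hd' : Distinct (Γ.filter fun d => d.2.pol = .box) Θ [] :=
      ⟨hd.1.sublist ((List.filter_sublist.append (List.Sublist.refl _)).map _), List.nodup_nil⟩
    refine (Typed.box (fun d h => ?_) (ih hd' ⟨fun x B hB => ?_, hK.mod, fun _ _ h => h.elim⟩)).weaken
      hsub (fun _ h => h) (by simp) hd
    · simpa using (List.mem_filter.1 h).2
    · exact (hK.reg x B hB.1).imp (fun h => List.mem_filter.2 ⟨h, by simpa using hB.2⟩) id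
  | mutBox hA _ ih => exact .mutBox hA (ih (hd.bindBox _) (bindBox_le_ofLists hK _))

/-! ## Evaluation terminates -/

/-- The commands whose evaluation returns a value. -/
def Halts (c : Cmd) : Prop := ∃ V, Relation.ReflTransGen Red c (ret V)

theorem Halts.of_red {c c' : Cmd} (h : Red c c') (hc : Halts c') : Halts c :=
  hc.imp fun _ hV => .head h hV

theorem Red.deterministic {c c₁ c₂ : Cmd} (h₁ : Red c c₁) (h₂ : Red c c₂) : c₁ = c₂ := by
  cases h₁ <;> cases h₂ <;> rfl

theorem not_red_ret (V : Val) (c : Cmd) : ¬ Red (ret V) c := by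
  intro h
  cases h

/-- Two reductions from the same command coincide by determinism until one of them stops, and a
returned command does not reduce. -/
theorem ret_unique {c : Cmd} {V W : Val} (hV : Relation.ReflTransGen Red c (ret V))
    (hW : Relation.ReflTransGen Red c (ret W)) : W = V := by
  induction hV using Relation.ReflTransGen.head_induction_on with
  | refl =>
    rcases Relation.ReflTransGen.cases_head hW with h | ⟨_, h, _⟩
    · cases h; rfl
    · exact (not_red_ret _ _ h).elim
  | head h _ ih =>
    rcases Relation.ReflTransGen.cases_head hW with rfl | ⟨_, h', hW⟩
    · exact (not_red_ret _ _ h).elim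
    · cases h.deterministic h'
      exact ih hW

/-! ### Realizability by orthogonality -/

/-- The cut of a value against a co-value, at polarity `ε`. -/
def cut : Pol → Val → Coval → Cmd
  | .plus, V, S => .cutPos .plus (.ofVal V) S
  | .box, V, S => .cutPos .box (.ofVal V) S
  | .minus, V, S => .cutNeg V (.ofCoval S)

/-- The co-values on which all the values of a set halt. -/
def orthVal (ε : Pol) (X : Val → Prop) (S : Coval) : Prop := ∀ V, X V → Halts (cut ε V S)

/-- The values on which all the co-values of a set halt. -/
def orthCoval (X : Coval → Prop) (V : Val) : Prop := ∀ S, X S → Halts (cut .minus V S)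

/-- The realizers of a type: a set of values and a set of co-values. -/
def Ty.real : Ty → (Val → Prop) × (Coval → Prop)
  -- The polarity decides which set is primitive: values for `𝟙`, `⊗`, `⊕`, `□`, and co-values for
  -- `¬`, `&`, `⅋`. The other set is its orthogonal, and no biorthogonal closure is needed because
  -- only top-level reduction of values against co-values matters.
  | .one => let X : Val → Prop := fun V => V = .unit
    (X, orthVal .box X)
  | .tensor A B => let X : Val → Prop := fun V => ∃ V₁ V₂, V = .pair V₁ V₂ ∧ A.real.1 V₁ ∧ B.real.1 V₂
    (X, orthVal (A.pol.odot B.pol) X)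
  | .plus A B => let X : Val → Prop := fun V =>
      (∃ V₁, V = .inl V₁ ∧ A.real.1 V₁) ∨ ∃ V₂, V = .inr V₂ ∧ B.real.1 V₂
    (X, orthVal (A.pol.odot B.pol) X)
  | .box A => let X : Val → Prop := fun V => ∃ V₁, V = .box V₁ ∧ A.real.1 V₁
    (X, orthVal .box X)
  | .not A => let Y : Coval → Prop := fun S => ∃ V, S = .conot V ∧ A.real.1 V
    (orthCoval Y, Y)
  | .withT A B => let Y : Coval → Prop := fun S =>
      (∃ S₁, S = .fst S₁ ∧ A.real.2 S₁) ∨ ∃ S₂, S = .snd S₂ ∧ B.real.2 S₂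
    (orthCoval Y, Y)
  | .par A B => let Y : Coval → Prop := fun S =>
      ∃ S₁ S₂, S = .copair S₁ S₂ ∧ A.real.2 S₁ ∧ B.real.2 S₂
    (orthCoval Y, Y)

theorem Pol.odot_ne_minus (ε ε' : Pol) : ε.odot ε' ≠ .minus := by
  cases ε <;> cases ε' <;> intro h <;> cases h

theorem PosPol.toPol_ne_minus (p : PosPol) : p.toPol ≠ .minus := by
  cases p <;> intro h <;> cases h

theorem PosPol.toPol_injective {p q : PosPol} (h : p.toPol = q.toPol) : p = q := by
  cases p <;> cases q <;> first | rfl | cases h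

theorem Ty.real_coval {A : Ty} (hA : A.pol ≠ .minus) (S : Coval) :
    A.real.2 S ↔ orthVal A.pol A.real.1 S := by
  cases A <;> first | exact Iff.rfl | exact (hA rfl).elim

theorem Ty.real_val {A : Ty} (hA : A.pol = .minus) (V : Val) :
    A.real.1 V ↔ orthCoval A.real.2 V := by
  cases A with
  | one | box => cases hA
  | tensor A B | plus A B => exact (Pol.odot_ne_minus _ _ hA).elim
  | _ => exact Iff.rfl

/-- One of the two sets is by definition orthogonal to the other, on whichever side the polarity
puts it. -/
theorem Ty.real_halts {A : Ty} {V : Val} {S : Coval} (hV : A.real.1 V) (hS : A.real.2 S) :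
    Halts (cut A.pol V S) := by
  by_cases hA : A.pol = .minus
  · rw [hA]; exact (A.real_val hA V).1 hV S hS
  · exact (A.real_coval hA S).1 hS V hV

theorem cut_toPol (p : PosPol) (V : Val) (S : Coval) :
    cut p.toPol V S = .cutPos p (.ofVal V) S := by
  cases p <;> rfl

/-- The realizers of a judgment. -/
def Judg.Real : Judg → Prop
  | .val V A => A.real.1 V
  | .coval S A => A.real.2 S
  | .exp t A => ∀ p : PosPol, A.pol = p.toPol → ∀ S, A.real.2 S → Halts (.cutPos p t S)
  | .env e A => ∀ V, A.real.1 V → Halts (.cutNeg V e)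
  | .cmd c => Halts c

/-- `σ` maps the declarations of `K` to realizers. -/
structure TCtx.Realizes (K : TCtx) (σ : Sub) : Prop where
  reg : ∀ x A, K.reg x A → A.real.1 (σ.onVar x)
  mod : ∀ x A, K.mod x A → A.real.1 (σ.onVar x)
  cov : ∀ α A, K.cov α A → A.real.2 (σ.onCovar α)

namespace TCtx.Realizes

variable {K : TCtx} {σ : Sub} {A : Ty}

theorem bindVar (h : K.Realizes σ) {V : Val} (hV : A.real.1 V) :
    (K.bindVar A).Realizes (σ.consVar V) where
  reg := by rintro (_ | x) B hB; exacts [by cases hB; exact hV, h.reg x B hB]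
  mod := by rintro (_ | x) B hB; exacts [hB.elim, h.mod x B hB]
  cov := h.cov

theorem bindBox (h : K.Realizes σ) {V : Val} (hV : A.real.1 V) :
    (K.bindBox A).Realizes (σ.consVar V) where
  reg := by rintro (_ | x) B hB; exacts [hB.elim, h.reg x B hB]
  mod := by rintro (_ | x) B hB; exacts [by cases hB; exact hV, h.mod x B hB]
  cov := h.cov

theorem bindCovar (h : K.Realizes σ) {S : Coval} (hS : A.real.2 S) :
    (K.bindCovar A).Realizes (σ.consCovar S) where
  reg := h.reg
  mod := h.mod
  cov := by rintro (_ | x) B hB; exacts [by cases hB; exact hS, h.cov x B hB]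

theorem modal (h : K.Realizes σ) : K.modal.Realizes σ :=
  ⟨fun x A hA => h.reg x A hA.1, h.mod, fun _ _ h => h.elim⟩

end TCtx.Realizes

theorem cutPos_of_cut {ε : Pol} {P : Cmd → Prop} (hε : ε ≠ .minus) {V : Val} {S : Coval}
    (h : ∀ p : PosPol, P (.cutPos p (.ofVal V) S)) : P (cut ε V S) := by
  cases ε
  exacts [h .plus, (hε rfl).elim, h .box]

/-- The fundamental lemma. Constructors belong to the primitive set by definition. A binder is
tested against the opposite set: the cut makes one reduction to the body under an extended
environment, and halting is closed under expansion. -/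
theorem HT.real {K : TCtx} {J : Judg} (h : HT K J) {σ : Sub} (hσ : K.Realizes σ) :
    (J.subst σ).Real := by
  induction h generalizing σ with
  | ax h => exact hσ.reg _ _ h
  | boxAx h => exact hσ.mod _ _ h
  | coAx h => exact hσ.cov _ _ h
  | cutPos hA _ _ ih ih' => exact ih hσ _ hA _ (ih' hσ)
  | cutNeg hA _ _ ih ih' => exact ih' hσ _ (ih hσ)
  | ofVal _ _ ih =>
    intro p hp S hS
    have := Ty.real_halts (ih hσ) hS
    rwa [hp, cut_toPol] at this
  | ofCoval hA _ ih =>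
    intro V hV
    have := Ty.real_halts hV (ih hσ)
    rwa [hA] at this
  | muPos hA _ ih =>
    intro p hp S hS
    -- The annotation on the binder and the one on the cut agree because both are the polarity of
    -- the type.
    cases PosPol.toPol_injective (hA.symm.trans hp)
    refine .of_red (.muPos _ _ _) ?_
    rw [Tm.subst_upCovar_instCovar]
    exact ih (hσ.bindCovar hS)
  | muNeg hA _ ih =>
    refine (Ty.real_val hA _).2 fun S hS => .of_red (.muNeg _ _) ?_
    rw [Tm.subst_upCovar_instCovar]
    exact ih (hσ.bindCovar hS)
  | @mutPos K p c A hA _ ih =>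
    refine (Ty.real_coval (hA ▸ p.toPol_ne_minus) _).2 fun V hV => ?_
    rw [hA, cut_toPol]
    refine .of_red (.mutPos _ _ _) ?_
    rw [Tm.subst_upVar_instVar]
    exact ih (hσ.bindVar hV)
  | mutNeg hA _ ih =>
    intro V hV
    refine .of_red (.mutNeg _ _) ?_
    rw [Tm.subst_upVar_instVar]
    exact ih (hσ.bindVar hV)
  | unit => exact rfl
  | mutUnit _ ih =>
    rintro _ rfl
    exact .of_red (.unit _) (ih hσ)
  | pair _ _ ih ih' => exact ⟨_, _, rfl, ih hσ, ih' hσ⟩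
  | mutPair hA hB _ ih =>
    rintro _ ⟨V₁, V₂, rfl, hV₁, hV₂⟩
    refine cutPos_of_cut (Pol.odot_ne_minus _ _) fun p => .of_red (.pairPos _ _ _ _ _ _) ?_
    rw [Tm.subst_upVar_instVars]
    exact ih ((hσ.bindVar hV₂).bindVar hV₁)
  | inl _ ih => exact Or.inl ⟨_, rfl, ih hσ⟩
  | inr _ ih => exact Or.inr ⟨_, rfl, ih hσ⟩
  | mutSum hA hB _ _ ih ih' =>
    rintro _ (⟨V, rfl, hV⟩ | ⟨V, rfl, hV⟩)
    · refine cutPos_of_cut (Pol.odot_ne_minus _ _) fun p => .of_red (.inlPos _ _ _ _ _ _) ?_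
      rw [Tm.subst_upVar_instVar]
      exact ih (hσ.bindVar hV)
    · refine cutPos_of_cut (Pol.odot_ne_minus _ _) fun p => .of_red (.inrPos _ _ _ _ _ _) ?_
      rw [Tm.subst_upVar_instVar]
      exact ih' (hσ.bindVar hV)
  | muPar hA hB _ ih =>
    rintro _ ⟨S₁, S₂, rfl, hS₁, hS₂⟩
    refine .of_red (.copair _ _ _ _ _) ?_
    rw [Tm.subst_upCovar_instCovars]
    exact ih ((hσ.bindCovar hS₂).bindCovar hS₁)
  | copair _ _ ih ih' => exact ⟨_, _, rfl, ih hσ, ih' hσ⟩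
  | muNot hA _ ih =>
    rintro _ ⟨V, rfl, hV⟩
    refine .of_red (.conot _ _ _) ?_
    rw [Tm.subst_upVar_instVar]
    exact ih (hσ.bindVar hV)
  | conot _ ih => exact ⟨_, rfl, ih hσ⟩
  | muWith hA hB _ _ ih ih' =>
    rintro _ (⟨S, rfl, hS⟩ | ⟨S, rfl, hS⟩)
    · refine .of_red (.fst _ _ _ _ _) ?_
      rw [Tm.subst_upCovar_instCovar]
      exact ih (hσ.bindCovar hS)
    · refine .of_red (.snd _ _ _ _ _) ?_
      rw [Tm.subst_upCovar_instCovar]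
      exact ih' (hσ.bindCovar hS)
  | fst _ ih => exact Or.inl ⟨_, rfl, ih hσ⟩
  | snd _ ih => exact Or.inr ⟨_, rfl, ih hσ⟩
  | box _ ih => exact ⟨_, rfl, ih hσ.modal⟩
  | mutBox hA _ ih =>
    rintro _ ⟨V, rfl, hV⟩
    refine .of_red (.box _ _ _) ?_
    rw [Tm.subst_upVar_instVar]
    exact ih (hσ.bindBox hV)

/-- The context of the toplevel continuation. -/
def TCtx.top (R : Ty) : TCtx := ⟨fun _ _ => False, fun _ _ => False, fun α A => α = tp ∧ A = R⟩

/-- The identity substitution realizes the context: a cut of any value against `tp` is already a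
result, so `tp` is orthogonal to every set of values. -/
theorem HT.halts {R : Ty} (hR : R.pol = .box) {c : Cmd} (h : HT (.top R) (.cmd c)) : Halts c := by
  have hσ : (TCtx.top R).Realizes .ident := by
    refine ⟨fun _ _ h => h.elim, fun _ _ h => h.elim, ?_⟩
    rintro _ _ ⟨rfl, rfl⟩
    refine (Ty.real_coval (by rw [hR]; intro h; cases h) _).2 fun V _ => ?_
    rw [hR]
    exact ⟨V, .refl⟩
  have := h.real hσ
  simp only [Judg.subst, Tm.subst_ident] at this
  exact this

/-! ## Typed memories -/

/-- A value or co-value which is evaluated, at a given type. -/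
def Tm.EvalAt : {s : Cls} → Tm s → Ty → Prop
  -- Evaluation replaces positive variables and negative covariables by their contents, so a name
  -- can remain only at the opposite polarity. Abstractions fall under the default case, being
  -- evaluated as they stand.
  | _, .var _, A => A.pol = .minus
  | _, .pair V W, .tensor A B => V.EvalAt A ∧ W.EvalAt B
  | _, .box V, .box A => V.EvalAt A
  | _, .inl V, .plus A _ => V.EvalAt A
  | _, .inr V, .plus _ B => V.EvalAt B
  | _, .covar _, A => A.pol ≠ .minus
  | _, .fst S, .withT A _ => S.EvalAt A
  | _, .snd S, .withT _ B => S.EvalAt B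
  | _, .conot V, .not A => V.EvalAt A
  | _, .copair S S', .par A B => S.EvalAt A ∧ S'.EvalAt B
  | _, _, _ => True

def Heap.Defines (H : Heap) (x : ℕ) : Prop := ∃ h ∈ H, h.name = x

def Stack.DefinesVar (S : Stack) (x : ℕ) : Prop :=
  ∃ F ∈ S, ∃ π V, Eqn.var x π V ∈ F.eqns

def Stack.DefinesCovar (S : Stack) (α : ℕ) : Prop :=
  ∃ F ∈ S, ∃ ε T, Eqn.covar α ε T ∈ F.eqns

/-- Types for the names, and a substitution that unfolds them. -/
structure World : Type where
  tv : ℕ → Ty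
  tc : ℕ → Ty
  sub : Sub

/-- The variables of a heap, as a context. -/
def World.heapCtx (w : World) (H : Heap) : TCtx :=
  ⟨fun _ _ => False, fun x A => H.Defines x ∧ A = w.tv x, fun _ _ => False⟩

/-- The names defined in a memory, as a context. -/
def World.ctx (w : World) (M : Mem) : TCtx :=
  -- Heap variables count as modal at all types, including the non-modal ones stored by opening a
  -- box. The unfolding of `tp` is itself, so `tp` is in scope without being defined.
  ⟨fun x A => M.stack.DefinesVar x ∧ A = w.tv x, fun x A => M.heap.Defines x ∧ A = w.tv x,
    fun α A => (α = tp ∨ M.stack.DefinesCovar α) ∧ A = w.tc α⟩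

/-- The heap is well typed, and its equations are solved by the substitution. -/
def World.HeapOK (w : World) : Heap → Prop
  | [] => True
  | h :: H => w.HeapOK H ∧ h.pol = (w.tv h.name).pol ∧
      -- Heap values see older heap equations only, never the stack. They therefore stay meaningful
      -- when frames are discarded.
      HT (w.heapCtx H) (.val h.val (w.tv h.name)) ∧ h.val.EvalAt (w.tv h.name) ∧
      w.sub.onVar h.name = h.val.subst w.sub

/-- The equation is well typed in the given memory, and is solved by the substitution. -/
def World.EqnOK (w : World) (M : Mem) : Eqn → Prop
  -- The final clause separates stack names from heap names, so that a term over the heap mentions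
  -- no stack variable.
  | .var x π V => π.toPol = (w.tv x).pol ∧ HT (w.ctx M) (.val V (w.tv x)) ∧
      V.EvalAt (w.tv x) ∧ w.sub.onVar x = V.subst w.sub ∧ ¬ M.heap.Defines x
  | .covar α ε S => α ≠ tp ∧ ε = (w.tc α).pol ∧ HT (w.ctx M) (.coval S (w.tc α)) ∧
      S.EvalAt (w.tc α) ∧ w.sub.onCovar α = S.subst w.sub

/-- The stack is well typed above a heap, and its equations are solved by the substitution. -/
def World.StackOK (w : World) (H : Heap) : Stack → Prop
  | [] => True
  | F :: S => w.StackOK H S ∧ ∀ E ∈ F.eqns, w.EqnOK ⟨H, S⟩ E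

/-- The memory is well typed, with a continuation of type `R`. -/
structure World.MemOK (w : World) (R : Ty) (M : Mem) : Prop where
  heap : w.HeapOK M.heap
  stack : w.StackOK M.heap M.stack
  type_tp : w.tc tp = R
  sub_tp : w.sub.onCovar tp = .covar tp

section Basic

variable {w w' : World} {R : Ty} {M M' : Mem} {H : Heap} {S : Stack}

theorem Heap.defines_cons {h : HeapEqn} {x : ℕ} :
    Heap.Defines (h :: H) x ↔ h.name = x ∨ H.Defines x := by
  simp only [Heap.Defines, List.mem_cons, exists_eq_or_imp]

theorem Stack.definesVar_cons {F : Frame} {x : ℕ} :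
    Stack.DefinesVar (F :: S) x ↔ (∃ π V, Eqn.var x π V ∈ F.eqns) ∨ S.DefinesVar x := by
  simp only [Stack.DefinesVar, List.mem_cons, exists_eq_or_imp]

theorem Stack.definesCovar_cons {F : Frame} {α : ℕ} :
    Stack.DefinesCovar (F :: S) α ↔ (∃ ε T, Eqn.covar α ε T ∈ F.eqns) ∨ S.DefinesCovar α := by
  simp only [Stack.DefinesCovar, List.mem_cons, exists_eq_or_imp]

theorem World.heapCtx_le (w : World) (M : Mem) : (w.heapCtx M.heap).Le (w.ctx M) :=
  ⟨fun _ _ h => h.elim, fun _ _ h => h, fun _ _ h => h.elim⟩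

theorem World.heapCtx_le_modal (w : World) (M : Mem) : (w.heapCtx M.heap).Le (w.ctx M).modal :=
  ⟨fun _ _ h => h.elim, fun _ _ h => h, fun _ _ h => h.elim⟩

theorem World.heapCtx_le_cons (w : World) (h : HeapEqn) (H : Heap) :
    (w.heapCtx H).Le (w.heapCtx (h :: H)) :=
  ⟨fun _ _ h => h.elim, fun _ _ h => ⟨Heap.defines_cons.2 (.inr h.1), h.2⟩, fun _ _ h => h.elim⟩

theorem World.ctx_le_heap_cons (w : World) (h : HeapEqn) (H : Heap) (S : Stack) :
    (w.ctx ⟨H, S⟩).Le (w.ctx ⟨h :: H, S⟩) :=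
  ⟨fun _ _ h => .inl h, fun _ _ h => ⟨Heap.defines_cons.2 (.inr h.1), h.2⟩, fun _ _ h => h⟩

theorem World.ctx_le_stack_cons (w : World) (H : Heap) (F : Frame) (S : Stack) :
    (w.ctx ⟨H, S⟩).Le (w.ctx ⟨H, F :: S⟩) :=
  ⟨fun _ _ h => .inl ⟨Stack.definesVar_cons.2 (.inr h.1), h.2⟩, fun _ _ h => h,
    fun _ _ h => ⟨h.1.imp id fun h => Stack.definesCovar_cons.2 (.inr h), h.2⟩⟩

theorem NonModalPol.toPol_ne_box (π : NonModalPol) : π.toPol ≠ .box := by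
  cases π <;> intro h <;> cases h

theorem World.StackOK.var_pol (h : w.StackOK H S) {x : ℕ} (hx : S.DefinesVar x) :
    (w.tv x).pol ≠ .box := by
  induction S with
  | nil => obtain ⟨_, h, _⟩ := hx; cases h
  | cons F S ih =>
    rcases Stack.definesVar_cons.1 hx with ⟨π, V, hE⟩ | hx
    · exact (h.2 _ hE).1 ▸ π.toPol_ne_box
    · exact ih h.1 hx

theorem World.StackOK.not_defines (h : w.StackOK H S) {x : ℕ} (hx : S.DefinesVar x) :
    ¬ H.Defines x := by
  induction S with
  | nil => obtain ⟨_, h, _⟩ := hx; cases h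
  | cons F S ih =>
    rcases Stack.definesVar_cons.1 hx with ⟨π, V, hE⟩ | hx
    · exact (h.2 _ hE).2.2.2.2
    · exact ih h.1 hx

/-- Variables on the stack carry a non-modal polarity, so none of them survives the restriction to
modal types. With `HT.modal_of_box`, a value of modal type needs the heap only. -/
theorem World.MemOK.modal_le (h : w.MemOK R M) : (w.ctx M).modal.Le (w.heapCtx M.heap) :=
  ⟨fun _ _ hx => (h.stack.var_pol hx.1.1 (hx.1.2 ▸ hx.2)).elim, fun _ _ hx => hx,
    fun _ _ hx => hx⟩

/-! ### Extensions -/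

/-- The two worlds agree on the names of the memory. -/
structure World.SameOn (w w' : World) (M : Mem) : Prop where
  var : ∀ x, M.heap.Defines x ∨ M.stack.DefinesVar x →
    w.tv x = w'.tv x ∧ w.sub.onVar x = w'.sub.onVar x
  covar : ∀ α, α = tp ∨ M.stack.DefinesCovar α →
    w.tc α = w'.tc α ∧ w.sub.onCovar α = w'.sub.onCovar α

theorem World.SameOn.ctx_le (h : w.SameOn w' M) : (w.ctx M).Le (w'.ctx M) :=
  ⟨fun _ _ hx => .inl ⟨hx.1, hx.2.trans (h.var _ (.inr hx.1)).1⟩,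
    fun _ _ hx => ⟨hx.1, hx.2.trans (h.var _ (.inl hx.1)).1⟩,
    fun _ _ hx => ⟨hx.1, hx.2.trans (h.covar _ hx.1).1⟩⟩

theorem World.SameOn.heapCtx_le (h : w.SameOn w' M) :
    (w.heapCtx M.heap).Le (w'.heapCtx M.heap) :=
  ⟨fun _ _ hx => hx.elim, fun _ _ hx => ⟨hx.1, hx.2.trans (h.var _ (.inl hx.1)).1⟩,
    fun _ _ hx => hx.elim⟩

theorem World.SameOn.agree (h : w.SameOn w' M) : (w.ctx M).Agree w.sub w'.sub :=
  ⟨fun _ _ hx => (h.var _ (.inr hx.1)).2, fun _ _ hx => (h.var _ (.inl hx.1)).2,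
    fun _ _ hx => (h.covar _ hx.1).2⟩

theorem HT.subst_val_eq {K : TCtx} {V : Val} {A : Ty} {σ τ : Sub} (h : HT K (.val V A))
    (ha : K.Agree σ τ) : V.subst σ = V.subst τ :=
  (Judg.val.inj (h.subst_congr ha)).1

theorem HT.subst_coval_eq {K : TCtx} {S : Coval} {A : Ty} {σ τ : Sub} (h : HT K (.coval S A))
    (ha : K.Agree σ τ) : S.subst σ = S.subst τ :=
  (Judg.coval.inj (h.subst_congr ha)).1

theorem HT.subst_cmd_eq {K : TCtx} {c : Cmd} {σ τ : Sub} (h : HT K (.cmd c))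
    (ha : K.Agree σ τ) : c.subst σ = c.subst τ :=
  Judg.cmd.inj (h.subst_congr ha)

theorem World.SameOn.heap_tail {h : HeapEqn} (hs : w.SameOn w' ⟨h :: H, S⟩) :
    w.SameOn w' ⟨H, S⟩ :=
  ⟨fun x hx => hs.var x (hx.imp (fun h => Heap.defines_cons.2 (.inr h)) id), hs.covar⟩

theorem World.SameOn.stack_tail {F : Frame} (hs : w.SameOn w' ⟨H, F :: S⟩) :
    w.SameOn w' ⟨H, S⟩ :=
  ⟨fun x hx => hs.var x (hx.imp id fun h => Stack.definesVar_cons.2 (.inr h)),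
    fun α hα => hs.covar α (hα.imp id fun h => Stack.definesCovar_cons.2 (.inr h))⟩

theorem World.HeapOK.congr (h : w.HeapOK H) (hs : w.SameOn w' ⟨H, S⟩) : w'.HeapOK H := by
  induction H with
  | nil => trivial
  | cons e H ih =>
    obtain ⟨h, hp, ht, he, hσ⟩ := h
    obtain ⟨h₁, h₂⟩ := hs.var e.name (.inl (Heap.defines_cons.2 (.inl rfl)))
    have hs' := hs.heap_tail
    refine ⟨ih h hs', ?_, ?_, ?_, ?_⟩
    · rwa [← h₁]
    · rw [← h₁]; exact ht.mono hs'.heapCtx_le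
    · rwa [← h₁]
    · rw [← h₂, hσ]; exact (ht.mono (w.heapCtx_le ⟨H, S⟩)).subst_val_eq hs'.agree

theorem World.StackOK.congr (h : w.StackOK H S) (hs : w.SameOn w' ⟨H, S⟩) : w'.StackOK H S := by
  induction S with
  | nil => trivial
  | cons F S ih =>
    have hs' := hs.stack_tail
    refine ⟨ih h.1 hs', fun E hE => ?_⟩
    have hEok := h.2 E hE
    cases E with
    | var x π V =>
      obtain ⟨hp, ht, he, hσ, hx⟩ := hEok
      obtain ⟨h₁, h₂⟩ := hs.var x (.inr (Stack.definesVar_cons.2 (.inl ⟨_, _, hE⟩)))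
      refine ⟨?_, ?_, ?_, ?_, hx⟩
      · rwa [← h₁]
      · rw [← h₁]; exact ht.mono hs'.ctx_le
      · rwa [← h₁]
      · rw [← h₂, hσ]; exact ht.subst_val_eq hs'.agree
    | covar α ε T =>
      obtain ⟨hα, hp, ht, he, hσ⟩ := hEok
      obtain ⟨h₁, h₂⟩ := hs.covar α (.inr (Stack.definesCovar_cons.2 (.inl ⟨_, _, hE⟩)))
      refine ⟨hα, ?_, ?_, ?_, ?_⟩
      · rwa [← h₁]
      · rw [← h₁]; exact ht.mono hs'.ctx_le
      · rwa [← h₁]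
      · rw [← h₂, hσ]; exact ht.subst_coval_eq hs'.agree

/-- The invariant depends on a world only at names in scope. A name given up with a discarded frame
may thus be reassigned later. -/
theorem World.MemOK.congr (h : w.MemOK R M) (hs : w.SameOn w' M) : w'.MemOK R M where
  heap := h.heap.congr hs
  stack := h.stack.congr hs
  type_tp := (hs.covar tp (.inl rfl)).1 ▸ h.type_tp
  sub_tp := (hs.covar tp (.inl rfl)).2 ▸ h.sub_tp

/-- The heap may grow below an existing stack, since frames are typed over the whole current heap.
-/
theorem World.StackOK.heap_cons {e : HeapEqn} (h : w.StackOK H S) (he : ¬ S.DefinesVar e.name) :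
    w.StackOK (e :: H) S := by
  induction S with
  | nil => trivial
  | cons F S ih =>
    refine ⟨ih h.1 fun h => he (Stack.definesVar_cons.2 (.inr h)), fun E hE => ?_⟩
    have hEok := h.2 E hE
    cases E with
    | var x π V =>
      obtain ⟨hp, ht, hv, hσ, hx⟩ := hEok
      refine ⟨hp, ht.mono (w.ctx_le_heap_cons e H S), hv, hσ, fun h => ?_⟩
      rcases Heap.defines_cons.1 h with rfl | h
      · exact he (Stack.definesVar_cons.2 (.inl ⟨_, _, hE⟩))
      · exact hx h
    | covar α ε T =>
      obtain ⟨hα, hp, ht, hv, hσ⟩ := hEok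
      exact ⟨hα, hp, ht.mono (w.ctx_le_heap_cons e H S), hv, hσ⟩

/-- The second world and memory extend the first ones. -/
structure World.Ext (w : World) (M : Mem) (w' : World) (M' : Mem) : Prop where
  le : (w.ctx M).Le (w'.ctx M')
  agree : (w.ctx M).Agree w.sub w'.sub

theorem World.Ext.trans {w'' : World} {M'' : Mem} (h : w.Ext M w' M') (h' : w'.Ext M' w'' M'') :
    w.Ext M w'' M'' where
  le := ⟨fun x A hx => (h.le.reg x A hx).elim (h'.le.reg x A) fun hx => .inr (h'.le.mod x A hx),
    fun x A hx => h'.le.mod x A (h.le.mod x A hx), fun x A hx => h'.le.cov x A (h.le.cov x A hx)⟩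
  agree := ⟨fun x A hx => (h.agree.reg x A hx).trans ((h.le.reg x A hx).elim (h'.agree.reg x A)
      (h'.agree.mod x A)),
    fun x A hx => (h.agree.mod x A hx).trans (h'.agree.mod x A (h.le.mod x A hx)),
    fun x A hx => (h.agree.cov x A hx).trans (h'.agree.cov x A (h.le.cov x A hx))⟩

/-- The variable `x`, of type `A`, unfolds to `V`. -/
def World.HasVar (w : World) (M : Mem) (x : ℕ) (A : Ty) (V : Val) : Prop :=
  ((w.ctx M).reg x A ∨ (w.ctx M).mod x A) ∧ w.sub.onVar x = V

/-- The covariable `α`, of type `A`, unfolds to `S`. -/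
def World.HasCovar (w : World) (M : Mem) (α : ℕ) (A : Ty) (T : Coval) : Prop :=
  (w.ctx M).cov α A ∧ w.sub.onCovar α = T

theorem World.HasVar.ext {x : ℕ} {A : Ty} {V : Val} (h : w.HasVar M x A V)
    (he : w.Ext M w' M') : w'.HasVar M' x A V := by
  refine ⟨?_, ?_⟩
  · exact h.1.elim (he.le.reg x A) fun h => .inr (he.le.mod x A h)
  · rw [← h.2]; exact h.1.elim (fun h => (he.agree.reg x A h).symm) fun h => (he.agree.mod x A h).symm

/-! ### Allocation preserves the invariant -/

def World.setVar (w : World) (x : ℕ) (A : Ty) (V : Val) : World :=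
  ⟨Function.update w.tv x A, w.tc, ⟨Function.update w.sub.onVar x V, w.sub.onCovar⟩⟩

def World.setCovar (w : World) (α : ℕ) (A : Ty) (T : Coval) : World :=
  ⟨w.tv, Function.update w.tc α A, ⟨w.sub.onVar, Function.update w.sub.onCovar α T⟩⟩

def Mem.DefinesVar (M : Mem) (x : ℕ) : Prop := M.heap.Defines x ∨ M.stack.DefinesVar x

def Mem.DefinesCovar (M : Mem) (α : ℕ) : Prop := α = tp ∨ M.stack.DefinesCovar α

theorem World.sameOn_setVar {x : ℕ} (hx : ¬ M.DefinesVar x) (A : Ty) (V : Val) :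
    w.SameOn (w.setVar x A V) M where
  var := fun y hy => by
    have : y ≠ x := by rintro rfl; exact hx hy
    simp only [setVar, Function.update_of_ne this, and_self]
  covar := fun _ _ => ⟨rfl, rfl⟩

theorem World.sameOn_setCovar {α : ℕ} (hα : ¬ M.DefinesCovar α) (A : Ty) (T : Coval) :
    w.SameOn (w.setCovar α A T) M where
  var := fun _ _ => ⟨rfl, rfl⟩
  covar := fun y hy => by
    have : y ≠ α := by rintro rfl; exact hα hy
    simp only [setCovar, Function.update_of_ne this, and_self]

theorem World.SameOn.trans {w'' : World} (h : w.SameOn w' M) (h' : w'.SameOn w'' M) :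
    w.SameOn w'' M :=
  ⟨fun x hx => ⟨(h.var x hx).1.trans (h'.var x hx).1, (h.var x hx).2.trans (h'.var x hx).2⟩,
    fun x hx => ⟨(h.covar x hx).1.trans (h'.covar x hx).1,
      (h.covar x hx).2.trans (h'.covar x hx).2⟩⟩

theorem World.SameOn.ext (h : w.SameOn w' M) (hM : (w'.ctx M).Le (w'.ctx M')) :
    w.Ext M w' M' where
  le := ⟨fun x A hx => (h.ctx_le.reg x A hx).elim (hM.reg x A) fun hx => .inr (hM.mod x A hx),
    fun x A hx => hM.mod x A (h.ctx_le.mod x A hx),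
    fun x A hx => hM.cov x A (h.ctx_le.cov x A hx)⟩
  agree := h.agree

/-- The type is arbitrary here, because opening a box puts its content on the heap at any polarity.
What matters is that the content is typed over the heap. -/
theorem World.MemOK.allocHeap (h : w.MemOK R M) {x : ℕ} {A : Ty} {V : Val}
    (hx : ¬ M.DefinesVar x) (hV : HT (w.heapCtx M.heap) (.val V A)) (he : V.EvalAt A) :
    ∃ w' : World, w'.MemOK R (M.allocHeap x A.pol V) ∧ w.Ext M w' (M.allocHeap x A.pol V) ∧
      (w'.ctx (M.allocHeap x A.pol V)).mod x A ∧ w'.sub.onVar x = V.subst w.sub := by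
  have hs := w.sameOn_setVar hx A (V.subst w.sub)
  have h' := h.congr hs
  have ht : (w.setVar x A (V.subst w.sub)).tv x = A := Function.update_self ..
  have hσ : (w.setVar x A (V.subst w.sub)).sub.onVar x = V.subst w.sub := Function.update_self ..
  refine ⟨_, ⟨⟨h'.heap, ?_, ?_, ?_, ?_⟩, h'.stack.heap_cons fun h => hx (.inr h), h'.type_tp,
    h'.sub_tp⟩, hs.ext (World.ctx_le_heap_cons _ _ M.heap M.stack), ⟨Heap.defines_cons.2 (.inl rfl), ht.symm⟩, hσ⟩
  · simp only [ht]
  · simp only [ht]; exact hV.mono hs.heapCtx_le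
  · simp only [ht]; exact he
  · simp only [hσ]; exact (hV.mono (w.heapCtx_le M)).subst_val_eq hs.agree

theorem Pol.nonModal?_of_ne {ε : Pol} (h : ε ≠ .box) :
    ∃ π : NonModalPol, ε.nonModal? = some π ∧ π.toPol = ε := by
  cases ε
  exacts [⟨.plus, rfl, rfl⟩, ⟨.minus, rfl, rfl⟩, (h rfl).elim]

theorem World.MemOK.pushFrame (h : w.MemOK R M) {F : Frame}
    (hF : ∀ E ∈ F.eqns, w.EqnOK M E) : w.MemOK R ⟨M.heap, F :: M.stack⟩ :=
  ⟨h.heap, ⟨h.stack, hF⟩, h.type_tp, h.sub_tp⟩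

/-- At a modal type the value is already typed over the heap, by `HT.modal_of_box` and
`World.MemOK.modal_le`, and can be stored there. At other types a frame is pushed, with no such
constraint. -/
theorem World.MemOK.allocVar (h : w.MemOK R M) {x : ℕ} {A : Ty} {V : Val}
    (hx : ¬ M.DefinesVar x) (hV : HT (w.ctx M) (.val V A)) (he : V.EvalAt A) :
    ∃ w' : World, w'.MemOK R (M.allocVar x A.pol V) ∧ w.Ext M w' (M.allocVar x A.pol V) ∧
      w'.HasVar (M.allocVar x A.pol V) x A (V.subst w.sub) := by
  by_cases hA : A.pol = .box
  · obtain ⟨w', h₁, h₂, h₃, h₄⟩ := h.allocHeap hx ((hV.modal_of_box hA).mono h.modal_le) he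
    have hM : M.allocHeap x A.pol V = M.allocVar x A.pol V := by rw [hA]; rfl
    rw [hM] at h₁ h₂ h₃
    exact ⟨w', h₁, h₂, .inr h₃, h₄⟩
  · obtain ⟨π, hπ, hπA⟩ := Pol.nonModal?_of_ne hA
    have hs := w.sameOn_setVar hx A (V.subst w.sub)
    have h' := h.congr hs
    have ht : (w.setVar x A (V.subst w.sub)).tv x = A := Function.update_self ..
    have hσ : (w.setVar x A (V.subst w.sub)).sub.onVar x = V.subst w.sub :=
      Function.update_self ..
    have hM : M.allocVar x A.pol V = ⟨M.heap, .one (.var x π V) :: M.stack⟩ := by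
      simp only [Mem.allocVar, hπ]
    rw [hM]
    refine ⟨_, h'.pushFrame ?_, hs.ext (World.ctx_le_stack_cons _ _ _ _),
      .inl ⟨Stack.definesVar_cons.2 (.inl ⟨π, V, List.mem_singleton_self _⟩), ht.symm⟩, hσ⟩
    intro E hE
    cases List.mem_singleton.1 hE
    refine ⟨by rw [ht, hπA], ?_, ?_, ?_, fun h => hx (.inl h)⟩
    · rw [ht]; exact hV.mono hs.ctx_le
    · rwa [ht]
    · rw [hσ]; exact hV.subst_val_eq hs.agree

theorem World.MemOK.allocVars (h : w.MemOK R M) {x y : ℕ} {A B : Ty} {V W : Val} (hxy : x ≠ y)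
    (hx : ¬ M.DefinesVar x) (hy : ¬ M.DefinesVar y) (hV : HT (w.ctx M) (.val V A))
    (hW : HT (w.ctx M) (.val W B)) (heV : V.EvalAt A) (heW : W.EvalAt B) :
    ∃ w' : World, w'.MemOK R (M.allocVars x A.pol V y B.pol W) ∧
      w.Ext M w' (M.allocVars x A.pol V y B.pol W) ∧
      w'.HasVar (M.allocVars x A.pol V y B.pol W) x A (V.subst w.sub) ∧
      w'.HasVar (M.allocVars x A.pol V y B.pol W) y B (W.subst w.sub) := by
  -- Two non-modal variables share a frame and are treated at once. In all other cases the memory is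
  -- the one obtained by two successive allocations.
  by_cases hAB : A.pol ≠ .box ∧ B.pol ≠ .box
  · obtain ⟨π, hπ, hπA⟩ := Pol.nonModal?_of_ne hAB.1
    obtain ⟨ρ, hρ, hρB⟩ := Pol.nonModal?_of_ne hAB.2
    have hs := (w.sameOn_setVar hx A (V.subst w.sub)).trans
      (World.sameOn_setVar hy B (W.subst w.sub))
    generalize hw : (w.setVar x A (V.subst w.sub)).setVar y B (W.subst w.sub) = w' at hs
    have h' := h.congr hs
    have htx : w'.tv x = A := by
      rw [← hw]; simp only [World.setVar, Function.update_of_ne hxy, Function.update_self]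
    have hσx : w'.sub.onVar x = V.subst w.sub := by
      rw [← hw]; simp only [World.setVar, Function.update_of_ne hxy, Function.update_self]
    have hty : w'.tv y = B := by rw [← hw]; exact Function.update_self ..
    have hσy : w'.sub.onVar y = W.subst w.sub := by rw [← hw]; exact Function.update_self ..
    have hM : M.allocVars x A.pol V y B.pol W =
        ⟨M.heap, .two (.var x π V) (.var y ρ W) :: M.stack⟩ := by
      simp only [Mem.allocVars, hπ, hρ]
    rw [hM]
    refine ⟨w', h'.pushFrame ?_, hs.ext (World.ctx_le_stack_cons _ _ _ _),
      ⟨.inl ⟨Stack.definesVar_cons.2 (.inl ⟨π, V, List.mem_cons_self⟩), htx.symm⟩, hσx⟩,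
      ⟨.inl ⟨Stack.definesVar_cons.2 (.inl ⟨ρ, W, List.mem_cons_of_mem _ List.mem_cons_self⟩),
        hty.symm⟩, hσy⟩⟩
    intro E hE
    rcases List.mem_cons.1 hE with rfl | hE
    · refine ⟨by rw [htx, hπA], ?_, ?_, ?_, fun h => hx (.inl h)⟩
      · rw [htx]; exact hV.mono hs.ctx_le
      · rwa [htx]
      · rw [hσx]; exact hV.subst_val_eq hs.agree
    · cases List.mem_singleton.1 hE
      refine ⟨by rw [hty, hρB], ?_, ?_, ?_, fun h => hy (.inl h)⟩
      · rw [hty]; exact hW.mono hs.ctx_le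
      · rwa [hty]
      · rw [hσy]; exact hW.subst_val_eq hs.agree
  · have hM : M.allocVars x A.pol V y B.pol W = (M.allocVar x A.pol V).allocVar y B.pol W := by
      revert hAB
      cases A.pol <;> cases B.pol <;> intro hAB <;>
        first | rfl | exact (hAB ⟨nofun, nofun⟩).elim
    obtain ⟨w₁, ok₁, ext₁, has₁⟩ := h.allocVar hx hV heV
    have hy' : ¬ (M.allocVar x A.pol V).DefinesVar y := by
      intro hy'
      by_cases hA : A.pol = .box
      · simp only [Mem.allocVar, hA, Pol.nonModal?, Mem.DefinesVar, Heap.defines_cons] at hy'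
        rcases hy' with (h | h) | h
        exacts [hxy h, hy (.inl h), hy (.inr h)]
      · obtain ⟨π, hπ, hπA⟩ := Pol.nonModal?_of_ne hA
        simp only [Mem.allocVar, hπ, Mem.DefinesVar, Stack.definesVar_cons, Frame.eqns,
          List.mem_singleton, Eqn.var.injEq] at hy'
        rcases hy' with h | ⟨_, _, h, _⟩ | h
        exacts [hy (.inl h), hxy h.symm, hy (.inr h)]
    obtain ⟨w₂, ok₂, ext₂, has₂⟩ := ok₁.allocVar hy' (hW.mono ext₁.le) heW
    -- The second value was unfolded in the intermediate world, which agrees with the initial one on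
    -- its free names.
    rw [← hW.subst_val_eq ext₁.agree] at has₂
    rw [hM]
    exact ⟨w₂, ok₂, ext₁.trans ext₂, has₁.ext ext₂, has₂⟩

theorem World.MemOK.allocCovar (h : w.MemOK R M) {α : ℕ} {A : Ty} {T : Coval}
    (hα : ¬ M.DefinesCovar α) (hT : HT (w.ctx M) (.coval T A)) (he : T.EvalAt A) :
    ∃ w' : World, w'.MemOK R (M.allocCovar α A.pol T) ∧ w.Ext M w' (M.allocCovar α A.pol T) ∧
      w'.HasCovar (M.allocCovar α A.pol T) α A (T.subst w.sub) := by
  have hs := w.sameOn_setCovar hα A (T.subst w.sub)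
  have h' := h.congr hs
  have ht : (w.setCovar α A (T.subst w.sub)).tc α = A := Function.update_self ..
  have hσ : (w.setCovar α A (T.subst w.sub)).sub.onCovar α = T.subst w.sub :=
    Function.update_self ..
  refine ⟨_, h'.pushFrame ?_, hs.ext (World.ctx_le_stack_cons _ _ _ _),
    ⟨.inr (Stack.definesCovar_cons.2 (.inl ⟨_, T, List.mem_singleton_self _⟩)), ht.symm⟩, hσ⟩
  intro E hE
  cases List.mem_singleton.1 hE
  refine ⟨fun h => hα (.inl h), by rw [ht], ?_, ?_, ?_⟩
  · rw [ht]; exact hT.mono hs.ctx_le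
  · rwa [ht]
  · rw [hσ]; exact hT.subst_coval_eq hs.agree

theorem World.MemOK.allocCovars (h : w.MemOK R M) {α β : ℕ} {A B : Ty} {T U : Coval}
    (hαβ : α ≠ β) (hα : ¬ M.DefinesCovar α) (hβ : ¬ M.DefinesCovar β)
    (hT : HT (w.ctx M) (.coval T A)) (hU : HT (w.ctx M) (.coval U B)) (heT : T.EvalAt A)
    (heU : U.EvalAt B) :
    ∃ w' : World, w'.MemOK R (M.allocCovars α A.pol T β B.pol U) ∧
      w.Ext M w' (M.allocCovars α A.pol T β B.pol U) ∧
      w'.HasCovar (M.allocCovars α A.pol T β B.pol U) α A (T.subst w.sub) ∧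
      w'.HasCovar (M.allocCovars α A.pol T β B.pol U) β B (U.subst w.sub) := by
  have hs := (w.sameOn_setCovar hα A (T.subst w.sub)).trans
    (World.sameOn_setCovar hβ B (U.subst w.sub))
  generalize hw : (w.setCovar α A (T.subst w.sub)).setCovar β B (U.subst w.sub) = w' at hs
  have h' := h.congr hs
  have htx : w'.tc α = A := by
    rw [← hw]; simp only [World.setCovar, Function.update_of_ne hαβ, Function.update_self]
  have hσx : w'.sub.onCovar α = T.subst w.sub := by
    rw [← hw]; simp only [World.setCovar, Function.update_of_ne hαβ, Function.update_self]
  have hty : w'.tc β = B := by rw [← hw]; exact Function.update_self ..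
  have hσy : w'.sub.onCovar β = U.subst w.sub := by rw [← hw]; exact Function.update_self ..
  refine ⟨w', h'.pushFrame ?_, hs.ext (World.ctx_le_stack_cons _ _ _ _),
    ⟨⟨.inr (Stack.definesCovar_cons.2 (.inl ⟨_, T, List.mem_cons_self⟩)), htx.symm⟩, hσx⟩,
    ⟨⟨.inr (Stack.definesCovar_cons.2 (.inl ⟨_, U, List.mem_cons_of_mem _ List.mem_cons_self⟩)),
      hty.symm⟩, hσy⟩⟩
  intro E hE
  rcases List.mem_cons.1 hE with rfl | hE
  · refine ⟨fun h => hα (.inl h), by rw [htx], ?_, ?_, ?_⟩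
    · rw [htx]; exact hT.mono hs.ctx_le
    · rwa [htx]
    · rw [hσx]; exact hT.subst_coval_eq hs.agree
  · cases List.mem_singleton.1 hE
    refine ⟨fun h => hβ (.inl h), by rw [hty], ?_, ?_, ?_⟩
    · rw [hty]; exact hU.mono hs.ctx_le
    · rwa [hty]
    · rw [hσy]; exact hU.subst_coval_eq hs.agree

end Basic

/-! ## Evaluation in a typed memory -/

section Eval

variable {w : World} {R : Ty} {M : Mem}

/-- `x : A` is bound in `M` to a value that is typed in `K`. -/
def World.Looks (w : World) (M : Mem) (K : TCtx) (x : ℕ) (A : Ty) : Prop :=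
  ∃ V, M.VarIs x A.pol V ∧ HT K (.val V A) ∧ V.EvalAt A ∧ V.subst w.sub = w.sub.onVar x

/-- All the variables of `K` are bound in `M`. -/
structure World.Covers (w : World) (M : Mem) (K : TCtx) : Prop where
  reg : ∀ x A, K.reg x A → w.Looks M K x A
  mod : ∀ x A, K.mod x A → w.Looks M K.modal x A

theorem World.Covers.modal {K : TCtx} (h : w.Covers M K) : w.Covers M K.modal where
  reg := fun x A hA => (h.reg x A hA.1).imp fun _ hV =>
    ⟨hV.1, hV.2.1.modal_of_box hA.2, hV.2.2⟩
  mod := fun x A hA => (h.mod x A hA).imp fun _ hV => ⟨hV.1, hV.2.1.mono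
    ⟨fun _ _ h => .inl ⟨h, h.2⟩, fun _ _ h => h, fun _ _ h => h⟩, hV.2.2⟩

theorem World.HeapOK.lookup {H : Heap} (h : w.HeapOK H) {x : ℕ} (hx : H.Defines x) :
    ∃ V, ⟨x, (w.tv x).pol, V⟩ ∈ H ∧ HT (w.heapCtx H) (.val V (w.tv x)) ∧ V.EvalAt (w.tv x) ∧
      V.subst w.sub = w.sub.onVar x := by
  induction H with
  | nil => obtain ⟨_, h, _⟩ := hx; cases h
  | cons e H ih =>
    obtain ⟨h, hp, ht, he, hσ⟩ := h
    rcases Heap.defines_cons.1 hx with rfl | hx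
    · exact ⟨e.val, List.mem_cons.2 (.inl (by rw [← hp])), ht.mono (w.heapCtx_le_cons e H), he,
        hσ.symm⟩
    · obtain ⟨V, hV, ht, h'⟩ := ih h hx
      exact ⟨V, List.mem_cons_of_mem _ hV, ht.mono (w.heapCtx_le_cons e H), h'⟩

theorem World.StackOK.lookup_var {H : Heap} {S : Stack} (h : w.StackOK H S) {x : ℕ}
    (hx : S.DefinesVar x) :
    ∃ F ∈ S, ∃ π V, Eqn.var x π V ∈ F.eqns ∧ π.toPol = (w.tv x).pol ∧
      HT (w.ctx ⟨H, S⟩) (.val V (w.tv x)) ∧ V.EvalAt (w.tv x) ∧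
      V.subst w.sub = w.sub.onVar x := by
  induction S with
  | nil => obtain ⟨_, h, _⟩ := hx; cases h
  | cons F S ih =>
    rcases Stack.definesVar_cons.1 hx with ⟨π, V, hE⟩ | hx
    · obtain ⟨hp, ht, he, hσ, _⟩ := h.2 _ hE
      exact ⟨F, List.mem_cons_self, π, V, hE, hp, ht.mono (w.ctx_le_stack_cons H F S), he,
        hσ.symm⟩
    · obtain ⟨F', hF', π, V, hE, hp, ht, h'⟩ := ih h.1 hx
      exact ⟨F', List.mem_cons_of_mem _ hF', π, V, hE, hp, ht.mono (w.ctx_le_stack_cons H F S), h'⟩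

theorem World.StackOK.lookup_covar {H : Heap} {S : Stack} (h : w.StackOK H S) {α : ℕ}
    (hα : S.DefinesCovar α) :
    ∃ F ∈ S, ∃ T, Eqn.covar α (w.tc α).pol T ∈ F.eqns ∧
      HT (w.ctx ⟨H, S⟩) (.coval T (w.tc α)) ∧ T.EvalAt (w.tc α) ∧
      T.subst w.sub = w.sub.onCovar α := by
  induction S with
  | nil => obtain ⟨_, h, _⟩ := hα; cases h
  | cons F S ih =>
    rcases Stack.definesCovar_cons.1 hα with ⟨ε, T, hE⟩ | hα
    · obtain ⟨_, hp, ht, he, hσ⟩ := h.2 _ hE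
      exact ⟨F, List.mem_cons_self, T, hp ▸ hE, ht.mono (w.ctx_le_stack_cons H F S), he, hσ.symm⟩
    · obtain ⟨F', hF', T, hE, ht, h'⟩ := ih h.1 hα
      exact ⟨F', List.mem_cons_of_mem _ hF', T, hE, ht.mono (w.ctx_le_stack_cons H F S), h'⟩

theorem World.MemOK.covers (h : w.MemOK R M) : w.Covers M (w.ctx M) where
  reg := by
    rintro x _ ⟨hx, rfl⟩
    obtain ⟨F, hF, π, V, hE, hp, h'⟩ := h.stack.lookup_var hx
    exact ⟨V, .inr ⟨F, hF, π, hE, hp⟩, h'⟩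
  mod := by
    rintro x _ ⟨hx, rfl⟩
    obtain ⟨V, hV, ht, h'⟩ := h.heap.lookup hx
    exact ⟨V, .inl ⟨_, hV, rfl⟩, ht.mono (w.heapCtx_le_modal M), h'⟩

theorem Pol.eq_toPol_of_ne {ε : Pol} (h : ε ≠ .minus) : ∃ p : PosPol, ε = p.toPol := by
  cases ε
  exacts [⟨.plus, rfl⟩, (h rfl).elim, ⟨.box, rfl⟩]

/-- A negative variable stays as it is; any other one is replaced by a stored value, which was
evaluated before it was stored. -/
theorem World.Looks.eval {K : TCtx} {x : ℕ} {A : Ty} (h : w.Looks M K x A)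
    (hx : HT K (.val (.var x) A)) :
    ∃ V, EvalVal M (.var x) V ∧ HT K (.val V A) ∧ V.EvalAt A ∧
      V.subst w.sub = (Tm.var x).subst w.sub := by
  obtain ⟨V, hM, hV, he, hσ⟩ := h
  by_cases hA : A.pol = .minus
  · rw [hA] at hM
    exact ⟨.var x, .varNeg hM, hx, hA, rfl⟩
  · obtain ⟨p, hp⟩ := Pol.eq_toPol_of_ne hA
    rw [hp] at hM
    exact ⟨V, .varPos hM, hV, he, hσ⟩

/-- The context is allowed to be smaller than that of the memory: under a box it shrinks to its
modal part while the memory stays the same. `World.Covers` is the condition stable under this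
restriction. -/
theorem World.Covers.eval_val {K : TCtx} (hK : w.Covers M K) {V : Val} {A : Ty}
    (h : HT K (.val V A)) :
    ∃ V', EvalVal M V V' ∧ HT K (.val V' A) ∧ V'.EvalAt A ∧ V'.subst w.sub = V.subst w.sub := by
  generalize hJ : Judg.val V A = J at h
  induction h generalizing V A with
  | ax h => cases hJ; exact (hK.reg _ _ h).eval (.ax h)
  | @boxAx K x A h =>
    cases hJ
    obtain ⟨V, h₁, h₂, h₃⟩ := hK.mod _ _ h
    exact World.Looks.eval ⟨V, h₁, h₂.mono K.modal_le, h₃⟩ (.boxAx h)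
  | muNeg hA h => cases hJ; exact ⟨_, .muNeg _, .muNeg hA h, trivial, rfl⟩
  | unit => cases hJ; exact ⟨_, .unit, .unit, trivial, rfl⟩
  | pair _ _ ih ih' =>
    cases hJ
    obtain ⟨V, h₁, h₂, h₃, h₄⟩ := ih hK rfl
    obtain ⟨V', h₁', h₂', h₃', h₄'⟩ := ih' hK rfl
    exact ⟨_, .pair h₁ h₁', .pair h₂ h₂', ⟨h₃, h₃'⟩, by simp only [Tm.subst, h₄, h₄']⟩
  | inl _ ih =>
    cases hJ
    obtain ⟨V, h₁, h₂, h₃, h₄⟩ := ih hK rfl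
    exact ⟨_, .inl h₁, .inl h₂, h₃, by simp only [Tm.subst, h₄]⟩
  | inr _ ih =>
    cases hJ
    obtain ⟨V, h₁, h₂, h₃, h₄⟩ := ih hK rfl
    exact ⟨_, .inr h₁, .inr h₂, h₃, by simp only [Tm.subst, h₄]⟩
  | box _ ih =>
    cases hJ
    obtain ⟨V, h₁, h₂, h₃, h₄⟩ := ih hK.modal rfl
    exact ⟨_, .box h₁, .box h₂, h₃, by simp only [Tm.subst, h₄]⟩
  | muPar hA hB h => cases hJ; exact ⟨_, .muPar _ _ _, .muPar hA hB h, trivial, rfl⟩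
  | muNot hA h => cases hJ; exact ⟨_, .muNot _ _, .muNot hA h, trivial, rfl⟩
  | muWith hA hB h h' => cases hJ; exact ⟨_, .muWith _ _ _ _, .muWith hA hB h h', trivial, rfl⟩
  | _ => cases hJ

theorem World.MemOK.eval_val (ok : w.MemOK R M) {V : Val} {A : Ty}
    (h : HT (w.ctx M) (.val V A)) :
    ∃ V', EvalVal M V V' ∧ HT (w.ctx M) (.val V' A) ∧ V'.EvalAt A ∧
      V'.subst w.sub = V.subst w.sub :=
  ok.covers.eval_val h

theorem World.MemOK.eval_coval (ok : w.MemOK R M) (hR : R.pol = .box) {S : Coval} {A : Ty}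
    (h : HT (w.ctx M) (.coval S A)) :
    ∃ S', EvalCoval M S S' ∧ HT (w.ctx M) (.coval S' A) ∧ S'.EvalAt A ∧
      S'.subst w.sub = S.subst w.sub := by
  generalize hJ : Judg.coval S A = J at h
  generalize hK : w.ctx M = K at h
  induction h generalizing S A with
  | @coAx K α A h =>
    cases hJ
    subst hK
    obtain ⟨h, rfl⟩ := h
    -- No frame defines `tp`; it evaluates to itself because its type `R` is modal.
    by_cases hα : α = tp
    · have hp : (w.tc α).pol = .box := by rw [hα, ok.type_tp, hR]
      exact ⟨_, .covarPos (p := .box) (.inl ⟨hα, rfl⟩), .coAx ⟨h, rfl⟩,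
        fun h' => Pol.noConfusion (hp.symm.trans h'), rfl⟩
    · obtain ⟨F, hF, T, hE, hT, he, hσ⟩ := ok.stack.lookup_covar (h.resolve_left hα)
      by_cases hA : (w.tc α).pol = .minus
      · rw [hA] at hE
        exact ⟨T, .covarNeg ⟨F, hF, hE⟩, hT, he, hσ⟩
      · obtain ⟨p, hp⟩ := Pol.eq_toPol_of_ne hA
        rw [hp] at hE
        exact ⟨_, .covarPos (.inr ⟨T, F, hF, hE⟩), .coAx ⟨h, rfl⟩, hA, rfl⟩
  | mutPos hA h => cases hJ; exact ⟨_, .mutPos _ _, .mutPos hA h, trivial, rfl⟩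
  | mutUnit h => cases hJ; exact ⟨_, .mutUnit _, .mutUnit h, trivial, rfl⟩
  | mutPair hA hB h => cases hJ; exact ⟨_, .mutPair _ _ _, .mutPair hA hB h, trivial, rfl⟩
  | mutSum hA hB h h' => cases hJ; exact ⟨_, .mutSum _ _ _ _, .mutSum hA hB h h', trivial, rfl⟩
  | mutBox hA h => cases hJ; exact ⟨_, .mutBox _ _, .mutBox hA h, trivial, rfl⟩
  | copair _ _ ih ih' =>
    cases hJ
    obtain ⟨V, h₁, h₂, h₃, h₄⟩ := ih rfl hK
    obtain ⟨V', h₁', h₂', h₃', h₄'⟩ := ih' rfl hK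
    exact ⟨_, .copair h₁ h₁', .copair h₂ h₂', ⟨h₃, h₃'⟩, by simp only [Tm.subst, h₄, h₄']⟩
  | conot h =>
    cases hJ
    subst hK
    obtain ⟨V, h₁, h₂, h₃, h₄⟩ := ok.eval_val h
    exact ⟨_, .conot h₁, .conot h₂, h₃, by simp only [Tm.subst, h₄]⟩
  | fst _ ih =>
    cases hJ
    obtain ⟨V, h₁, h₂, h₃, h₄⟩ := ih rfl hK
    exact ⟨_, .fst h₁, .fst h₂, h₃, by simp only [Tm.subst, h₄]⟩
  | snd _ ih =>
    cases hJ
    obtain ⟨V, h₁, h₂, h₃, h₄⟩ := ih rfl hK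
    exact ⟨_, .snd h₁, .snd h₂, h₃, by simp only [Tm.subst, h₄]⟩
  | _ => cases hJ

/-! ### Shapes of evaluated terms -/

/-- A variable left by evaluation has negative type, and so has `μα^-`. At a positive type only the
constructors remain. -/
theorem HT.shape_tensor {K : TCtx} {V : Val} {A B : Ty} (h : HT K (.val V (.tensor A B)))
    (he : V.EvalAt (.tensor A B)) : ∃ V₁ V₂, V = .pair V₁ V₂ ∧ HT K (.val V₁ A) ∧
      HT K (.val V₂ B) ∧ V₁.EvalAt A ∧ V₂.EvalAt B := by
  cases h with
  | ax | boxAx => exact (Pol.odot_ne_minus _ _ he).elim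
  | muNeg hA => exact (Pol.odot_ne_minus _ _ hA).elim
  | pair h h' => exact ⟨_, _, rfl, h, h', he.1, he.2⟩

theorem HT.shape_plus {K : TCtx} {V : Val} {A B : Ty} (h : HT K (.val V (.plus A B)))
    (he : V.EvalAt (.plus A B)) : (∃ V₁, V = .inl V₁ ∧ HT K (.val V₁ A) ∧ V₁.EvalAt A) ∨
      ∃ V₂, V = .inr V₂ ∧ HT K (.val V₂ B) ∧ V₂.EvalAt B := by
  cases h with
  | ax | boxAx => exact (Pol.odot_ne_minus _ _ he).elim
  | muNeg hA => exact (Pol.odot_ne_minus _ _ hA).elim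
  | inl h => exact .inl ⟨_, rfl, h, he⟩
  | inr h => exact .inr ⟨_, rfl, h, he⟩

theorem HT.shape_box {K : TCtx} {V : Val} {A : Ty} (h : HT K (.val V (.box A)))
    (he : V.EvalAt (.box A)) : ∃ V₁, V = .box V₁ ∧ HT K.modal (.val V₁ A) ∧ V₁.EvalAt A := by
  cases h with
  | ax | boxAx => cases he
  | muNeg hA => cases hA
  | box h => exact ⟨_, rfl, h, he⟩

theorem HT.shape_one {K : TCtx} {V : Val} (h : HT K (.val V .one)) (he : V.EvalAt .one) :
    V = .unit := by
  cases h with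
  | ax | boxAx => cases he
  | muNeg hA => cases hA
  | unit => rfl

/-- Dually, a covariable left by evaluation does not have negative type, and `μ̃x` as a co-value has
a positive one. -/
theorem HT.shape_not {K : TCtx} {S : Coval} {A : Ty} (h : HT K (.coval S (.not A)))
    (he : S.EvalAt (.not A)) : ∃ V, S = .conot V ∧ HT K (.val V A) ∧ V.EvalAt A := by
  cases h with
  | coAx => exact (he rfl).elim
  | @mutPos _ p _ _ hA => exact (p.toPol_ne_minus hA.symm).elim
  | conot h => exact ⟨_, rfl, h, he⟩

theorem HT.shape_par {K : TCtx} {S : Coval} {A B : Ty} (h : HT K (.coval S (.par A B)))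
    (he : S.EvalAt (.par A B)) : ∃ S₁ S₂, S = .copair S₁ S₂ ∧ HT K (.coval S₁ A) ∧
      HT K (.coval S₂ B) ∧ S₁.EvalAt A ∧ S₂.EvalAt B := by
  cases h with
  | coAx => exact (he rfl).elim
  | @mutPos _ p _ _ hA => exact (p.toPol_ne_minus hA.symm).elim
  | copair h h' => exact ⟨_, _, rfl, h, h', he.1, he.2⟩

theorem HT.shape_withT {K : TCtx} {S : Coval} {A B : Ty} (h : HT K (.coval S (.withT A B)))
    (he : S.EvalAt (.withT A B)) : (∃ S₁, S = .fst S₁ ∧ HT K (.coval S₁ A) ∧ S₁.EvalAt A) ∨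
      ∃ S₂, S = .snd S₂ ∧ HT K (.coval S₂ B) ∧ S₂.EvalAt B := by
  cases h with
  | coAx => exact (he rfl).elim
  | @mutPos _ p _ _ hA => exact (p.toPol_ne_minus hA.symm).elim
  | fst h => exact .inl ⟨_, rfl, h, he⟩
  | snd h => exact .inr ⟨_, rfl, h, he⟩

/-! ### Fresh names -/

theorem World.heap_not_free {H : Heap} (h : w.HeapOK H) {x : ℕ} (hx : ¬ H.Defines x) :
    ∀ e ∈ H, e.name ≠ x ∧ ¬ e.val.FreeVar x := by
  intro e he
  refine ⟨fun h => hx ⟨e, he, h⟩, fun hf => ?_⟩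
  induction H with
  | nil => cases he
  | cons e' H ih =>
    rcases List.mem_cons.1 he with rfl | he
    · obtain ⟨_, h | h⟩ := h.2.2.1.freeVar hf
      exacts [h, hx (Heap.defines_cons.2 (.inr h.1))]
    · exact ih h.1 (fun h => hx (Heap.defines_cons.2 (.inr h))) he

theorem World.heap_not_free_covar {H : Heap} (h : w.HeapOK H) (α : ℕ) :
    ∀ e ∈ H, ¬ e.val.FreeCovar α := by
  intro e he hf
  induction H with
  | nil => cases he
  | cons e' H ih =>
    rcases List.mem_cons.1 he with rfl | he
    · exact (h.2.2.1.freeCovar hf).elim fun _ h => h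
    · exact ih h.1 he

theorem World.StackOK.eqnOK {H : Heap} {S : Stack} (h : w.StackOK H S) {F : Frame} (hF : F ∈ S)
    {E : Eqn} (hE : E ∈ F.eqns) : ∃ S', (w.ctx ⟨H, S'⟩).Le (w.ctx ⟨H, S⟩) ∧ w.EqnOK ⟨H, S'⟩ E := by
  induction S with
  | nil => cases hF
  | cons F' S ih =>
    rcases List.mem_cons.1 hF with rfl | hF
    · exact ⟨S, w.ctx_le_stack_cons H F S, h.2 E hE⟩
    · obtain ⟨S', hle, hok⟩ := ih h.1 hF
      refine ⟨S', ⟨fun x A hx => ?_, fun _ _ hx => hx, fun α A hα => ?_⟩, hok⟩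
      · exact (hle.reg x A hx).elim ((w.ctx_le_stack_cons H F' S).reg x A) .inr
      · exact (w.ctx_le_stack_cons H F' S).cov α A (hle.cov α A hα)

theorem World.ctx_not_freeVar {J : Judg} (h : HT (w.ctx M) J) {x : ℕ} (hx : ¬ M.DefinesVar x) :
    ¬ J.FreeVar x := by
  intro hf
  obtain ⟨_, h | h⟩ := h.freeVar hf
  exacts [hx (.inr h.1), hx (.inl h.1)]

theorem World.ctx_not_freeCovar {J : Judg} (h : HT (w.ctx M) J) {α : ℕ}
    (hα : ¬ M.DefinesCovar α) : ¬ J.FreeCovar α := by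
  intro hf
  obtain ⟨_, h⟩ := h.freeCovar hf
  exact hα h.1

/-- Every free variable of a well-typed state is defined in its memory, so being undefined is enough
for freshness. -/
theorem World.MemOK.freshVar (h : w.MemOK R M) {c : Cmd} (hc : HT (w.ctx M) (.cmd c)) {x : ℕ}
    (hx : ¬ M.DefinesVar x) : FreshVar M c x := by
  refine ⟨World.heap_not_free h.heap fun h => hx (.inl h), ?_,
    World.ctx_not_freeVar hc hx⟩
  intro F hF E hE
  obtain ⟨S', hle, hok⟩ := h.stack.eqnOK hF hE
  cases E with
  | var y π V =>
    exact ⟨by rintro rfl; exact hx (.inr ⟨F, hF, π, V, hE⟩),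
      World.ctx_not_freeVar (hok.2.1.mono hle) hx⟩
  | covar β ε T => exact World.ctx_not_freeVar (hok.2.2.1.mono hle) hx

theorem World.MemOK.freshCovar (h : w.MemOK R M) {c : Cmd} (hc : HT (w.ctx M) (.cmd c)) {α : ℕ}
    (hα : ¬ M.DefinesCovar α) : FreshCovar M c α := by
  refine ⟨fun h => hα (.inl h), World.heap_not_free_covar h.heap α, ?_,
    World.ctx_not_freeCovar hc hα⟩
  intro F hF E hE
  obtain ⟨S', hle, hok⟩ := h.stack.eqnOK hF hE
  cases E with
  | var y π V => exact World.ctx_not_freeCovar (hok.2.1.mono hle) hα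
  | covar β ε T =>
    exact ⟨by rintro rfl; exact hα (.inr ⟨F, hF, ε, T, hE⟩),
      World.ctx_not_freeCovar (hok.2.2.1.mono hle) hα⟩

theorem Heap.exists_bound (H : Heap) : ∃ N, ∀ x, H.Defines x → x < N := by
  induction H with
  | nil => exact ⟨0, fun x ⟨_, h, _⟩ => nomatch h⟩
  | cons e H ih =>
    obtain ⟨N, hN⟩ := ih
    refine ⟨max (e.name + 1) N, fun x hx => ?_⟩
    rcases Heap.defines_cons.1 hx with rfl | hx
    · exact lt_max_of_lt_left (Nat.lt_succ_self _)
    · exact lt_max_of_lt_right (hN x hx)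

def Eqn.name : Eqn → ℕ
  | .var x _ _ => x
  | .covar α _ _ => α

theorem Stack.exists_bound (S : Stack) : ∃ N, ∀ F ∈ S, ∀ E ∈ F.eqns, E.name < N := by
  have hF (F : Frame) : ∃ N, ∀ E ∈ F.eqns, E.name < N := by
    cases F with
    | one E => exact ⟨E.name + 1, by simp [Frame.eqns]⟩
    | two E E' => exact ⟨E.name + E'.name + 1, by simp [Frame.eqns]⟩
  induction S with
  | nil => exact ⟨0, fun F hF => nomatch hF⟩
  | cons F S ih =>
    obtain ⟨N, hN⟩ := ih
    obtain ⟨N', hN'⟩ := hF F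
    refine ⟨max N N', fun F' hF' E hE => ?_⟩
    rcases List.mem_cons.1 hF' with rfl | hF'
    · exact lt_max_of_lt_right (hN' E hE)
    · exact lt_max_of_lt_left (hN F' hF' E hE)

theorem Mem.exists_bound (M : Mem) :
    ∃ N, ∀ x, N ≤ x → ¬ M.DefinesVar x ∧ ¬ M.DefinesCovar x := by
  obtain ⟨N, hN⟩ := Heap.exists_bound M.heap
  obtain ⟨N', hN'⟩ := Stack.exists_bound M.stack
  -- The bound `1` excludes `tp`, which is the index `0` and counts as defined.
  refine ⟨max (max N N') 1, fun x hx => ⟨?_, ?_⟩⟩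
  · rintro (h | ⟨F, hF, π, V, hE⟩)
    · have := hN x h; omega
    · have : x < N' := hN' F hF _ hE
      omega
  · rintro (h | ⟨F, hF, π, V, hE⟩)
    · have : tp = 0 := rfl
      omega
    · have : x < N' := hN' F hF _ hE
      omega

end Eval

/-! ## The machine simulates evaluation -/

theorem TCtx.Ren.scons_var {f g : ℕ → ℕ} {K K' : TCtx} {x : ℕ} {A : Ty} (h : Ren f g K K')
    (hx : K'.reg x A ∨ K'.mod x A) : Ren (scons x f) g (K.bindVar A) K' where
  reg := by rintro (_ | n) B hB; exacts [by cases hB; exact hx, h.reg n B hB]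
  mod := by rintro (_ | n) B hB; exacts [hB.elim, h.mod n B hB]
  cov := h.cov

theorem TCtx.Ren.scons_box {f g : ℕ → ℕ} {K K' : TCtx} {x : ℕ} {A : Ty} (h : Ren f g K K')
    (hx : K'.mod x A) : Ren (scons x f) g (K.bindBox A) K' where
  reg := by rintro (_ | n) B hB; exacts [hB.elim, h.reg n B hB]
  mod := by rintro (_ | n) B hB; exacts [by cases hB; exact hx, h.mod n B hB]
  cov := h.cov

theorem TCtx.Ren.scons_covar {f g : ℕ → ℕ} {K K' : TCtx} {α : ℕ} {A : Ty} (h : Ren f g K K')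
    (hα : K'.cov α A) : Ren f (scons α g) (K.bindCovar A) K' where
  reg := h.reg
  mod := h.mod
  cov := by rintro (_ | n) B hB; exacts [by cases hB; exact hα, h.cov n B hB]

namespace TCtx.Agree

variable {K : TCtx} {σ τ : Sub} {f g : ℕ → ℕ}

theorem precomp_var (h : K.Agree σ (τ.precomp f g)) (A : Ty) (x : ℕ) :
    (K.bindVar A).Agree (σ.consVar (τ.onVar x)) (τ.precomp (scons x f) g) where
  reg := by rintro (_ | n) B hB; exacts [rfl, h.reg n B hB]
  mod := by rintro (_ | n) B hB; exacts [rfl, h.mod n B hB]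
  cov := h.cov

theorem precomp_box (h : K.Agree σ (τ.precomp f g)) (A : Ty) (x : ℕ) :
    (K.bindBox A).Agree (σ.consVar (τ.onVar x)) (τ.precomp (scons x f) g) where
  reg := by rintro (_ | n) B hB; exacts [rfl, h.reg n B hB]
  mod := by rintro (_ | n) B hB; exacts [rfl, h.mod n B hB]
  cov := h.cov

theorem precomp_covar (h : K.Agree σ (τ.precomp f g)) (A : Ty) (α : ℕ) :
    (K.bindCovar A).Agree (σ.consCovar (τ.onCovar α)) (τ.precomp f (scons α g)) where
  reg := h.reg
  mod := h.mod
  cov := by rintro (_ | n) B hB; exacts [rfl, h.cov n B hB]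

end TCtx.Agree

section Machine

variable {w : World} {R : Ty} {M : Mem}

/-- The machine has a step from `(M, c)` to a well-typed state that unfolds to `d`. -/
def StepsTo (R : Ty) (M : Mem) (c d : Cmd) : Prop :=
  ∃ (w' : World) (M' : Mem) (c' : Cmd), Step (M, c) (M', c') ∧ w'.MemOK R M' ∧
    HT (w'.ctx M') (.cmd c') ∧ c'.subst w'.sub = d

/-- The new name unfolds to the unfolding of the stored value. Naming the bound variable and then
unfolding is therefore the same as unfolding the body and substituting, as `▷` does. -/
theorem World.MemOK.step_var (ok : w.MemOK R M) {c₀ c : Cmd} {A : Ty} {V : Val}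
    (hc₀ : HT (w.ctx M) (.cmd c₀)) (hc : HT ((w.ctx M).bindVar A) (.cmd c))
    (hV : HT (w.ctx M) (.val V A)) (he : V.EvalAt A)
    (hstep : ∀ x, FreshVar M c₀ x → Step (M, c₀) (M.allocVar x A.pol V, c.openVar x)) :
    StepsTo R M c₀ ((c.subst w.sub.upVar).instVar (V.subst w.sub)) := by
  obtain ⟨N, hN⟩ := M.exists_bound
  have hx := (hN N le_rfl).1
  obtain ⟨w', ok', ext, has⟩ := ok.allocVar hx hV he
  refine ⟨w', _, _, hstep N (ok.freshVar hc₀ hx), ok', hc.rename (ext.le.scons_var has.1), ?_⟩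
  rw [Tm.openVar, Tm.subst_rename_left, Tm.subst_upVar_instVar, ← has.2]
  -- Precomposition with identities does not change the new substitution, so the agreement of the
  -- two worlds lifts directly to the body.
  exact (hc.subst_cmd_eq (ext.agree.precomp_var (f := id) (g := id) A N)).symm

theorem World.MemOK.step_box (ok : w.MemOK R M) {c₀ c : Cmd} {A : Ty} {V : Val}
    (hc₀ : HT (w.ctx M) (.cmd c₀)) (hc : HT ((w.ctx M).bindBox A) (.cmd c))
    (hV : HT (w.ctx M).modal (.val V A)) (he : V.EvalAt A)
    (hstep : ∀ x, FreshVar M c₀ x → Step (M, c₀) (M.allocHeap x A.pol V, c.openVar x)) :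
    StepsTo R M c₀ ((c.subst w.sub.upVar).instVar (V.subst w.sub)) := by
  obtain ⟨N, hN⟩ := M.exists_bound
  have hx := (hN N le_rfl).1
  obtain ⟨w', ok', ext, hN', hσ⟩ := ok.allocHeap hx (hV.mono ok.modal_le) he
  refine ⟨w', _, _, hstep N (ok.freshVar hc₀ hx), ok', hc.rename (ext.le.scons_box hN'), ?_⟩
  rw [Tm.openVar, Tm.subst_rename_left, Tm.subst_upVar_instVar, ← hσ]
  exact (hc.subst_cmd_eq (ext.agree.precomp_box (f := id) (g := id) A N)).symm

theorem World.MemOK.step_vars (ok : w.MemOK R M) {c₀ c : Cmd} {A B : Ty} {V W : Val}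
    (hc₀ : HT (w.ctx M) (.cmd c₀)) (hc : HT (((w.ctx M).bindVar B).bindVar A) (.cmd c))
    (hV : HT (w.ctx M) (.val V A)) (hW : HT (w.ctx M) (.val W B)) (heV : V.EvalAt A)
    (heW : W.EvalAt B)
    (hstep : ∀ x y, x ≠ y → FreshVar M c₀ x → FreshVar M c₀ y →
      Step (M, c₀) (M.allocVars x A.pol V y B.pol W, c.openVars x y)) :
    StepsTo R M c₀ ((c.subst w.sub.upVar.upVar).instVars (V.subst w.sub) (W.subst w.sub)) := by
  obtain ⟨N, hN⟩ := M.exists_bound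
  have hx := (hN N le_rfl).1
  have hy := (hN (N + 1) (Nat.le_succ N)).1
  have hxy : N ≠ N + 1 := (Nat.succ_ne_self N).symm
  obtain ⟨w', ok', ext, has, has'⟩ := ok.allocVars hxy hx hy hV hW heV heW
  refine ⟨w', _, _, hstep N (N + 1) hxy (ok.freshVar hc₀ hx) (ok.freshVar hc₀ hy), ok',
    hc.rename ((ext.le.scons_var has'.1).scons_var has.1), ?_⟩
  rw [Tm.openVars, Tm.subst_rename_left, Tm.subst_upVar_instVars, ← has.2, ← has'.2]
  exact (hc.subst_cmd_eq
    ((ext.agree.precomp_var (f := id) (g := id) B (N + 1)).precomp_var A N)).symm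

theorem World.MemOK.step_covar (ok : w.MemOK R M) {c₀ c : Cmd} {A : Ty} {T : Coval}
    (hc₀ : HT (w.ctx M) (.cmd c₀)) (hc : HT ((w.ctx M).bindCovar A) (.cmd c))
    (hT : HT (w.ctx M) (.coval T A)) (he : T.EvalAt A)
    (hstep : ∀ α, FreshCovar M c₀ α → Step (M, c₀) (M.allocCovar α A.pol T, c.openCovar α)) :
    StepsTo R M c₀ ((c.subst w.sub.upCovar).instCovar (T.subst w.sub)) := by
  obtain ⟨N, hN⟩ := M.exists_bound
  have hx := (hN N le_rfl).2
  obtain ⟨w', ok', ext, has⟩ := ok.allocCovar hx hT he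
  refine ⟨w', _, _, hstep N (ok.freshCovar hc₀ hx), ok', hc.rename (ext.le.scons_covar has.1), ?_⟩
  rw [Tm.openCovar, Tm.subst_rename_left, Tm.subst_upCovar_instCovar, ← has.2]
  exact (hc.subst_cmd_eq (ext.agree.precomp_covar (f := id) (g := id) A N)).symm

theorem World.MemOK.step_covars (ok : w.MemOK R M) {c₀ c : Cmd} {A B : Ty} {T U : Coval}
    (hc₀ : HT (w.ctx M) (.cmd c₀)) (hc : HT (((w.ctx M).bindCovar B).bindCovar A) (.cmd c))
    (hT : HT (w.ctx M) (.coval T A)) (hU : HT (w.ctx M) (.coval U B)) (heT : T.EvalAt A)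
    (heU : U.EvalAt B)
    (hstep : ∀ α β, α ≠ β → FreshCovar M c₀ α → FreshCovar M c₀ β →
      Step (M, c₀) (M.allocCovars α A.pol T β B.pol U, c.openCovars α β)) :
    StepsTo R M c₀
      ((c.subst w.sub.upCovar.upCovar).instCovars (T.subst w.sub) (U.subst w.sub)) := by
  obtain ⟨N, hN⟩ := M.exists_bound
  have hx := (hN N le_rfl).2
  have hy := (hN (N + 1) (Nat.le_succ N)).2
  have hxy : N ≠ N + 1 := (Nat.succ_ne_self N).symm
  obtain ⟨w', ok', ext, has, has'⟩ := ok.allocCovars hxy hx hy hT hU heT heU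
  refine ⟨w', _, _, hstep N (N + 1) hxy (ok.freshCovar hc₀ hx) (ok.freshCovar hc₀ hy), ok',
    hc.rename ((ext.le.scons_covar has'.1).scons_covar has.1), ?_⟩
  rw [Tm.openCovars, Tm.subst_rename_left, Tm.subst_upCovar_instCovars, ← has.2, ← has'.2]
  exact (hc.subst_cmd_eq
    ((ext.agree.precomp_covar (f := id) (g := id) B (N + 1)).precomp_covar A N)).symm

/-- A state whose command is not about to look up a name simulates a reduction. -/
def World.Simulates (w : World) (R : Ty) (M : Mem) (c : Cmd) : Prop :=
  ∃ d, Red (c.subst w.sub) d ∧ StepsTo R M c d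

theorem World.MemOK.simulates_muPos (ok : w.MemOK R M) (hR : R.pol = .box) {p : PosPol} {c : Cmd}
    {S : Coval} {A : Ty} (hA : A.pol = p.toPol)
    (hc : HT ((w.ctx M).bindCovar A) (.cmd c)) (hS : HT (w.ctx M) (.coval S A)) :
    w.Simulates R M (.cutPos p (.muPos p c) S) := by
  obtain ⟨S', h₁, h₂, h₃, h₄⟩ := ok.eval_coval hR hS
  refine ⟨_, .muPos _ _ _, ?_⟩
  rw [← h₄]
  refine ok.step_covar (.cutPos hA (.muPos hA hc) hS) hc h₂ h₃ fun α hα => ?_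
  rw [hA]
  exact .muPos h₁ hα

/-- Once the co-value is not a covariable, it is a binder, and evaluating the value exposes the
constructor that the binder expects. -/
theorem World.MemOK.simulates_cutPos (ok : w.MemOK R M) {p : PosPol} {V : Val} {S : Coval}
    {A : Ty} (hA : A.pol = p.toPol) (hV : HT (w.ctx M) (.val V A))
    (hS : HT (w.ctx M) (.coval S A)) (hnc : ∀ α, S ≠ .covar α) :
    w.Simulates R M (.cutPos p (.ofVal V) S) := by
  have hcut : HT (w.ctx M) (.cmd (.cutPos p (.ofVal V) S)) := .cutPos hA (.ofVal hA hV) hS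
  obtain ⟨V', h₁, h₂, h₃, h₄⟩ := ok.eval_val hV
  cases hS with
  | coAx => exact (hnc _ rfl).elim
  | @mutPos _ q c _ hq hc =>
    cases PosPol.toPol_injective (hA.symm.trans hq)
    refine ⟨_, .mutPos _ _ _, ?_⟩
    rw [← h₄]
    refine ok.step_var hcut hc h₂ h₃ fun x hx => ?_
    rw [hA]
    exact .mutPos h₁ hx
  | mutUnit hc =>
    cases h₂.shape_one h₃
    cases PosPol.toPol_injective (p := p) (q := .box) hA.symm
    refine ⟨_, ?_, w, M, _, .mutUnit h₁, ok, hc, rfl⟩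
    -- Evaluation preserves the unfolding, so the unfolded value has the same head constructor as
    -- the evaluated one and the reduction rule applies.
    simp only [Tm.subst, ← h₄]
    exact .unit _
  | mutPair hA₁ hA₂ hc =>
    subst hA₁ hA₂
    obtain ⟨V₁, V₂, rfl, t₁, t₂, e₁, e₂⟩ := h₂.shape_tensor h₃
    refine ⟨_, ?_, ok.step_vars hcut hc t₁ t₂ e₁ e₂ fun x y hxy hx hy =>
      .mutPairPos h₁ hxy hx hy⟩
    simp only [Tm.subst, ← h₄]
    exact .pairPos _ _ _ _ _ _
  | mutSum hA₁ hA₂ hc hc' =>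
    subst hA₁ hA₂
    rcases h₂.shape_plus h₃ with ⟨V₁, rfl, t₁, e₁⟩ | ⟨V₁, rfl, t₁, e₁⟩
    · refine ⟨_, ?_, ok.step_var hcut hc t₁ e₁ fun x hx => .inlPos h₁ hx⟩
      simp only [Tm.subst, ← h₄]
      exact .inlPos _ _ _ _ _ _
    · refine ⟨_, ?_, ok.step_var hcut hc' t₁ e₁ fun x hx => .inrPos h₁ hx⟩
      simp only [Tm.subst, ← h₄]
      exact .inrPos _ _ _ _ _ _
  | mutBox hA₁ hc =>
    subst hA₁
    cases PosPol.toPol_injective (p := p) (q := .box) hA.symm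
    obtain ⟨V₁, rfl, t₁, e₁⟩ := h₂.shape_box h₃
    refine ⟨_, ?_, ok.step_box hcut hc t₁ e₁ fun x hx => .mutBox h₁ hx⟩
    simp only [Tm.subst, ← h₄]
    exact .box _ _ _
  | copair | conot | fst | snd => exact (p.toPol_ne_minus hA.symm).elim

theorem World.MemOK.simulates_mutNeg (ok : w.MemOK R M) {V : Val} {c : Cmd} {A : Ty}
    (hA : A.pol = .minus) (hV : HT (w.ctx M) (.val V A))
    (hc : HT ((w.ctx M).bindVar A) (.cmd c)) : w.Simulates R M (.cutNeg V (.mutNeg c)) := by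
  obtain ⟨V', h₁, h₂, h₃, h₄⟩ := ok.eval_val hV
  refine ⟨_, .mutNeg _ _, ?_⟩
  rw [← h₄]
  refine ok.step_var (.cutNeg hA hV (.mutNeg hA hc)) hc h₂ h₃ fun x hx => ?_
  rw [hA]
  exact .mutNeg h₁ hx

theorem World.MemOK.simulates_cutNeg (ok : w.MemOK R M) (hR : R.pol = .box) {V : Val} {S : Coval}
    {A : Ty} (hA : A.pol = .minus) (hV : HT (w.ctx M) (.val V A))
    (hS : HT (w.ctx M) (.coval S A)) (hnv : ∀ x, V ≠ .var x) :
    w.Simulates R M (.cutNeg V (.ofCoval S)) := by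
  have hcut : HT (w.ctx M) (.cmd (.cutNeg V (.ofCoval S))) := .cutNeg hA hV (.ofCoval hA hS)
  obtain ⟨S', h₁, h₂, h₃, h₄⟩ := ok.eval_coval hR hS
  cases hV with
  | ax | boxAx => exact (hnv _ rfl).elim
  | muNeg _ hc =>
    refine ⟨_, .muNeg _ _, ?_⟩
    rw [← h₄]
    refine ok.step_covar hcut hc h₂ h₃ fun x hx => ?_
    rw [hA]
    exact .muNeg h₁ hx
  | unit | box => cases hA
  | pair | inl | inr => exact (Pol.odot_ne_minus _ _ hA).elim
  | muPar hA₁ hA₂ hc =>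
    subst hA₁ hA₂
    obtain ⟨S₁, S₂, rfl, t₁, t₂, e₁, e₂⟩ := h₂.shape_par h₃
    refine ⟨_, ?_, ok.step_covars hcut hc t₁ t₂ e₁ e₂ fun x y hxy hx hy =>
      .muPar h₁ hxy hx hy⟩
    simp only [Tm.subst, ← h₄]
    exact .copair _ _ _ _ _
  | muNot hA₁ hc =>
    subst hA₁
    obtain ⟨V₁, rfl, t₁, e₁⟩ := h₂.shape_not h₃
    refine ⟨_, ?_, ok.step_var hcut hc t₁ e₁ fun x hx => .muNot h₁ hx⟩
    simp only [Tm.subst, ← h₄]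
    exact .conot _ _ _
  | muWith hA₁ hA₂ hc hc' =>
    subst hA₁ hA₂
    rcases h₂.shape_withT h₃ with ⟨V₁, rfl, t₁, e₁⟩ | ⟨V₁, rfl, t₁, e₁⟩
    · refine ⟨_, ?_, ok.step_covar hcut hc t₁ e₁ fun x hx => .fst h₁ hx⟩
      simp only [Tm.subst, ← h₄]
      exact .fst _ _ _ _ _
    · refine ⟨_, ?_, ok.step_covar hcut hc' t₁ e₁ fun x hx => .snd h₁ hx⟩
      simp only [Tm.subst, ← h₄]
      exact .snd _ _ _ _ _

/-! ### Lookups -/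

/-- Iterated steps of the machine. -/
abbrev Steps : Mem × Cmd → Mem × Cmd → Prop := Relation.ReflTransGen Step

/-- Opening boxes can store negative values on the heap, among them variables, so a lookup may have
to be repeated. Each one leads to an older equation; the induction is on the suffix `H₀` of the heap
in which the value is typed, while the memory is fixed. -/
theorem World.HeapOK.resolve {H₀ : Heap} (h : w.HeapOK H₀) (hH : ∀ e ∈ H₀, e ∈ M.heap) {V : Val}
    {A : Ty} (hA : A.pol = .minus) (hV : HT (w.heapCtx H₀) (.val V A)) :
    ∃ V', (∀ S, Steps (M, .cutNeg V (.ofCoval S)) (M, .cutNeg V' (.ofCoval S))) ∧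
      HT (w.heapCtx H₀) (.val V' A) ∧ V'.subst w.sub = V.subst w.sub ∧ ∀ x, V' ≠ .var x := by
  induction H₀ generalizing V with
  | nil =>
    refine ⟨V, fun _ => .refl, hV, rfl, ?_⟩
    rintro x rfl
    cases hV with
    | ax h => exact h
    | boxAx h => obtain ⟨⟨_, h, _⟩, _⟩ := h; cases h
  | cons e H₀ ih =>
    obtain ⟨h, hp, ht, he, hσ⟩ := h
    have hH' : ∀ e ∈ H₀, e ∈ M.heap := fun e he => hH e (List.mem_cons_of_mem _ he)
    by_cases hx : ∃ x, V = .var x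
    · obtain ⟨x, rfl⟩ := hx
      cases hV with
      | ax h => exact h.elim
      | boxAx hx =>
        obtain ⟨hx, rfl⟩ := hx
        rcases Heap.defines_cons.1 hx with rfl | hx
        · obtain ⟨V', hs, ht', hV', hn⟩ := ih h hH' ht
          refine ⟨V', fun S => .head (.evalMinus (.inl ⟨e, hH e List.mem_cons_self, ?_⟩)) (hs S),
            ht'.mono (w.heapCtx_le_cons e H₀), hV'.trans hσ.symm, hn⟩
          rw [← hA, ← hp]
        · obtain ⟨V', hs, ht', h'⟩ := ih h hH' (.boxAx ⟨hx, rfl⟩)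
          exact ⟨V', hs, ht'.mono (w.heapCtx_le_cons e H₀), h'⟩
    · exact ⟨V, fun _ => .refl, hV, rfl, fun x hV => hx ⟨x, hV⟩⟩

/-- A chain of negative variables descends through older frames and may enter the heap, which it
then cannot leave. -/
theorem World.StackOK.resolve_val (hh : w.HeapOK M.heap) {S₀ : Stack} (h : w.StackOK M.heap S₀)
    (hS : ∀ F ∈ S₀, F ∈ M.stack) {V : Val} {A : Ty} (hA : A.pol = .minus)
    (hV : HT (w.ctx ⟨M.heap, S₀⟩) (.val V A)) :
    ∃ V', (∀ S, Steps (M, .cutNeg V (.ofCoval S)) (M, .cutNeg V' (.ofCoval S))) ∧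
      HT (w.ctx ⟨M.heap, S₀⟩) (.val V' A) ∧ V'.subst w.sub = V.subst w.sub ∧
      ∀ x, V' ≠ .var x := by
  by_cases hx : ∃ x, V = .var x
  swap
  · exact ⟨V, fun _ => .refl, hV, rfl, fun x hV => hx ⟨x, hV⟩⟩
  obtain ⟨x, rfl⟩ := hx
  cases hV with
  | boxAx hx =>
    obtain ⟨V', hs, ht, h'⟩ := hh.resolve (fun _ h => h) hA (.boxAx hx)
    exact ⟨V', hs, ht.mono (w.heapCtx_le ⟨M.heap, S₀⟩), h'⟩
  | ax hx =>
    obtain ⟨hx, rfl⟩ := hx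
    induction S₀ generalizing x with
    | nil => obtain ⟨_, h, _⟩ := hx; cases h
    | cons F S₀ ih =>
      have hS' : ∀ F ∈ S₀, F ∈ M.stack := fun F hF => hS F (List.mem_cons_of_mem _ hF)
      have hle := w.ctx_le_stack_cons M.heap F S₀
      rcases Stack.definesVar_cons.1 hx with ⟨π, V, hE⟩ | hx
      · obtain ⟨hp, ht, he, hσ, _⟩ := h.2 _ hE
        have hstep (S : Coval) :
            Step (M, .cutNeg (.var x) (.ofCoval S)) (M, .cutNeg V (.ofCoval S)) :=
          .evalMinus (.inr ⟨F, hS F List.mem_cons_self, π, hE, hp.trans hA⟩)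
        by_cases hy : ∃ y, V = .var y
        · obtain ⟨y, rfl⟩ := hy
          -- The type is separated from `x` so that inversion can identify it with the type of `y`.
          generalize hB : w.tv x = B at ht hA
          cases ht with
          | ax hy =>
            obtain ⟨hy, rfl⟩ := hy
            obtain ⟨V', hs, ht', hV', hn⟩ := ih h.1 hS' y hy hA
            exact ⟨V', fun S => .head (hstep S) (hs S), ht'.mono hle, hV'.trans hσ.symm, hn⟩
          | boxAx hy =>
            obtain ⟨V', hs, ht', hV', hn⟩ := hh.resolve (fun _ h => h) hA (.boxAx hy)
            exact ⟨V', fun S => .head (hstep S) (hs S), ht'.mono (w.heapCtx_le ⟨M.heap, F :: S₀⟩),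
              hV'.trans hσ.symm, hn⟩
        · exact ⟨V, fun S => .single (hstep S), ht.mono hle, hσ.symm, fun y hV => hy ⟨y, hV⟩⟩
      · obtain ⟨V', hs, ht', h'⟩ := ih h.1 hS' x hx hA
        exact ⟨V', hs, ht'.mono hle, h'⟩

/-- Each lookup moves to an older frame, and the chain cannot end in `tp`, whose polarity is `□`
rather than `+`. -/
theorem World.StackOK.resolve_plus (htp : (w.tc tp).pol = .box) {S₀ : Stack}
    (h : w.StackOK M.heap S₀)
    (hS : ∀ F ∈ S₀, F ∈ M.stack) {S : Coval} {A : Ty} (hA : A.pol = .plus)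
    (hT : HT (w.ctx ⟨M.heap, S₀⟩) (.coval S A)) :
    ∃ S', (∀ V, Steps (M, .cutPos .plus (.ofVal V) S) (M, .cutPos .plus (.ofVal V) S')) ∧
      HT (w.ctx ⟨M.heap, S₀⟩) (.coval S' A) ∧ S'.subst w.sub = S.subst w.sub ∧
      ∀ α, S' ≠ .covar α := by
  induction S₀ generalizing S with
  | nil =>
    refine ⟨S, fun _ => .refl, hT, rfl, ?_⟩
    rintro α rfl
    cases hT with
    | coAx h =>
      obtain ⟨rfl | ⟨_, h, _⟩, rfl⟩ := h
      · cases htp.symm.trans hA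
      · cases h
  | cons F S₀ ih =>
    have hS' : ∀ F ∈ S₀, F ∈ M.stack := fun F hF => hS F (List.mem_cons_of_mem _ hF)
    have hle := w.ctx_le_stack_cons M.heap F S₀
    by_cases hα : ∃ α, S = .covar α
    · obtain ⟨α, rfl⟩ := hα
      cases hT with
      | coAx hα =>
        obtain ⟨rfl | hα, rfl⟩ := hα
        · cases htp.symm.trans hA
        rcases Stack.definesCovar_cons.1 hα with ⟨ε, T, hE⟩ | hα
        · obtain ⟨_, hp, ht, he, hσ⟩ := h.2 _ hE
          obtain ⟨S', hs, ht', hV', hn⟩ := ih h.1 hS' ht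
          rw [hp, hA] at hE
          exact ⟨S', fun V => .head (.evalPlus ⟨F, hS F List.mem_cons_self, hE⟩) (hs V),
            ht'.mono hle, hV'.trans hσ.symm, hn⟩
        · obtain ⟨S', hs, ht', h'⟩ := ih h.1 hS' (.coAx ⟨.inr hα, rfl⟩)
          exact ⟨S', hs, ht'.mono hle, h'⟩
    · exact ⟨S, fun _ => .refl, hT, rfl, fun α h => hα ⟨α, h⟩⟩

theorem Eqn.any_definesCovar {F : Frame} {α : ℕ} :
    F.eqns.any (Eqn.definesCovar α) = true ↔ ∃ ε T, Eqn.covar α ε T ∈ F.eqns := by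
  rw [List.any_eq_true]
  constructor
  · rintro ⟨E, hE, h⟩
    cases E with
    | var => cases h
    | covar β ε T =>
      have : β = α := by simpa [Eqn.definesCovar] using h
      subst this
      exact ⟨ε, T, hE⟩
  · rintro ⟨ε, T, hE⟩
    exact ⟨_, hE, by simp [Eqn.definesCovar]⟩

/-- The co-value found was typed over the frames older than its own, and these are exactly the ones
that are kept. -/
theorem World.StackOK.dropTo {H : Heap} {S : Stack} (h : w.StackOK H S) {α : ℕ}
    (hα : S.DefinesCovar α) :
    (Stack.dropTo α S).length < S.length ∧ w.StackOK H (Stack.dropTo α S) ∧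
      ∃ F ∈ S, ∃ T, Eqn.covar α (w.tc α).pol T ∈ F.eqns ∧
        HT (w.ctx ⟨H, Stack.dropTo α S⟩) (.coval T (w.tc α)) ∧
        T.subst w.sub = w.sub.onCovar α := by
  induction S with
  | nil => obtain ⟨_, h, _⟩ := hα; cases h
  | cons F S ih =>
    by_cases hF : F.eqns.any (Eqn.definesCovar α) = true
    · rw [Stack.dropTo, if_pos hF]
      obtain ⟨ε, T, hE⟩ := Eqn.any_definesCovar.1 hF
      obtain ⟨_, hp, ht, _, hσ⟩ := h.2 _ hE
      exact ⟨Nat.lt_succ_self _, h.1, F, List.mem_cons_self, T, hp ▸ hE, ht, hσ.symm⟩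
    · rw [Stack.dropTo, if_neg hF]
      have hα' := (Stack.definesCovar_cons.1 hα).resolve_left
        fun h => hF (Eqn.any_definesCovar.2 h)
      obtain ⟨hlt, hok, F', hF', h'⟩ := ih h.1 hα'
      exact ⟨Nat.lt_succ_of_lt hlt, hok, F', List.mem_cons_of_mem _ hF', h'⟩

/-- Each lookup discards at least one frame, hence the recursion on the length of the stack. The
world is unchanged, as it may keep entries for names that are gone. -/
theorem World.MemOK.resolve_box {M : Mem} (ok : w.MemOK R M) {V : Val} {S : Coval} {A : Ty}
    (hA : A.pol = .box) (hV : HT (w.ctx M) (.val V A)) (hS : HT (w.ctx M) (.coval S A)) :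
    ∃ M' S', Steps (M, .cutPos .box (.ofVal V) S) (M', .cutPos .box (.ofVal V) S') ∧
      w.MemOK R M' ∧ HT (w.ctx M') (.val V A) ∧ HT (w.ctx M') (.coval S' A) ∧
      S'.subst w.sub = S.subst w.sub ∧ (S' = .covar tp ∨ ∀ α, S' ≠ .covar α) := by
  by_cases hα : ∃ α, S = .covar α
  swap
  · exact ⟨M, S, .refl, ok, hV, hS, rfl, .inr fun α h => hα ⟨α, h⟩⟩
  obtain ⟨α, rfl⟩ := hα
  by_cases hα : α = tp
  · exact ⟨M, _, .refl, ok, hV, hS, rfl, .inl (by rw [hα])⟩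
  cases hS with
  | coAx hS =>
    obtain ⟨hS, rfl⟩ := hS
    obtain ⟨hlt, hok, F, hF, T, hE, hT, hσ⟩ := ok.stack.dropTo (hS.resolve_left hα)
    have ok' : w.MemOK R (M.restrict α) := ⟨ok.heap, hok, ok.type_tp, ok.sub_tp⟩
    -- The truncation is safe because the value, being of modal type, is typed over the heap alone,
    -- and the heap is kept whole.
    have hV' : HT (w.ctx (M.restrict α)) (.val V (w.tc α)) :=
      ((hV.modal_of_box hA).mono ok.modal_le).mono (w.heapCtx_le (M.restrict α))
    obtain ⟨M', S', hs, ok'', tV, tS, hσ', hn⟩ := resolve_box ok' hA hV' hT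
    rw [hA] at hE
    exact ⟨M', S', .head (.evalBox ⟨F, hF, hE⟩) hs, ok'', tV, tS, hσ'.trans hσ, hn⟩
termination_by M.stack.length

/-! ### Evaluation of states -/

/-- The state reaches either a returned value or a state that simulates a reduction, without
changing the command that it unfolds to. -/
theorem World.MemOK.normalize (ok : w.MemOK R M) (hR : R.pol = .box) {c : Cmd}
    (hc : HT (w.ctx M) (.cmd c)) :
    ∃ M' c', Steps (M, c) (M', c') ∧ w.MemOK R M' ∧ c'.subst w.sub = c.subst w.sub ∧
      ((∃ V, c' = ret V ∧ HT (w.ctx M') (.val V R)) ∨ w.Simulates R M' c') := by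
  have htp : (w.tc tp).pol = .box := by rw [ok.type_tp, hR]
  cases hc with
  | @cutPos _ p t S A hA ht hS =>
    cases ht with
    | muPos hq hc =>
      cases PosPol.toPol_injective (hA.symm.trans hq)
      exact ⟨M, _, .refl, ok, rfl, .inr (ok.simulates_muPos hR hA hc hS)⟩
    | ofVal _ hV =>
      cases p with
      | plus =>
        obtain ⟨S', hs, ht, hσ, hn⟩ := ok.stack.resolve_plus htp (fun _ h => h) hA hS
        exact ⟨M, _, hs _, ok, by simp only [Tm.subst, hσ],
          .inr (ok.simulates_cutPos hA hV ht hn)⟩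
      | box =>
        obtain ⟨M', S', hs, ok', tV, tS, hσ, hn⟩ := ok.resolve_box hA hV hS
        refine ⟨M', _, hs, ok', by simp only [Tm.subst, hσ], ?_⟩
        rcases hn with rfl | hn
        · refine .inl ⟨_, rfl, ?_⟩
          cases tS with
          | coAx h => exact (h.2.trans ok.type_tp) ▸ tV
        · exact .inr (ok'.simulates_cutPos hA tV tS hn)
  | @cutNeg _ V e A hA hV he =>
    cases he with
    | mutNeg _ hc => exact ⟨M, _, .refl, ok, rfl, .inr (ok.simulates_mutNeg hA hV hc)⟩
    | ofCoval _ hS =>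
      obtain ⟨V', hs, ht, hσ, hn⟩ := ok.stack.resolve_val ok.heap (fun _ h => h) hA hV
      exact ⟨M, _, hs _, ok, by simp only [Tm.subst, hσ],
        .inr (ok.simulates_cutNeg hR hA ht hS hn)⟩

/-- If the command that a well-typed state unfolds to returns a value, then so does the
machine. -/
theorem World.MemOK.evaluates (hR : R.pol = .box) {d : Cmd} {V : Val}
    (hd : Relation.ReflTransGen Red d (ret V)) {w : World} {M : Mem} {c : Cmd}
    (ok : w.MemOK R M) (hc : HT (w.ctx M) (.cmd c)) (hcd : c.subst w.sub = d) :
    ∃ (w' : World) (M' : Mem) (V' : Val), Steps (M, c) (M', ret V') ∧ w'.MemOK R M' ∧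
      HT (w'.ctx M') (.val V' R) ∧ V'.subst w'.sub = V := by
  induction hd using Relation.ReflTransGen.head_induction_on generalizing w M c with
  | refl =>
    obtain ⟨M', c', hs, ok', hσ, ⟨V', rfl, hV'⟩ | ⟨d', hd', _⟩⟩ := ok.normalize hR hc
    · have := hσ.trans hcd
      simp only [ret, Tm.subst, Tm.cutPos.injEq, Tm.ofVal.injEq, true_and] at this
      exact ⟨w, M', V', hs, ok', hV', this.1⟩
    · rw [hσ, hcd] at hd'
      exact (not_red_ret _ _ hd').elim
  | head h _ ih =>
    obtain ⟨M', c', hs, ok', hσ, ⟨V', rfl, hV'⟩ | ⟨d', hd', w', M'', c'', hstep, ok'', hc'', hcd''⟩⟩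
      := ok.normalize hR hc
    -- A returned state unfolds to a returned command, because `tp` unfolds to itself. This
    -- contradicts the reduction at hand.
    · have hret : (ret V').subst w.sub = ret (V'.subst w.sub) := by
        simp only [ret, Tm.subst, ok.sub_tp]
      rw [← hcd, ← hσ, hret] at h
      exact (not_red_ret _ _ h).elim
    · rw [hσ, hcd] at hd'
      -- By determinism the simulated reduction is the next one of the given sequence.
      obtain ⟨w₁, M₁, V₁, hs₁, h₁⟩ := ih ok'' hc'' (hcd''.trans (hd'.deterministic h))
      exact ⟨w₁, M₁, V₁, hs.trans (.head hstep hs₁), h₁⟩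

/-! ### Reading the result back from the heap -/

/-- The world's substitution solves every heap equation, so replacing a variable by its stored value
does not change the unfolding. Each replacement leaves a value over the older equations; at the end
it is closed. -/
theorem World.HeapOK.applyTo {H : Heap} (h : w.HeapOK H) {V : Val} {A : Ty}
    (hV : HT (w.heapCtx H) (.val V A)) :
    HT .empty (.val (H.applyTo V) A) ∧ H.applyTo V = V.subst w.sub := by
  induction H generalizing V with
  | nil =>
    have hV' : HT .empty (.val V A) :=
      hV.mono ⟨fun _ _ h => h.elim, fun _ _ ⟨⟨_, h, _⟩, _⟩ => (List.not_mem_nil h).elim,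
        fun _ _ h => h.elim⟩
    refine ⟨hV', ?_⟩
    -- On a closed value the world's substitution agrees with the identity.
    have := hV'.subst_val_eq (σ := .ident) (τ := w.sub)
      ⟨fun _ _ h => h.elim, fun _ _ h => h.elim, fun _ _ h => h.elim⟩
    rwa [Tm.subst_ident] at this
  | cons e H ih =>
    obtain ⟨h, hp, ht, he, hσ⟩ := h
    have hV' : HT (w.heapCtx H) (.val (V.substFree e.name e.val) A) := by
      refine hV.subst ⟨fun _ _ h => h.elim, ?_, fun _ _ h => h.elim⟩
      rintro x _ ⟨hx, rfl⟩
      simp only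
      split
      · next h => subst h; exact ht.mono ⟨fun _ _ h => h.elim, fun _ _ h => h, fun _ _ h => h.elim⟩
      · next h' =>
        exact .boxAx ⟨(Heap.defines_cons.1 hx).resolve_left fun h => h' h.symm, rfl⟩
    obtain ⟨h₁, h₂⟩ := ih h hV'
    refine ⟨h₁, h₂.trans ?_⟩
    rw [Tm.substFree, Tm.subst_subst]
    congr 1
    apply Sub.ext_fun
    · intro x
      simp only [Sub.comp]
      split
      · next h => rw [h, hσ]
      · rfl
    · intro α
      rfl

theorem World.MemOK.noRef (ok : w.MemOK R M) {V : Val} {A : Ty}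
    (hV : HT (w.heapCtx M.heap) (.val V A)) : NoRef V M.stack := by
  intro F hF E hE
  cases E with
  | var x π W =>
    intro hx
    obtain ⟨_, h | h⟩ := hV.freeVar hx
    · exact h
    · exact ok.stack.not_defines ⟨F, hF, π, W, hE⟩ h.1
  | covar α ε T => exact fun hα => (hV.freeCovar hα).elim fun _ h => h

end Machine

end LBox

theorem mainTheorem2 (R : LBox.Ty) (hR : R.pol = LBox.Pol.box) (c : LBox.Cmd)
    (hc : LBox.Typed [] [] [(LBox.tp, R)] (LBox.Judg.cmd c)) :
    ∃ V : LBox.Val, LBox.EvaluatesTo R c V ∧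
      ∃ (V' : LBox.Val) (H : LBox.Heap) (S : LBox.Stack),
        Relation.ReflTransGen LBox.Step (⟨[], []⟩, c) (⟨H, S⟩, LBox.ret V') ∧
        LBox.NoRef V' S ∧ LBox.Heap.applyTo H V' = V := by
  have hc₀ : LBox.HT (.top R) (.cmd c) := by
    refine hc.toHT.mono ⟨fun _ _ h => (List.not_mem_nil h).elim,
      fun _ _ h => (List.not_mem_nil h).elim, fun α A h => ?_⟩
    cases List.mem_singleton.1 h
    exact ⟨rfl, rfl⟩
  obtain ⟨V, hV⟩ := hc₀.halts hR
  -- The initial world unfolds every name to itself. Only the type given to `tp` matters, since the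
  -- memory is empty.
  have hc₁ : LBox.HT (LBox.World.ctx ⟨fun _ => R, fun _ => R, .ident⟩ ⟨[], []⟩) (.cmd c) :=
    hc₀.mono ⟨fun _ _ h => h.elim, fun _ _ h => h.elim, fun _ _ h => ⟨.inl h.1, h.2⟩⟩
  obtain ⟨w, ⟨H, S⟩, V', hs, ok, hV', hσ⟩ :=
    LBox.World.MemOK.evaluates hR hV (M := ⟨[], []⟩) ⟨trivial, trivial, rfl, rfl⟩ hc₁ (LBox.Tm.subst_ident c)
  -- The type `R` is modal, so the returned value depends on the heap only.
  have hH := (hV'.modal_of_box hR).mono ok.modal_le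
  obtain ⟨ht, happ⟩ := ok.heap.applyTo hH
  -- The typing of `V` in the empty context is that of the machine's result after substitution of
  -- the heap.
  rw [happ, hσ] at ht
  exact ⟨V, ⟨ht.toTyped ⟨List.nodup_nil, List.nodup_nil⟩
    ⟨fun _ _ h => h.elim, fun _ _ h => h.elim, fun _ _ h => h.elim⟩, hV,
    fun W hW => LBox.ret_unique hV hW⟩, V', H, S, hs, ok.noRef hH, happ.trans hσ⟩
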